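/- Let $k$ be an algebraically closed field of characteristic zero, let $x$ be a closed point of $X=\mathbb{P}^1_k$, put $D=x$, and let $r\ge 1$ be an integer. A parabolic bundle $\mathcal{E}_*$ on $X$ (with parabolic structure over $D$ and weights in $\frac1r\mathbb{Z}$) is a functor $\mathcal{E}_*:(\frac1r\mathbb{Z})^{\mathrm{op}}\to \mathrm{Vect}(X)$ together with a natural isomorphism $j:\mathcal{E}_*\otimes\mathcal{O}_X(-D)\to\mathcal{E}_{*+1}$ whose composite with the structure maps $\mathcal{E}_{*+1}\to\mathcal{E}_*$ is the natural map $\mathcal{E}_*\otimes\mathcal{O}_X(-D)\to\mathcal{E}_*$; morphisms are natural transformations compatible with $j$. The underlying bundle is $\mathcal{E}_0$, the rank is $\mathrm{rk}(\mathcal{E}_0)$, a parabolic line bundle is a parabolic bundle of rank $1$, and the parabolic degree and slope are $$\deg_{\mathrm{par}}(\mathcal{E}_*)=\mathrm{rk}(\mathcal{E}_0)\,(\deg D-\chi(\mathcal{O}_X))+\frac1r\sum_{i=1}^r\chi(\mathcal{E}_{i/r}),\qquad \mu(\mathcal{E}_*)=\frac{\deg_{\mathrm{par}}(\mathcal{E}_*)}{\mathrm{rk}(\mathcal{E}_0)}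 .$$ A parabolic subbundle of $\mathcal{E}_*$ is a morphism of parabolic bundles $\mathcal{F}_*\to\mathcal{E}_*$ such that every $\mathcal{F}_{i/r}\to\mathcal{E}_{i/r}$ is injective with locally free cokernel, and $\mathcal{E}_*$ is semistable if $\mu(\mathcal{F}_*)\le\mu(\mathcal{E}_*)$ for all nonzero parabolic subbundles $\mathcal{F}_*$. Let $\mathcal{E}_*$ be a parabolic bundle of rank $n$ on $\mathbb{P}^1_k$ with the single parabolic point $x$. Then $\mathcal{E}_*$ is semistable if and only if there is a parabolic line bundle $\mathcal{L}_*$ (with weights in $\frac1r\mathbb{Z}$) such that $\mathcal{E}_*\cong\mathcal{L}_*^{\oplus n}$. In particular, if $\mathcal{E}_*$ is semistable, then its underlying bundle satisfies $\mathcal{E}_0\cong\mathcal{O}(a)^{\oplus n}$ for some integer $a$. -/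

import Mathlib

open CategoryTheory Limits AlgebraicGeometry TopologicalSpace MonoidalCategory

universe u

noncomputable section

namespace ParabolicP1

/-! ### Vector bundles on a scheme -/

section VectorBundles

variable {X : Scheme.{u}}

instance hasFiniteBiproductsModules : HasFiniteBiproducts X.Modules :=
  Abelian.hasFiniteBiproducts

/-- The structure sheaf `𝒪_X` as an `𝒪_X`-module. -/
def structureModule (X : Scheme.{u}) : X.Modules :=
  SheafOfModules.unit X.ringCatSheaf

/-- The direct sum `M^{⊕n}`. -/
def power (M : X.Modules) (n : ℕ) : X.Modules :=
  ⨁ fun _ : Fin n ↦ M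

/-- `M` is locally free of rank `n`: every point has an open neighbourhood `U` with
`M|_U ≅ 𝒪_U^{⊕n}`. -/
def IsLocallyFreeOfRank (M : X.Modules) (n : ℕ) : Prop :=
  ∀ p : X, ∃ U : X.Opens, p ∈ U ∧
    Nonempty (M.restrict U.ι ≅ power (structureModule (U : Scheme.{u})) n)

/-- Vector bundles (of constant rank; the scheme used below is connected). -/
def IsVectorBundle (M : X.Modules) : Prop :=
  ∃ n : ℕ, IsLocallyFreeOfRank M n

/-- The rank of a vector bundle on a nonempty scheme, i.e. the unique `n` such that `M` is
locally free of rank `n`. -/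
def rank (M : X.Modules) : ℕ :=
  sInf {n | IsLocallyFreeOfRank M n}

end VectorBundles

/-! ### The functor `M ↦ M ⊗ 𝒪_X(-D)` for the reduced divisor `D = x` -/

section Twist

variable {X : Scheme.{u}}

/-- Sections over `U` of the ideal sheaf `𝒪_X(-x)`: the functions on `U` that vanish at `x`
(no condition if `x ∉ U`). -/
def pointIdeal (x : X) (U : X.Opens) : Ideal Γ(X, U) :=
  ⨅ hx : x ∈ U, RingHom.ker (X.evaluation U x hx).hom

theorem map_mem_pointIdeal (x : X) {U V : X.Opens} (h : V ≤ U) {f : Γ(X, U)}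
    (hf : f ∈ pointIdeal x U) : X.presheaf.map (homOfLE h).op f ∈ pointIdeal x V := by
  simp only [pointIdeal, Ideal.mem_iInf, RingHom.mem_ker] at hf ⊢
  intro hx
  rw [← hf (h hx)]
  simp only [← Scheme.germ_residue, CommRingCat.hom_comp, RingHom.comp_apply]
  rw [TopCat.Presheaf.germ_res_apply]

/-- The ideal sheaf `𝒪_X(-x)`, as a presheaf of modules. -/
def idealPresheaf (x : X) :
    PresheafOfModules.{u} (X.presheaf ⋙ forget₂ CommRingCat.{u} RingCat.{u}) where
  obj U := ModuleCat.of Γ(X, U.unop) (pointIdeal x U.unop)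
  map {U V} f := ModuleCat.ofHom
    (Y := (ModuleCat.restrictScalars
      ((X.presheaf ⋙ forget₂ CommRingCat.{u} RingCat.{u}).map f).hom).obj
        (ModuleCat.of Γ(X, V.unop) (pointIdeal x V.unop)))
    { toFun := fun s ↦ ⟨X.presheaf.map f s.1, map_mem_pointIdeal x (leOfHom f.unop) s.2⟩
      map_add' := fun s t ↦ Subtype.ext (map_add (X.presheaf.map f).hom s.1 t.1)
      map_smul' := fun a s ↦ Subtype.ext (map_mul (X.presheaf.map f).hom a s.1) }
  map_id U := by
    ext s
    exact Subtype.ext (congr($(X.presheaf.map_id U) s.1))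
  map_comp f g := by
    ext s
    exact Subtype.ext (congr($(X.presheaf.map_comp f g) s.1))

/-- The inclusion `𝒪_X(-x) ⟶ 𝒪_X`. -/
def idealInclusion (x : X) :
    idealPresheaf x ⟶ 𝟙_ (PresheafOfModules.{u} (X.presheaf ⋙ forget₂ CommRingCat.{u} RingCat.{u}))
    where
  app U := ModuleCat.ofHom (X := pointIdeal x U.unop) (Y := Γ(X, U.unop))
    (pointIdeal x U.unop).subtype
  naturality f := by
    ext s
    rfl

variable (X) in
/-- The presheaf of modules underlying an `𝒪_X`-module. -/
def toPresheafModules : X.Modules ⥤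
    PresheafOfModules.{u} (X.presheaf ⋙ forget₂ CommRingCat.{u} RingCat.{u}) :=
  SheafOfModules.forget X.ringCatSheaf

variable (X) in
/-- Sheafification of presheaves of modules. -/
def sheafifyModules :
    PresheafOfModules.{u} (X.presheaf ⋙ forget₂ CommRingCat.{u} RingCat.{u}) ⥤ X.Modules :=
  let a : PresheafOfModules.{u} X.ringCatSheaf.obj ⥤ SheafOfModules.{u} X.ringCatSheaf :=
    PresheafOfModules.sheafification (𝟙 X.ringCatSheaf.obj)
  a

variable (X) in
/-- A sheaf is its own sheafification. -/
def sheafifyCounit : toPresheafModules X ⋙ sheafifyModules X ⟶ 𝟭 X.Modules :=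
  let adj : PresheafOfModules.sheafification (𝟙 X.ringCatSheaf.obj) ⊣
      SheafOfModules.forget X.ringCatSheaf :=
    PresheafOfModules.sheafificationAdjunction (𝟙 X.ringCatSheaf.obj)
  adj.counit

/-- The functor `M ↦ M ⊗ 𝒪_X(-x)` on `𝒪_X`-modules: the sheaf associated with the presheaf
`U ↦ M(U) ⊗ 𝒪_X(-x)(U)`. -/
def twist (x : X) : X.Modules ⥤ X.Modules :=
  toPresheafModules X ⋙ tensorRight (idealPresheaf x) ⋙ sheafifyModules X

/-- The natural morphism `M ⊗ 𝒪_X(-x) ⟶ M ⊗ 𝒪_X = M`. -/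
def twistInclusion (x : X) : twist x ⟶ 𝟭 X.Modules :=
  Functor.whiskerLeft (toPresheafModules X) (Functor.whiskerRight
    (((curriedTensor _).flip.map (idealInclusion x)) ≫ (rightUnitorNatIso _).hom)
      (sheafifyModules X)) ≫ sheafifyCounit X

end Twist

/-! ### Parabolic bundles -/

section Parabolic

/-- The functor `i ↦ i + r` on `ℤᵒᵖ`. With `i` standing for `i/r`, this is the shift by `1` on
`((1/r)ℤ)ᵒᵖ`. -/
def shiftFunctor (r : ℕ) : ℤᵒᵖ ⥤ ℤᵒᵖ :=
  (Monotone.functor (f := fun i : ℤ ↦ i + r) fun _ _ h ↦ by simpa using h).op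

/-- Vector bundles on `X` with parabolic structure over the reduced divisor `D = x` and
parabolic weights in `(1/r)ℤ`. The ordered set `(1/r)ℤ` is identified with `ℤ` through
`i/r ↔ i`, so that `functor.obj (op i)` is `F_{i/r}`. -/
structure ParabolicBundle (X : Scheme.{u}) (x : X) (r : ℕ) where
  /-- the functor `F_* : ((1/r)ℤ)ᵒᵖ ⥤ Vect(X)` -/
  functor : ℤᵒᵖ ⥤ X.Modules
  isVectorBundle : ∀ i : ℤ, IsVectorBundle (functor.obj (.op i))
  /-- the natural isomorphism `j : F_* ⊗ 𝒪_X(-D) ≅ F_*[1]` -/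
  j : functor ⋙ twist x ≅ shiftFunctor r ⋙ functor
  triangle : ∀ i : ℤ,
    j.hom.app (.op i) ≫ functor.map (homOfLE (by simp : i ≤ i + (r : ℤ))).op =
      (twistInclusion x).app (functor.obj (.op i))

namespace ParabolicBundle

variable {X : Scheme.{u}} {x : X} {r : ℕ}

/-- Morphisms of parabolic bundles: natural transformations that commute with `j`. -/
@[ext]
structure Hom (E F : ParabolicBundle X x r) where
  hom : E.functor ⟶ F.functor
  comm : Functor.whiskerRight hom (twist x) ≫ F.j.hom =
    E.j.hom ≫ Functor.whiskerLeft (shiftFunctor r) hom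

instance : Category (ParabolicBundle X x r) where
  Hom := Hom
  id E := ⟨𝟙 _, by simp⟩
  comp f g := ⟨f.hom ≫ g.hom, by
    rw [Functor.whiskerRight_comp, Category.assoc, g.comm, ← Category.assoc, f.comm,
      Category.assoc, Functor.whiskerLeft_comp]⟩
  id_comp f := Hom.ext (Category.id_comp f.hom)
  comp_id f := Hom.ext (Category.comp_id f.hom)
  assoc f g h := Hom.ext (Category.assoc f.hom g.hom h.hom)

/-- The vector bundle `E_{i/r}`. -/
def bundle (E : ParabolicBundle X x r) (i : ℤ) : X.Modules :=
  E.functor.obj (.op i)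

/-- The underlying vector bundle `E_0`. -/
def underlying (E : ParabolicBundle X x r) : X.Modules :=
  E.bundle 0

/-- The rank of a parabolic bundle is that of its underlying vector bundle. -/
def rank (E : ParabolicBundle X x r) : ℕ :=
  ParabolicP1.rank E.underlying

/-- `E_*` is isomorphic to `(L_*)^{⊕n}`: there are morphisms of parabolic bundles `ι_a : L ⟶ E`
and `π_a : E ⟶ L` (`a < n`) that make `E` a direct sum of `n` copies of `L`. -/
def IsDirectSumOfCopies (E L : ParabolicBundle X x r) (n : ℕ) : Prop :=
  ∃ (ι : Fin n → (L ⟶ E)) (π : Fin n → (E ⟶ L)),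
    (∀ a, ι a ≫ π a = 𝟙 L) ∧ (∀ a b, a ≠ b → (ι a).hom ≫ (π b).hom = 0) ∧
      ∑ a, (π a).hom ≫ (ι a).hom = 𝟙 E.functor

/-- A morphism of parabolic bundles `F ⟶ E` is the inclusion of a parabolic subbundle if each
`F_{i/r} ⟶ E_{i/r}` is the inclusion of a subbundle, i.e. is injective with locally free
quotient. -/
def IsSubbundle {F E : ParabolicBundle X x r} (f : F ⟶ E) : Prop :=
  ∀ i : ℤ, Mono (f.hom.app (.op i)) ∧ IsVectorBundle (cokernel (f.hom.app (.op i)))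

end ParabolicBundle

end Parabolic

/-! ### The projective line and Euler characteristics -/

section ProjectiveLine

variable (k : Type u) [Field k]

attribute [instance] MvPolynomial.gradedAlgebra

/-- The projective line `Proj k[X₀, X₁]`. -/
abbrev P1 : Scheme.{u} :=
  Proj (MvPolynomial.homogeneousSubmodule (Fin 2) k)

/-- The standard affine open subset `X_i ≠ 0` of the projective line. -/
def chart (i : Fin 2) : (P1 k).Opens :=
  Proj.basicOpen (MvPolynomial.homogeneousSubmodule (Fin 2) k) (MvPolynomial.X i)

/-- The structure morphism of the projective line. -/
def toSpec : P1 k ⟶ Spec (.of k) :=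
  Proj.toSpecZero (MvPolynomial.homogeneousSubmodule (Fin 2) k) ≫
    Spec.map (CommRingCat.ofHom
      (algebraMap k (MvPolynomial.homogeneousSubmodule (Fin 2) k 0)))

/-- The constant functions on an open subset of the projective line. -/
def scalars (U : (P1 k).Opens) : k →+* Γ(P1 k, U) :=
  ((Scheme.ΓSpecIso (.of k)).inv ≫ (toSpec k).appTop ≫ (P1 k).presheaf.map U.leTop.op).hom

variable {k}

theorem map_scalars {U V : (P1 k).Opens} (h : V ≤ U) (c : k) :
    (P1 k).presheaf.map (homOfLE h).op (scalars k U c) = scalars k V c := by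
  rfl

/-- The `k`-vector space structure on sections of an `𝒪`-module on the projective line. -/
instance sectionsModule (M : (P1 k).Modules) (U : (P1 k).Opens) : Module k Γ(M, U) :=
  Module.compHom _ (scalars k U)

/-- Restriction of sections, as a `k`-linear map. -/
def restrictSections (M : (P1 k).Modules) {U V : (P1 k).Opens} (h : V ≤ U) :
    Γ(M, U) →ₗ[k] Γ(M, V) where
  toFun s := M.presheaf.map (homOfLE h).op s
  map_add' s t := map_add _ s t
  map_smul' c s := by
    change M.presheaf.map (homOfLE h).op (scalars k U c • s) = scalars k V c • _
    rw [Scheme.Modules.map_smul, map_scalars]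

/-- The differential `M(U₀) × M(U₁) → M(U₀ ∩ U₁)` of the Čech complex of `M` for the cover of the
projective line by its two standard affine open subsets. -/
def cechDifferential (M : (P1 k).Modules) :
    (Γ(M, chart k 0) × Γ(M, chart k 1)) →ₗ[k] Γ(M, chart k 0 ⊓ chart k 1) :=
  (restrictSections M inf_le_left).comp (LinearMap.fst k _ _) -
    (restrictSections M inf_le_right).comp (LinearMap.snd k _ _)

/-- The Euler characteristic `χ(M) = dim H⁰(M) - dim H¹(M)` (the cohomology of a quasi-coherent
sheaf is that of its Čech complex for the standard affine cover). -/
def eulerChar (M : (P1 k).Modules) : ℤ :=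
  (Module.finrank k (LinearMap.ker (cechDifferential M)) : ℤ) -
    Module.finrank k (Γ(M, chart k 0 ⊓ chart k 1) ⧸ LinearMap.range (cechDifferential M))

end ProjectiveLine

/-! ### The line bundles `𝒪(a)` on the projective line -/

section SerreTwist

variable (k : Type u) [Field k]

/-- The regular function `X_j / X_i` on the chart `X_i ≠ 0`. -/
def coordinate (i j : Fin 2) : Γ(P1 k, chart k i) :=
  Proj.awayToSection (MvPolynomial.homogeneousSubmodule (Fin 2) k) (MvPolynomial.X i)
    (HomogeneousLocalization.Away.mk (MvPolynomial.homogeneousSubmodule (Fin 2) k)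
      (MvPolynomial.isHomogeneous_X k i) 1 (MvPolynomial.X j)
      (by simpa using MvPolynomial.isHomogeneous_X k j))

/-- The transition function `(X₁ / X₀)^a` on `U₀ ∩ U₁`, where `a` may be negative. -/
def transition (a : ℤ) : Γ(P1 k, chart k 0 ⊓ chart k 1) :=
  (P1 k).presheaf.map (homOfLE inf_le_left).op (coordinate k 0 1) ^ a.toNat *
    (P1 k).presheaf.map (homOfLE inf_le_right).op (coordinate k 1 0) ^ (-a).toNat

variable {k}

/-- Restriction of functions. -/
def res {U V : (P1 k).Opens} (h : V ≤ U) : Γ(P1 k, U) →+* Γ(P1 k, V) :=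
  ((P1 k).presheaf.map (homOfLE h).op).hom

theorem res_res {U V W : (P1 k).Opens} (h : V ≤ U) (h' : W ≤ V) (s : Γ(P1 k, U)) :
    res h' (res h s) = res (h'.trans h) s := by
  simp only [res, ← CommRingCat.comp_apply, ← Functor.map_comp]
  rfl

theorem res_self {U : (P1 k).Opens} (h : U ≤ U) (s : Γ(P1 k, U)) : res h s = s := by
  change (P1 k).presheaf.map (𝟙 (.op U)) s = s
  rw [CategoryTheory.Functor.map_id]
  rfl

theorem exists_gluing {ι : Type u} (W : ι → (P1 k).Opens) (V : (P1 k).Opens) (h : ∀ i, W i ≤ V)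
    (hV : V ≤ iSup W) (s : ∀ i, Γ(P1 k, W i))
    (hs : ∀ i j, res (V := W i ⊓ W j) inf_le_left (s i) = res inf_le_right (s j)) :
    ∃ t : Γ(P1 k, V), ∀ i, res (h i) t = s i :=
  (TopCat.Sheaf.existsUnique_gluing' (P1 k).sheaf W V (fun i ↦ homOfLE (h i)) hV s hs).exists

theorem eq_of_res_eq {ι : Type u} (W : ι → (P1 k).Opens) (V : (P1 k).Opens) (h : ∀ i, W i ≤ V)
    (hV : V ≤ iSup W) (s t : Γ(P1 k, V)) (hs : ∀ i, res (h i) s = res (h i) t) : s = t :=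
  TopCat.Sheaf.eq_of_locally_eq' (P1 k).sheaf W V (fun i ↦ homOfLE (h i)) hV s t hs

/-- The sections of `𝒪(a)` over `V`: pairs of functions `s₀` on `V ∩ U₀` and `s₁` on `V ∩ U₁` with
`s₀ = (X₁ / X₀)^a s₁` on `V ∩ U₀ ∩ U₁`. -/
def serreSections (a : ℤ) (V : (P1 k).Opens) :
    AddSubgroup (Γ(P1 k, V ⊓ chart k 0) × Γ(P1 k, V ⊓ chart k 1)) where
  carrier := {s | res (V := V ⊓ (chart k 0 ⊓ chart k 1)) (inf_le_inf_left V inf_le_left) s.1 =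
    res inf_le_right (transition k a) * res (inf_le_inf_left V inf_le_right) s.2}
  zero_mem' := by simp
  add_mem' {s t} hs ht := by
    simp only [Set.mem_ofPred_eq, Prod.fst_add, Prod.snd_add, map_add] at hs ht ⊢
    rw [hs, ht, mul_add]
  neg_mem' {s} hs := by
    simp only [Set.mem_ofPred_eq, Prod.fst_neg, Prod.snd_neg, map_neg] at hs ⊢
    rw [hs, mul_neg]

instance (a : ℤ) (V : (P1 k).Opens) : SMul Γ(P1 k, V) (serreSections a V) where
  smul f s := ⟨(res inf_le_left f * s.1.1, res inf_le_left f * s.1.2), by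
    have hs := s.2
    simp only [serreSections, AddSubgroup.mem_mk, AddSubmonoid.mem_mk, AddSubsemigroup.mem_mk,
      Set.mem_ofPred_eq, map_mul, res_res] at hs ⊢
    rw [hs, mul_left_comm]⟩

theorem serre_smul_fst {a : ℤ} {V : (P1 k).Opens} (f : Γ(P1 k, V)) (s : serreSections a V) :
    (f • s).1.1 = res inf_le_left f * s.1.1 := rfl

theorem serre_smul_snd {a : ℤ} {V : (P1 k).Opens} (f : Γ(P1 k, V)) (s : serreSections a V) :
    (f • s).1.2 = res inf_le_left f * s.1.2 := rfl

theorem serre_ext {a : ℤ} {V : (P1 k).Opens} {s t : serreSections a V} (h₁ : s.1.1 = t.1.1)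
    (h₂ : s.1.2 = t.1.2) : s = t :=
  Subtype.ext (Prod.ext h₁ h₂)

instance (a : ℤ) (V : (P1 k).Opens) : Module Γ(P1 k, V) (serreSections a V) where
  one_smul s := serre_ext (by simp [serre_smul_fst]) (by simp [serre_smul_snd])
  mul_smul f g s := serre_ext (by simp [serre_smul_fst, mul_assoc])
    (by simp [serre_smul_snd, mul_assoc])
  smul_zero f := serre_ext (by simp [serre_smul_fst]) (by simp [serre_smul_snd])
  smul_add f s t := serre_ext (by simp [serre_smul_fst, mul_add])
    (by simp [serre_smul_snd, mul_add])
  add_smul f g s := serre_ext (by simp [serre_smul_fst, add_mul])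
    (by simp [serre_smul_snd, add_mul])
  zero_smul s := serre_ext (by simp [serre_smul_fst]) (by simp [serre_smul_snd])

/-- Restriction of sections of `𝒪(a)`. -/
def serreRes (a : ℤ) {U V : (P1 k).Opens} (h : V ≤ U) :
    serreSections a U →+ serreSections a V where
  toFun s := ⟨(res (inf_le_inf_right _ h) s.1.1, res (inf_le_inf_right _ h) s.1.2), by
    have hs := congr(res (inf_le_inf_right (chart k 0 ⊓ chart k 1) h) $(s.2))
    simpa only [serreSections, AddSubgroup.mem_mk, AddSubmonoid.mem_mk, AddSubsemigroup.mem_mk,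
      Set.mem_ofPred_eq, map_mul, res_res] using hs⟩
  map_zero' := serre_ext (map_zero _) (map_zero _)
  map_add' s t := serre_ext (map_add _ _ _) (map_add _ _ _)

theorem mem_serreSections {a : ℤ} {V : (P1 k).Opens}
    {s : Γ(P1 k, V ⊓ chart k 0) × Γ(P1 k, V ⊓ chart k 1)} :
    s ∈ serreSections a V ↔
      res (V := V ⊓ (chart k 0 ⊓ chart k 1)) (inf_le_inf_left V inf_le_left) s.1 =
        res inf_le_right (transition k a) * res (inf_le_inf_left V inf_le_right) s.2 :=
  Iff.rfl

variable (k) in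
/-- `𝒪(a)` as a presheaf of abelian groups. -/
def serrePresheafAb (a : ℤ) : TopCat.Presheaf Ab.{u} (P1 k) where
  obj U := AddCommGrpCat.of (serreSections a U.unop)
  map f := AddCommGrpCat.ofHom (serreRes a (leOfHom f.unop))
  map_id _ := AddCommGrpCat.hom_ext (AddMonoidHom.ext fun s ↦
    serre_ext (res_self _ s.1.1) (res_self _ s.1.2))
  map_comp _ _ := AddCommGrpCat.hom_ext (AddMonoidHom.ext fun s ↦
    serre_ext (res_res _ _ s.1.1).symm (res_res _ _ s.1.2).symm)

theorem serrePresheafAb_isSheaf (a : ℤ) : (serrePresheafAb k a).IsSheaf := by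
  rw [TopCat.Presheaf.isSheaf_iff_isSheafUniqueGluing]
  intro ι U sf hsf
  change ∀ i, serreSections a (U i) at sf
  have hle (i : ι) : U i ≤ iSup U := le_iSup U i
  have hc (C : (P1 k).Opens) : iSup U ⊓ C ≤ ⨆ i, U i ⊓ C := (iSup_inf_eq U C).le
  have h0 (i j : ι) : res (V := U i ⊓ U j ⊓ chart k 0) (inf_le_inf_right _ inf_le_left)
      (sf i).1.1 = res (inf_le_inf_right _ inf_le_right) (sf j).1.1 :=
    congr($(hsf i j).1.1)
  have h1 (i j : ι) : res (V := U i ⊓ U j ⊓ chart k 1) (inf_le_inf_right _ inf_le_left)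
      (sf i).1.2 = res (inf_le_inf_right _ inf_le_right) (sf j).1.2 :=
    congr($(hsf i j).1.2)
  have hW (C : (P1 k).Opens) (i j : ι) : (U i ⊓ C) ⊓ (U j ⊓ C) ≤ U i ⊓ U j ⊓ C :=
    le_inf (inf_le_inf inf_le_left inf_le_left) (inf_le_left.trans inf_le_right)
  obtain ⟨t₀, ht₀⟩ := exists_gluing (fun i ↦ U i ⊓ chart k 0) (iSup U ⊓ chart k 0)
    (fun i ↦ inf_le_inf_right _ (hle i)) (hc _) (fun i ↦ (sf i).1.1) (fun i j ↦ by
      simpa only [res_res] using congr(res (hW _ i j) $(h0 i j)))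
  obtain ⟨t₁, ht₁⟩ := exists_gluing (fun i ↦ U i ⊓ chart k 1) (iSup U ⊓ chart k 1)
    (fun i ↦ inf_le_inf_right _ (hle i)) (hc _) (fun i ↦ (sf i).1.2) (fun i j ↦ by
      simpa only [res_res] using congr(res (hW _ i j) $(h1 i j)))
  refine ⟨(⟨(t₀, t₁), ?_⟩ : serreSections a (iSup U)), fun i ↦ serre_ext (ht₀ i) (ht₁ i), ?_⟩
  · rw [mem_serreSections]
    refine eq_of_res_eq (fun i ↦ U i ⊓ (chart k 0 ⊓ chart k 1)) _
      (fun i ↦ inf_le_inf_right _ (hle i)) (hc _) _ _ fun i ↦ ?_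
    have e := mem_serreSections.1 (sf i).2
    rw [← ht₀ i, ← ht₁ i] at e
    simpa only [res_res, map_mul] using e
  · intro t ht
    change serreSections a (iSup U) at t
    have e (i : ι) : serreRes a (hle i) t = sf i := ht i
    refine serre_ext ?_ ?_
    · refine eq_of_res_eq (fun i ↦ U i ⊓ chart k 0) _
        (fun i ↦ inf_le_inf_right _ (hle i)) (hc _) _ _ fun i ↦ ?_
      exact congr($(e i).1.1).trans (ht₀ i).symm
    · refine eq_of_res_eq (fun i ↦ U i ⊓ chart k 1) _
        (fun i ↦ inf_le_inf_right _ (hle i)) (hc _) _ _ fun i ↦ ?_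
      exact congr($(e i).1.2).trans (ht₁ i).symm

instance (a : ℤ) (U : (P1 k).Opensᵒᵖ) :
    Module ((P1 k).ringCatSheaf.obj.obj U) ((serrePresheafAb k a).obj U) :=
  inferInstanceAs (Module Γ(P1 k, U.unop) (serreSections a U.unop))

variable (k) in
/-- The line bundle `𝒪(a)` on the projective line, glued from the structure sheaves of the
standard affine charts along the transition function `(X₁ / X₀)^a`. -/
def serreTwist (a : ℤ) : (P1 k).Modules where
  val := PresheafOfModules.ofPresheaf (R := (P1 k).ringCatSheaf.obj) (serrePresheafAb k a) (by
    intro U V f r m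
    change Γ(P1 k, U.unop) at r
    change serreSections a U.unop at m
    refine serre_ext (V := V.unop)
      (s := serreRes a (leOfHom f.unop) (r • m))
      (t := res (leOfHom f.unop) r • serreRes a (leOfHom f.unop) m) ?_ ?_
    · change res _ (res _ r * m.1.1) = res _ (res _ r) * res _ m.1.1
      simp only [map_mul, res_res]
    · change res _ (res _ r * m.1.2) = res _ (res _ r) * res _ m.1.2
      simp only [map_mul, res_res])
  isSheaf := serrePresheafAb_isSheaf a

end SerreTwist

/-! ### Semistability on the projective line with one parabolic point -/

namespace ParabolicBundle

variable {k : Type u} [Field k] {x : P1 k} {r : ℕ}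

/-- The parabolic degree
`rk(E_0) (deg D - χ(𝒪)) + (1/r) ∑_{i=1}^r χ(E_{i/r})`, where `D` is a single `k`-rational point,
so that `deg D = 1`. -/
def parabolicDegree (E : ParabolicBundle (P1 k) x r) : ℚ :=
  E.rank * (1 - eulerChar (structureModule (P1 k))) +
    1 / r * ∑ i ∈ Finset.Icc 1 r, (eulerChar (E.bundle i) : ℚ)

/-- The slope of a (nonzero) parabolic bundle. -/
def slope (E : ParabolicBundle (P1 k) x r) : ℚ :=
  E.parabolicDegree / E.rank

/-- Semistability: `μ(F_*) ≤ μ(E_*)` for all nonzero parabolic subbundles `F_*` of `E_*`. -/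
def IsSemistable (E : ParabolicBundle (P1 k) x r) : Prop :=
  ∀ (F : ParabolicBundle (P1 k) x r) (f : F ⟶ E), IsSubbundle f → 0 < F.rank →
    F.slope ≤ E.slope

end ParabolicBundle

end ParabolicP1

/-!
Everything is reduced to linear algebra over the two standard charts of the projective line, where
`t = X₁ / X₀` is the coordinate.

*Local structure.* A locally free sheaf has local frames (`IsFrame`), and the image of
`M ⊗ 𝒪(-x) ⟶ M` consists locally of the multiples of a local equation `ℓ` of `x`
(`mem_range_twistInclusion_iff_exists_smul`). As `E_{i/r + 1} ≅ E_{i/r} ⊗ 𝒪(-x)`, all structure maps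
`E_{j/r} ⟶ E_{i/r}` of a parabolic bundle are injective, sections of `E_{i/r + b}` are sections of
`E_{i/r}` multiplied by `ℓ ^ b` (`ParabolicBundle.exists_equiv`), and a natural transformation of
parabolic bundles commutes with `j` (`ParabolicBundle.comm_of_natTrans`).

*Cohomology.* For a vector bundle `M`, the sections over the charts form two subspaces `M₀`, `M₁` of
the space of sections over the overlap. They are lattices (`IsLattice`) for multiplication by `t`
and by `t⁻¹`, and `H⁰ = M₀ ⊓ M₁`, `H¹ = Γ / (M₀ ⊔ M₁)`. Twisting by a point replaces `M₁` by
`t⁻¹ M₁`, whence `χ(E_{i/r + 1}) = χ(E_{i/r}) - rank E` (`ParabolicBundle.eulerChar_period`). If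
the twist has neither `H⁰` nor `H¹`, then a basis of `H⁰(M)` generates `M` over both charts
(`le_of_twist_eq_top`).

*A semistable `E` splits.* Let `m` be the greatest integer with `H⁰(E_{m/r}) ≠ 0`. A nonzero global
section of `E_{m/r}` defines a morphism to `E` from the parabolic line bundle `L` with components
`𝒪(⌊(m - i) / r⌋)` (`ParabolicBundle.exists_natTrans_lineFunctor`). In the components `E_{i/r}`
with `m - r < i ≤ m` the section vanishes nowhere: otherwise it could be divided by the equation of
a point, and all points are linearly equivalent, so `E_{i/r + 1}` would have a nonzero section
(`ne_prime_smul`). By periodicity `L` is a subbundle of `E`. As `χ(L_{i/r}) = 0` for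
`m < i ≤ m + r`, where `χ(E_{i/r}) ≤ 0`, the inequality of slopes forces `χ(E_{i/r}) = 0` there
(`ParabolicBundle.eulerChar_eq_zero_of_isSemistable`), and these components have no cohomology. So a
basis of `H⁰(E_{m/r})` generates `E_{i/r}` for `m - r < i ≤ m`, and the morphisms from `L` that it
defines form an isomorphism from a direct sum of copies of `L` to `E`.

*A sum of copies of `L` is semistable.* Put `N = χ(L_{i/r})`. The translate `L_{i/r + N}` is a line
bundle with `χ = 0`, so it has no cohomology, and neither has `E_{i/r + N}`. Hence
`χ(E_{i/r}) = N rank E`, and a subbundle `F` satisfies `H⁰(F_{i/r + N}) = 0`, that is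
`χ(F_{i/r}) ≤ N rank F`. Summing over `i` compares the slopes.
-/

namespace ParabolicP1

/-! ### Sections of sheaves of modules -/

section Sections

variable {X : Scheme.{u}} {M N K : X.Modules} {U V W : X.Opens}

/-- Restriction of regular functions, as a ring homomorphism. -/
def ores {U V : X.Opens} (h : V ≤ U) : Γ(X, U) →+* Γ(X, V) :=
  (X.presheaf.map (homOfLE h).op).hom

/-- Restriction of sections of a sheaf of modules, as a group homomorphism. -/
def mres (M : X.Modules) {U V : X.Opens} (h : V ≤ U) : Γ(M, U) →+ Γ(M, V) :=
  (M.presheaf.map (homOfLE h).op).hom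

/-- The action of a morphism of sheaves of modules on sections, as a linear map. -/
def mapp (φ : M ⟶ N) (U : X.Opens) : Γ(M, U) →ₗ[Γ(X, U)] Γ(N, U) where
  toFun s := φ.app U s
  map_add' s t := map_add _ s t
  map_smul' a s := φ.app_smul a s

theorem ores_ores (h : V ≤ U) (h' : W ≤ V) (s : Γ(X, U)) :
    ores h' (ores h s) = ores (h'.trans h) s := by
  simp only [ores, ← CommRingCat.comp_apply, ← Functor.map_comp]
  rfl

theorem ores_self (h : U ≤ U) (s : Γ(X, U)) : ores h s = s := by
  change X.presheaf.map (𝟙 (.op U)) s = s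
  rw [CategoryTheory.Functor.map_id]
  rfl

theorem mres_mres (h : V ≤ U) (h' : W ≤ V) (s : Γ(M, U)) :
    mres M h' (mres M h s) = mres M (h'.trans h) s := by
  change (M.presheaf.map _ ≫ M.presheaf.map _) s = _
  rw [← Functor.map_comp]
  rfl

theorem mres_self (h : U ≤ U) (s : Γ(M, U)) : mres M h s = s := by
  change M.presheaf.map (𝟙 (.op U)) s = s
  rw [CategoryTheory.Functor.map_id]
  rfl

theorem mres_smul (h : V ≤ U) (a : Γ(X, U)) (s : Γ(M, U)) :
    mres M h (a • s) = ores h a • mres M h s :=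
  M.map_smul (homOfLE h) a s

theorem mapp_mres (φ : M ⟶ N) (h : V ≤ U) (s : Γ(M, U)) :
    mapp φ V (mres M h s) = mres N h (mapp φ U s) :=
  congr($((φ.mapPresheaf.naturality (homOfLE h).op)) s)

theorem mapp_comp (φ : M ⟶ N) (ψ : N ⟶ K) (s : Γ(M, U)) :
    mapp (φ ≫ ψ) U s = mapp ψ U (mapp φ U s) := rfl

theorem mapp_id (s : Γ(M, U)) : mapp (𝟙 M) U s = s := rfl

theorem mapp_add (φ ψ : M ⟶ N) (s : Γ(M, U)) :
    mapp (φ + ψ) U s = mapp φ U s + mapp ψ U s := rfl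

theorem mapp_zero (s : Γ(M, U)) : mapp (0 : M ⟶ N) U s = 0 := rfl

theorem mapp_sum {ι : Type*} (t : Finset ι) (φ : ι → (M ⟶ N)) (s : Γ(M, U)) :
    mapp (∑ i ∈ t, φ i) U s = ∑ i ∈ t, mapp (φ i) U s := by
  classical
  induction t using Finset.induction_on with
  | empty => simp [mapp_zero]
  | insert a t ha ih => rw [Finset.sum_insert ha, Finset.sum_insert ha, mapp_add, ih]

theorem hom_ext_mapp {φ ψ : M ⟶ N} (h : ∀ U s, mapp φ U s = mapp ψ U s) : φ = ψ := by
  ext U s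
  exact h U s

/-- A morphism of sheaves of modules from its effect on sections. -/
def homOfSections (f : ∀ U : X.Opens, Γ(M, U) →ₗ[Γ(X, U)] Γ(N, U))
    (hf : ∀ (U V : X.Opens) (h : V ≤ U) (s : Γ(M, U)), f V (mres M h s) = mres N h (f U s)) :
    M ⟶ N :=
  ⟨PresheafOfModules.homMk (M₁ := M.val) (M₂ := N.val)
    { app := fun U ↦ AddCommGrpCat.ofHom (f U.unop).toAddMonoidHom
      naturality := fun U V i ↦ by
        ext s
        exact hf U.unop V.unop (leOfHom i.unop) s }
    fun U r s ↦ (f U.unop).map_smul r s⟩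

theorem section_ext {ι : Type*} (W : ι → X.Opens) (V : X.Opens) (h : ∀ i, W i ≤ V)
    (hV : V ≤ iSup W) {s t : Γ(M, V)} (hs : ∀ i, mres M (h i) s = mres M (h i) t) : s = t :=
  TopCat.Sheaf.eq_of_locally_eq' ⟨M.presheaf, M.isSheaf⟩ W V (fun i ↦ homOfLE (h i)) hV s t hs

theorem exists_section_gluing {ι : Type*} (W : ι → X.Opens) (V : X.Opens) (h : ∀ i, W i ≤ V)
    (hV : V ≤ iSup W) (s : ∀ i, Γ(M, W i))
    (hs : ∀ i j, mres M (V := W i ⊓ W j) inf_le_left (s i) = mres M inf_le_right (s j)) :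
    ∃ t : Γ(M, V), ∀ i, mres M (h i) t = s i :=
  (TopCat.Sheaf.existsUnique_gluing' ⟨M.presheaf, M.isSheaf⟩ W V (fun i ↦ homOfLE (h i)) hV s
    hs).exists

theorem function_ext {ι : Type*} (W : ι → X.Opens) (V : X.Opens) (h : ∀ i, W i ≤ V)
    (hV : V ≤ iSup W) {s t : Γ(X, V)} (hs : ∀ i, ores (h i) s = ores (h i) t) : s = t :=
  TopCat.Sheaf.eq_of_locally_eq' X.sheaf W V (fun i ↦ homOfLE (h i)) hV s t hs

theorem exists_function_gluing {ι : Type*} (W : ι → X.Opens) (V : X.Opens) (h : ∀ i, W i ≤ V)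
    (hV : V ≤ iSup W) (s : ∀ i, Γ(X, W i))
    (hs : ∀ i j, ores (V := W i ⊓ W j) inf_le_left (s i) = ores inf_le_right (s j)) :
    ∃ t : Γ(X, V), ∀ i, ores (h i) t = s i :=
  (TopCat.Sheaf.existsUnique_gluing' X.sheaf W V (fun i ↦ homOfLE (h i)) hV s hs).exists

theorem subsingleton_sections_bot (M : X.Modules) : Subsingleton Γ(M, ⊥) :=
  ⟨fun _ _ ↦ section_ext (ι := PEmpty.{1}) (fun i ↦ i.elim) ⊥ (fun i ↦ i.elim) bot_le
    fun i ↦ i.elim⟩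

theorem mapp_injective_of_mono (φ : M ⟶ N) [Mono φ] (U : X.Opens) :
    Function.Injective (mapp φ U) := by
  have h1 : Mono ((Scheme.Modules.toPresheaf X).map φ) := inferInstance
  have h2 : Mono (((Scheme.Modules.toPresheaf X).map φ).app (.op U)) := inferInstance
  exact (AddCommGrpCat.mono_iff_injective _).1 h2

theorem mono_of_mapp_injective (φ : M ⟶ N) (h : ∀ U, Function.Injective (mapp φ U)) : Mono φ := by
  refine ⟨fun f g hfg ↦ hom_ext_mapp fun U s ↦ h U ?_⟩
  rw [← mapp_comp, ← mapp_comp, hfg]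

theorem isIso_of_mapp_bijective (φ : M ⟶ N) (h : ∀ U, Function.Bijective (mapp φ U)) :
    IsIso φ := by
  rw [Scheme.Modules.Hom.isIso_iff_isIso_app]
  intro U
  have : IsIso ((forget _).map (φ.app U)) := (isIso_iff_bijective _).2 (h U)
  exact isIso_of_reflects_iso _ (forget _)

theorem mapp_bijective_of_isIso (φ : M ⟶ N) [IsIso φ] (U : X.Opens) :
    Function.Bijective (mapp φ U) := by
  refine Function.bijective_iff_has_inverse.2 ⟨mapp (inv φ) U, fun s ↦ ?_, fun s ↦ ?_⟩
  · rw [← mapp_comp, IsIso.hom_inv_id, mapp_id]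
  · rw [← mapp_comp, IsIso.inv_hom_id, mapp_id]

/-- Factorization through a monomorphism can be checked on sections. -/
theorem exists_lift_of_range_le (α : K ⟶ N) (β : M ⟶ N) (hβ : ∀ U, Function.Injective (mapp β U))
    (h : ∀ U, LinearMap.range (mapp α U) ≤ LinearMap.range (mapp β U)) :
    ∃ γ : K ⟶ M, γ ≫ β = α := by
  choose f hf using fun (U : X.Opens) (s : Γ(K, U)) ↦ h U ⟨s, rfl⟩
  refine ⟨homOfSections (fun U ↦
    { toFun := f U
      map_add' := fun s t ↦ hβ U (by simp only [map_add, hf])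
      map_smul' := fun a s ↦ hβ U (by simp only [map_smul, hf, RingHom.id_apply]) })
    fun U V h s ↦ hβ V ?_, hom_ext_mapp fun U s ↦ hf U s⟩
  change mapp β V (f V _) = mapp β V (mres M h (f U s))
  rw [hf, mapp_mres, mapp_mres, hf]

theorem exists_iso_of_range_eq (α : K ⟶ N) (β : M ⟶ N) (hα : ∀ U, Function.Injective (mapp α U))
    (hβ : ∀ U, Function.Injective (mapp β U))
    (h : ∀ U, LinearMap.range (mapp α U) = LinearMap.range (mapp β U)) :
    ∃ γ : K ≅ M, γ.hom ≫ β = α := by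
  obtain ⟨f, hf⟩ := exists_lift_of_range_le α β hβ fun U ↦ (h U).le
  obtain ⟨g, hg⟩ := exists_lift_of_range_le β α hα fun U ↦ (h U).ge
  have := mono_of_mapp_injective α hα
  have := mono_of_mapp_injective β hβ
  exact ⟨⟨f, g, by rw [← cancel_mono α, Category.assoc, hg, hf, Category.id_comp],
    by rw [← cancel_mono β, Category.assoc, hf, hg, Category.id_comp]⟩, hf⟩

/-- A section of a sheaf of modules that is locally in the image of a morphism which is injective on
sections is in the image. -/
theorem mem_range_of_locally {φ : M ⟶ N} (hφ : ∀ U, Function.Injective (mapp φ U))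
    {s : Γ(N, U)} (h : ∀ p ∈ U, ∃ (V : X.Opens) (hV : V ≤ U), p ∈ V ∧
      mres N hV s ∈ LinearMap.range (mapp φ V)) : s ∈ LinearMap.range (mapp φ U) := by
  choose V hV hp t ht using fun p : U ↦ h p.1 p.2
  have hcov : U ≤ iSup V := fun p hp' ↦ Opens.mem_iSup.2 ⟨⟨p, hp'⟩, hp _⟩
  obtain ⟨w, hw⟩ := exists_section_gluing V U hV hcov t fun i j ↦ hφ _ (by
    rw [mapp_mres, mapp_mres, ht, ht, mres_mres, mres_mres])
  exact ⟨w, section_ext V U hV hcov fun i ↦ by rw [← mapp_mres, hw, ht]⟩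

/-- Bijectivity on sections of a morphism of sheaves of modules is a local property. -/
theorem isIso_of_locally_bijective (φ : M ⟶ N)
    (h : ∀ p : X, ∃ U : X.Opens, p ∈ U ∧ ∀ V ≤ U, Function.Bijective (mapp φ V)) : IsIso φ := by
  choose U hp hU using h
  have hinj (V : X.Opens) : Function.Injective (mapp φ V) := by
    intro s t hst
    refine section_ext (fun p : X ↦ V ⊓ U p) V (fun _ ↦ inf_le_left)
      (fun p hp' ↦ Opens.mem_iSup.2 ⟨p, hp', hp p⟩) fun p ↦ (hU p _ inf_le_right).1 ?_
    rw [mapp_mres, mapp_mres, hst]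
  refine isIso_of_mapp_bijective φ fun V ↦ ⟨hinj V, fun s ↦ ?_⟩
  exact mem_range_of_locally hinj fun p hpV ↦
    ⟨V ⊓ U p, inf_le_left, ⟨hpV, hp p⟩, (hU p _ inf_le_right).2 _⟩

/-- Sections of a finite direct sum, in terms of the sections of the summands. -/
theorem mapp_biproduct_bijective {n : ℕ} {L : Fin n → X.Modules} (φ : ∀ a, L a ⟶ M)
    (h : Function.Bijective fun w : ∀ a, Γ(L a, U) ↦ ∑ a, mapp (φ a) U (w a)) :
    Function.Bijective (mapp (biproduct.desc φ) U) := by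
  have hs (w : Γ(⨁ L, U)) : w = ∑ a, mapp (biproduct.ι L a) U (mapp (biproduct.π L a) U w) := by
    conv_lhs => rw [← mapp_id w, ← biproduct.total, mapp_sum]
    rfl
  have hd (w : Γ(⨁ L, U)) : mapp (biproduct.desc φ) U w =
      ∑ a, mapp (φ a) U (mapp (biproduct.π L a) U w) := by
    conv_lhs => rw [hs w, map_sum]
    refine Finset.sum_congr rfl fun a _ ↦ ?_
    rw [← mapp_comp, biproduct.ι_desc]
  refine ⟨fun v w hvw ↦ ?_, fun s ↦ ?_⟩
  · rw [hd, hd] at hvw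
    have := h.1 hvw
    rw [hs v, hs w]
    exact Finset.sum_congr rfl fun a _ ↦ congrArg _ (congrFun this a)
  · obtain ⟨w, rfl⟩ := h.2 s
    refine ⟨∑ a, mapp (biproduct.ι L a) U (w a), ?_⟩
    rw [map_sum]
    refine Finset.sum_congr rfl fun a _ ↦ ?_
    rw [← mapp_comp, biproduct.ι_desc]

end Sections

/-! ### Local frames -/

section Frames

variable {X : Scheme.{u}} {M N : X.Modules} {U V W : X.Opens} {ι : Type*} [Fintype ι]

/-- A frame of `M` over `U`: sections over `U` whose restrictions to every smaller open set `V`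
form a basis of `Γ(M, V)` over `Γ(X, V)`. -/
def IsFrame (M : X.Modules) (U : X.Opens) (e : ι → Γ(M, U)) : Prop :=
  ∀ (V : X.Opens) (h : V ≤ U),
    Function.Bijective fun a : ι → Γ(X, V) ↦ ∑ i, a i • mres M h (e i)

theorem IsFrame.mono {e : ι → Γ(M, U)} (he : IsFrame M U e) (h : V ≤ U) :
    IsFrame M V fun i ↦ mres M h (e i) := by
  intro W hW
  simpa only [mres_mres] using he W (hW.trans h)

theorem IsFrame.exists_eq {e : ι → Γ(M, U)} (he : IsFrame M U e) (h : V ≤ U) (s : Γ(M, V)) :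
    ∃ a : ι → Γ(X, V), s = ∑ i, a i • mres M h (e i) := by
  obtain ⟨a, ha⟩ := (he V h).2 s
  exact ⟨a, ha.symm⟩

theorem IsFrame.eq_of_sum_eq {e : ι → Γ(M, U)} (he : IsFrame M U e) (h : V ≤ U)
    {a b : ι → Γ(X, V)} (hab : ∑ i, a i • mres M h (e i) = ∑ i, b i • mres M h (e i)) : a = b :=
  (he V h).1 hab

theorem IsFrame.map_of_bijective {e : ι → Γ(M, U)} (he : IsFrame M U e) (φ : M ⟶ N)
    (hφ : ∀ V ≤ U, Function.Bijective (mapp φ V)) : IsFrame N U fun i ↦ mapp φ U (e i) := by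
  intro V hV
  convert! (hφ V hV).comp (he V hV) using 2 with a
  simp [mapp_mres]

/-- Whether sections form a frame is a local question. -/
theorem isFrame_of_locally {e : ι → Γ(M, U)}
    (h : ∀ p ∈ U, ∃ (V : X.Opens) (hV : V ≤ U), p ∈ V ∧ IsFrame M V fun i ↦ mres M hV (e i)) :
    IsFrame M U e := by
  choose V hV hp hf using fun p : U ↦ h p.1 p.2
  intro W hW
  have hle (p : U) : W ⊓ V p ≤ W := inf_le_left
  have hcov : W ≤ ⨆ p, W ⊓ V p := fun p hp' ↦ Opens.mem_iSup.2 ⟨⟨p, hW hp'⟩, hp', hp _⟩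
  have hinj (p : U) (Z : X.Opens) (hZ : Z ≤ V p) {a b : ι → Γ(X, Z)}
      (hab : ∑ i, a i • mres M (hZ.trans (hV p)) (e i) =
        ∑ i, b i • mres M (hZ.trans (hV p)) (e i)) : a = b :=
    (hf p).eq_of_sum_eq hZ (by simpa only [mres_mres] using hab)
  refine ⟨fun a b hab ↦ funext fun i ↦ function_ext _ W hle hcov fun p ↦ ?_, fun s ↦ ?_⟩
  · refine congrFun (hinj p (W ⊓ V p) inf_le_right (a := fun i ↦ ores (hle p) (a i))
      (b := fun i ↦ ores (hle p) (b i)) ?_) i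
    have := congrArg (mres M (hle p)) hab
    simpa only [map_sum, mres_smul, mres_mres] using this
  · choose a ha using fun p : U ↦ (hf p).exists_eq (V := W ⊓ V p) inf_le_right
      (mres M (hle p) s)
    have hglue (i : ι) := exists_function_gluing (fun p ↦ W ⊓ V p) W hle hcov (fun p ↦ a p i)
      fun p q ↦ by
        refine congrFun (hinj p (W ⊓ V p ⊓ (W ⊓ V q)) (inf_le_left.trans inf_le_right)
          (a := fun i ↦ ores inf_le_left (a p i)) (b := fun i ↦ ores inf_le_right (a q i)) ?_) i
        have h1 := congrArg (mres M (V := W ⊓ V p ⊓ (W ⊓ V q)) inf_le_left) (ha p)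
        have h2 := congrArg (mres M (V := W ⊓ V p ⊓ (W ⊓ V q)) inf_le_right) (ha q)
        simp only [map_sum, mres_smul, mres_mres] at h1 h2
        rw [← h1, ← h2]
    choose c hc using hglue
    refine ⟨c, section_ext _ W hle hcov fun p ↦ ?_⟩
    rw [ha p]
    simp only [map_sum, mres_smul, mres_mres, hc]

/-- A morphism that carries a frame to a frame is bijective on sections. -/
theorem IsFrame.mapp_bijective {e : ι → Γ(M, U)} (he : IsFrame M U e) (φ : M ⟶ N)
    (hφ : IsFrame N U fun i ↦ mapp φ U (e i)) (h : V ≤ U) : Function.Bijective (mapp φ V) := by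
  have : (fun a : ι → Γ(X, V) ↦ ∑ i, a i • mres N h (mapp φ U (e i))) =
      mapp φ V ∘ fun a : ι → Γ(X, V) ↦ ∑ i, a i • mres M h (e i) := by
    ext a
    simp [mapp_mres]
  exact ((he V h).of_comp_iff _).1 (this ▸ hφ V h)

/-- Sections of the structure sheaf, regarded as sections of a sheaf of modules. -/
def functionSection (U : X.Opens) : Γ(X, U) ≃ₗ[Γ(X, U)] Γ(structureModule X, U) where
  toFun a := a
  invFun a := a
  map_add' _ _ := rfl
  map_smul' _ _ := rfl
  left_inv _ := rfl
  right_inv _ := rfl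

theorem mres_functionSection (h : V ≤ U) (a : Γ(X, U)) :
    mres (structureModule X) h (functionSection U a) = functionSection V (ores h a) := rfl

/-- The morphism from the structure sheaf given by a section over the whole scheme. -/
def homOfTopSection (s : Γ(M, ⊤)) : structureModule X ⟶ M :=
  homOfSections (fun U ↦ LinearMap.toSpanSingleton Γ(X, U) Γ(M, U) (mres M le_top s) ∘ₗ
    (functionSection U).symm.toLinearMap) fun U V h a ↦ by
      obtain ⟨a, rfl⟩ := (functionSection U).surjective a
      simp [mres_functionSection, mres_smul, mres_mres]

theorem mapp_homOfTopSection (s : Γ(M, ⊤)) (a : Γ(X, U)) :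
    mapp (homOfTopSection s) U (functionSection U a) = a • mres M le_top s := rfl

theorem mapp_functionSection (φ : structureModule X ⟶ M) (h : U ≤ V) (a : Γ(X, U)) :
    mapp φ U (functionSection U a) = a • mres M h (mapp φ V (functionSection V 1)) := by
  rw [← mapp_mres, mres_functionSection, ← map_smul, ← map_smul, map_one, smul_eq_mul, mul_one]

theorem isFrame_power (X : Scheme.{u}) (n : ℕ) :
    IsFrame (power (structureModule X) n) ⊤ fun i ↦
      mapp (biproduct.ι (fun _ : Fin n ↦ structureModule X) i) ⊤ (functionSection ⊤ 1) := by
  intro V hV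
  have hs (w : Γ(⨁ fun _ : Fin n ↦ structureModule X, V)) :
      w = ∑ a, mapp (biproduct.ι _ a) V (mapp (biproduct.π _ a) V w) := by
    conv_lhs => rw [← mapp_id w, ← biproduct.total, mapp_sum]
    rfl
  have he (a : Fin n → Γ(X, V)) : ∑ i, a i • mres (power (structureModule X) n) hV
      (mapp (biproduct.ι (fun _ : Fin n ↦ structureModule X) i) ⊤ (functionSection ⊤ 1)) =
      ∑ i, mapp (biproduct.ι (fun _ : Fin n ↦ structureModule X) i) V
        (functionSection V (a i)) :=
    Finset.sum_congr rfl fun i _ ↦ (mapp_functionSection _ hV _).symm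
  have hπ (i : Fin n) (c : Fin n → Γ(X, V)) :
      mapp (biproduct.π (fun _ : Fin n ↦ structureModule X) i) V
      (∑ j, mapp (biproduct.ι (fun _ : Fin n ↦ structureModule X) j) V
        (functionSection V (c j))) = functionSection V (c i) := by
    rw [map_sum, Finset.sum_eq_single i]
    · rw [← mapp_comp, biproduct.ι_π_self]
      rfl
    · intro j _ hj
      rw [← mapp_comp, biproduct.ι_π_ne _ hj]
      rfl
    · simp
  refine ⟨fun a b hab ↦ funext fun i ↦ (functionSection V).injective ?_, fun w ↦
    ⟨fun i ↦ (functionSection V).symm (mapp (biproduct.π _ i) V w), ?_⟩⟩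
  · dsimp only at hab
    rw [he, he] at hab
    rw [← hπ i a, ← hπ i b, hab]
  · dsimp only
    rw [he]
    exact (hs w).symm

theorem restrict_smul (W : (U : Scheme.{u}).Opens) (r : Γ(X, U.ι ''ᵁ W))
    (s : Γ(M, U.ι ''ᵁ W)) :
    (HSMul.hSMul (α := Γ(U, W)) (β := Γ(M.restrict U.ι, W)) r s : Γ(M.restrict U.ι, W)) =
      r • s := by
  change (U.ι.appIso W).inv r • s = r • s
  rw [Scheme.Opens.ι_appIso]
  rfl

theorem isFrame_restrict_iff {e : ι → Γ(M, U.ι ''ᵁ ⊤)} :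
    IsFrame (M.restrict U.ι) ⊤ e ↔ IsFrame M (U.ι ''ᵁ ⊤) e := by
  have key (W : (U : Scheme.{u}).Opens) (a : ι → Γ(X, U.ι ''ᵁ W)) :
      (Finset.univ.sum fun i ↦ HSMul.hSMul (α := Γ(U, W)) (β := Γ(M.restrict U.ι, W)) (a i)
        (mres (M.restrict U.ι) le_top (e i)) : Γ(M.restrict U.ι, W)) =
      (∑ i, a i • mres M (Scheme.Hom.image_mono _ le_top) (e i) : Γ(M, U.ι ''ᵁ W)) :=
    Finset.sum_congr rfl fun i _ ↦ restrict_smul W (a i) _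
  refine ⟨fun h V hV ↦ ?_, fun h W hW ↦ ?_⟩
  · obtain ⟨W, rfl⟩ : ∃ W : (U : Scheme.{u}).Opens, U.ι ''ᵁ W = V := by
      refine ⟨U.ι ⁻¹ᵁ V, ?_⟩
      rw [Scheme.Hom.image_preimage_eq_opensRange_inf, inf_eq_right]
      exact hV.trans (by rw [Scheme.Hom.image_top_eq_opensRange])
    exact (congrArg Function.Bijective (funext (key W))).mp (h W le_top)
  · exact (congrArg Function.Bijective (funext (key W))).mpr
      (h (U.ι ''ᵁ W) (Scheme.Hom.image_mono _ le_top))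

theorem IsLocallyFreeOfRank.exists_isFrame {n : ℕ} (h : IsLocallyFreeOfRank M n) (p : X) :
    ∃ (U : X.Opens) (e : Fin n → Γ(M, U)), p ∈ U ∧ IsFrame M U e := by
  obtain ⟨U, hp, ⟨α⟩⟩ := h p
  have h1 := (isFrame_power U n).map_of_bijective α.inv fun V _ ↦ mapp_bijective_of_isIso _ V
  exact ⟨U.ι ''ᵁ ⊤, _, by simpa using hp, isFrame_restrict_iff.1 h1⟩

theorem isLocallyFreeOfRank_of_isFrame {n : ℕ}
    (h : ∀ p : X, ∃ (U : X.Opens) (e : Fin n → Γ(M, U)), p ∈ U ∧ IsFrame M U e) :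
    IsLocallyFreeOfRank M n := by
  intro p
  obtain ⟨U, e, hp, he⟩ := h p
  have hU : U.ι ''ᵁ ⊤ ≤ U := by simp
  let e' : Fin n → Γ(M.restrict U.ι, ⊤) := fun i ↦ mres M hU (e i)
  have he' : IsFrame (M.restrict U.ι) ⊤ e' := isFrame_restrict_iff.2 (he.mono hU)
  let φ : power (structureModule U) n ⟶ M.restrict U.ι :=
    biproduct.desc fun i ↦ homOfTopSection (e' i)
  have hφ (V : (U : Scheme.{u}).Opens) : Function.Bijective (mapp φ V) := by
    refine (isFrame_power U n).mapp_bijective φ ?_ le_top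
    convert he' using 2 with i
    refine (congrArg (fun ψ ↦ mapp ψ ⊤ (functionSection ⊤ 1)) (biproduct.ι_desc
      (fun i ↦ homOfTopSection (e' i)) i)).trans ?_
    rw [mapp_homOfTopSection, one_smul, mres_self]
  have := isIso_of_mapp_bijective φ hφ
  exact ⟨U, hp, ⟨(asIso φ).symm⟩⟩

end Frames

/-! ### Vector bundles on affine charts of integral schemes -/

section Integral

variable {X : Scheme.{u}} {M N : X.Modules} {U V W : X.Opens} {n : ℕ}

theorem ores_eq_zero_of_bot (h : V ≤ U) (hU : U = ⊥) (a : Γ(X, U)) : a = 0 := by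
  subst hU
  exact function_ext (ι := PEmpty.{1}) (fun i ↦ i.elim) ⊥ (fun i ↦ i.elim) bot_le fun i ↦ i.elim

theorem exists_pow_mul_eq_ores (hW : IsAffineOpen W) (f : Γ(X, W)) (hV : V = X.basicOpen f)
    (h : V ≤ W) (a : Γ(X, V)) :
    ∃ m : ℕ, ∀ k ≥ m, ∃ y : Γ(X, W), ores h y = ores h f ^ k * a := by
  subst hV
  obtain ⟨m, y, hy⟩ := exists_eq_pow_mul_of_isAffineOpen X W hW f a
  refine ⟨m, fun k hk ↦ ⟨f ^ (k - m) * y, ?_⟩⟩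
  have hy' : ores h y = ores h f ^ m * a := hy
  rw [map_mul, hy', map_pow, ← mul_assoc, ← pow_add, Nat.sub_add_cancel hk]

/-- An affine open set is covered by finitely many basic open sets with a frame. -/
theorem exists_finset_isFrame (hM : IsLocallyFreeOfRank M n) (hU : IsAffineOpen U) :
    ∃ t : Finset Γ(X, U), Ideal.span (t : Set Γ(X, U)) = ⊤ ∧
      ∀ g ∈ t, ∃ e : Fin n → Γ(M, X.basicOpen g), IsFrame M (X.basicOpen g) e := by
  let S : Set Γ(X, U) := {g | ∃ e : Fin n → Γ(M, X.basicOpen g), IsFrame M (X.basicOpen g) e}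
  have hS : Ideal.span S = ⊤ := by
    rw [← hU.self_le_iSup_basicOpen_iff]
    intro p hp
    obtain ⟨D, e, hpD, hD⟩ := hM.exists_isFrame p
    obtain ⟨f, hf, hpf⟩ := hU.exists_basicOpen_le ⟨p, hpD⟩ hp
    exact Opens.mem_iSup.2 ⟨⟨f, _, hD.mono hf⟩, hpf⟩
  obtain ⟨t, htS, ht⟩ := (Ideal.span_eq_top_iff_finite S).1 hS
  exact ⟨t, ht, fun g hg ↦ htS hg⟩

theorem isUnit_ores_basicOpen (g : Γ(X, U)) : IsUnit (ores (X.basicOpen_le g) g) :=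
  X.toRingedSpace.isUnit_res_basicOpen g

theorem IsFrame.linearCombination_bijective {ι : Type*} [Fintype ι] {e : ι → Γ(M, U)}
    (he : IsFrame M U e) : Function.Bijective (Fintype.linearCombination Γ(X, U) e) := by
  have h := he U le_rfl
  simp only [mres_self] at h
  exact h

/-- A frame as a basis of the module of sections. -/
def IsFrame.basis {ι : Type*} [Fintype ι] {e : ι → Γ(M, U)} (he : IsFrame M U e) :
    Module.Basis ι Γ(X, U) Γ(M, U) :=
  .ofEquivFun (LinearEquiv.ofBijective _ he.linearCombination_bijective).symm

theorem IsFrame.basis_apply {ι : Type*} [Fintype ι] {e : ι → Γ(M, U)} (he : IsFrame M U e) (i : ι) :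
    he.basis i = e i := by
  classical
  simp only [IsFrame.basis, Module.Basis.coe_ofEquivFun, LinearEquiv.symm_symm]
  rw [LinearEquiv.ofBijective_apply, Fintype.linearCombination_apply_single, one_smul]

variable [IsIntegral X]

theorem ores_injective (h : V ≤ U) (hV : V ≠ ⊥) : Function.Injective (ores h) := by
  obtain ⟨p, hp⟩ := (Opens.ne_bot_iff_nonempty V).1 hV
  have : Nonempty V := ⟨⟨p, hp⟩⟩
  exact map_injective_of_isIntegral X (homOfLE h)

theorem inf_ne_bot (hU : U ≠ ⊥) (hV : V ≠ ⊥) : U ⊓ V ≠ ⊥ := by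
  rw [Opens.ne_bot_iff_nonempty] at *
  exact (PreirreducibleSpace.isPreirreducible_univ (X := X) U V U.2 V.2
    (by simpa using hU) (by simpa using hV)).mono fun p hp ↦ hp.2

theorem mres_injective (hM : IsLocallyFreeOfRank M n) (h : V ≤ U) (hV : V ≠ ⊥) :
    Function.Injective (mres M h) := by
  rw [injective_iff_map_eq_zero]
  intro s hs
  choose D e hp hD using hM.exists_isFrame
  refine section_ext (fun p : X ↦ U ⊓ D p) U (fun _ ↦ inf_le_left)
    (fun p hp' ↦ Opens.mem_iSup.2 ⟨p, hp', hp p⟩) fun p ↦ ?_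
  rw [map_zero]
  obtain ⟨a, ha⟩ := (hD p).exists_eq inf_le_right (mres M (inf_le_left : U ⊓ D p ≤ U) s)
  have hne : V ⊓ D p ≠ ⊥ := inf_ne_bot hV
    ((Opens.ne_bot_iff_nonempty _).2 ⟨p, hp p⟩)
  have h0 := congrArg (mres M (inf_le_inf_right (D p) h)) ha
  rw [mres_mres, ← mres_mres (h.trans le_rfl) (inf_le_left : V ⊓ D p ≤ V), hs, map_zero] at h0
  simp only [map_sum, mres_smul, mres_mres] at h0
  have h1 := (hD p).eq_of_sum_eq (V := V ⊓ D p) inf_le_right (a := 0)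
    (b := fun i ↦ ores (inf_le_inf_right (D p) h) (a i)) (by simpa using h0)
  have h2 (i) : a i = 0 := by
    apply ores_injective (inf_le_inf_right (D p) h) hne
    rw [map_zero]
    exact (congrFun h1 i).symm
  rw [ha]
  simp [h2]

theorem smul_injective (hM : IsLocallyFreeOfRank M n) (hU : U ≠ ⊥) {a : Γ(X, U)} (ha : a ≠ 0) :
    Function.Injective fun s : Γ(M, U) ↦ a • s := by
  suffices h : ∀ s : Γ(M, U), a • s = 0 → s = 0 from fun s t hst ↦
    sub_eq_zero.1 (h _ (by rw [smul_sub, sub_eq_zero]; exact hst))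
  intro s hs
  obtain ⟨p, hp⟩ := (Opens.ne_bot_iff_nonempty U).1 hU
  obtain ⟨D, e, hpD, hD⟩ := hM.exists_isFrame p
  have hne : U ⊓ D ≠ ⊥ := (Opens.ne_bot_iff_nonempty _).2 ⟨p, hp, hpD⟩
  have : Nonempty (U ⊓ D : X.Opens) := ⟨⟨p, hp, hpD⟩⟩
  apply mres_injective hM (inf_le_left : U ⊓ D ≤ U) hne
  obtain ⟨c, hc⟩ := hD.exists_eq inf_le_right (mres M (inf_le_left : U ⊓ D ≤ U) s)
  have h0 := congrArg (mres M (inf_le_left : U ⊓ D ≤ U)) hs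
  rw [mres_smul, hc, map_zero, Finset.smul_sum] at h0
  have h1 := hD.eq_of_sum_eq (V := U ⊓ D) inf_le_right (a := 0)
    (b := fun i ↦ ores inf_le_left a * c i) (by simpa [mul_smul] using h0.symm)
  have ha' : ores (inf_le_left : U ⊓ D ≤ U) a ≠ 0 := fun h ↦
    ha (ores_injective inf_le_left hne (h.trans (map_zero _).symm))
  have hc0 : c = 0 := funext fun i ↦ by
    simpa [ha'] using (congrFun h1 i).symm
  rw [hc, hc0]
  simp

/-- After multiplication by a power of `f`, sections over the basic open set of `f` extend. -/
theorem exists_pow_smul_eq_mres (hM : IsLocallyFreeOfRank M n) (hU : IsAffineOpen U)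
    (f : Γ(X, U)) (hf : X.basicOpen f ≠ ⊥) (s : Γ(M, X.basicOpen f)) :
    ∃ (m : ℕ) (y : Γ(M, U)), mres M (X.basicOpen_le f) y = ores (X.basicOpen_le f) f ^ m • s := by
  obtain ⟨t, ht, hfr⟩ := exists_finset_isFrame hM hU
  have key (g : t) : ∃ m : ℕ, ∀ k ≥ m, ∃ y : Γ(M, X.basicOpen g.1),
      mres M (inf_le_left : X.basicOpen g.1 ⊓ X.basicOpen f ≤ _) y =
        ores (V := X.basicOpen g.1 ⊓ X.basicOpen f) (inf_le_right.trans (X.basicOpen_le f)) f ^ k •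
          mres M inf_le_right s := by
    obtain ⟨e, he⟩ := hfr g.1 g.2
    obtain ⟨a, ha⟩ := he.exists_eq (V := X.basicOpen g.1 ⊓ X.basicOpen f) inf_le_left
      (mres M inf_le_right s)
    choose m hm using fun i ↦ exists_pow_mul_eq_ores (hU.basicOpen g.1)
      (ores (X.basicOpen_le g.1) f) (V := X.basicOpen g.1 ⊓ X.basicOpen f)
      (X.basicOpen_res f (homOfLE (X.basicOpen_le g.1)).op).symm inf_le_left (a i)
    refine ⟨Finset.univ.sup m, fun k hk ↦ ?_⟩
    choose y hy using fun i ↦ hm i k ((Finset.le_sup (Finset.mem_univ i)).trans hk)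
    refine ⟨∑ i, y i • e i, ?_⟩
    rw [ha, Finset.smul_sum, map_sum]
    refine Finset.sum_congr rfl fun i _ ↦ ?_
    rw [mres_smul, hy, mul_smul, ores_ores]
  choose m hm using key
  let k := Finset.univ.sup m
  choose y hy using fun g ↦ hm g k (Finset.le_sup (Finset.mem_univ g))
  have hcov : U ≤ ⨆ g : t, X.basicOpen g.1 := (hU.self_le_iSup_basicOpen_iff (s := t)).2 ht
  obtain ⟨w, hw⟩ := exists_section_gluing (fun g : t ↦ X.basicOpen g.1) U
    (fun g ↦ X.basicOpen_le g.1) hcov y fun g g' ↦ by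
      by_cases hne : X.basicOpen g.1 ⊓ X.basicOpen g'.1 = ⊥
      · have := subsingleton_sections_bot M
        rw [← hne] at this
        exact Subsingleton.elim _ _
      apply mres_injective hM
        (inf_le_left : (X.basicOpen g.1 ⊓ X.basicOpen g'.1) ⊓ X.basicOpen f ≤ _) (inf_ne_bot hne hf)
      have h1 := congrArg (mres M (V := (X.basicOpen g.1 ⊓ X.basicOpen g'.1) ⊓ X.basicOpen f)
        (inf_le_inf_right _ inf_le_left)) (hy g)
      have h2 := congrArg (mres M (V := (X.basicOpen g.1 ⊓ X.basicOpen g'.1) ⊓ X.basicOpen f)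
        (inf_le_inf_right _ inf_le_right)) (hy g')
      simp only [mres_smul, mres_mres, map_pow, ores_ores] at h1 h2 ⊢
      rw [h1, h2]
  refine ⟨k, w, section_ext (fun g : t ↦ X.basicOpen g.1 ⊓ X.basicOpen f) (X.basicOpen f)
    (fun _ ↦ inf_le_right) (fun p hp ↦ ?_) fun g ↦ ?_⟩
  · obtain ⟨g, hg⟩ := Opens.mem_iSup.1 (hcov (X.basicOpen_le f hp))
    exact Opens.mem_iSup.2 ⟨g, hg, hp⟩
  · have h1 := hy g
    rw [← hw g, mres_mres] at h1
    rw [mres_mres, h1, mres_smul, map_pow, ores_ores]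

theorem finite_sections (hM : IsLocallyFreeOfRank M n) (hU : IsAffineOpen U) :
    Module.Finite Γ(X, U) Γ(M, U) := by
  obtain ⟨t, ht, hfr⟩ := exists_finset_isFrame hM hU
  have key (g : t) : ∃ F : Finset Γ(M, U), ∀ s : Γ(M, U), ∃ k : ℕ,
      g.1 ^ k • s ∈ Submodule.span Γ(X, U) (F : Set Γ(M, U)) := by
    classical
    by_cases hne : X.basicOpen g.1 = ⊥
    · rw [basicOpen_eq_bot_iff] at hne
      exact ⟨∅, fun s ↦ ⟨1, by simp [hne]⟩⟩
    obtain ⟨e, he⟩ := hfr g.1 g.2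
    choose m y hy using fun i ↦ exists_pow_smul_eq_mres hM hU g.1 hne (e i)
    refine ⟨Finset.univ.image y, fun s ↦ ?_⟩
    obtain ⟨a, ha⟩ := he.exists_eq le_rfl (mres M (X.basicOpen_le g.1) s)
    choose r hr using fun i ↦ exists_pow_mul_eq_ores hU g.1 rfl (X.basicOpen_le g.1) (a i)
    let k := Finset.univ.sup r
    choose c hc using fun i ↦ hr i k (Finset.le_sup (Finset.mem_univ i))
    let q := Finset.univ.sup m
    refine ⟨k + q, ?_⟩
    have : g.1 ^ (k + q) • s = ∑ i, (c i * g.1 ^ (q - m i)) • y i := by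
      apply mres_injective hM (X.basicOpen_le g.1) hne
      rw [mres_smul, ha, map_sum, Finset.smul_sum]
      refine Finset.sum_congr rfl fun i _ ↦ ?_
      rw [mres_smul, hy, mres_self, ← mul_smul, ← mul_smul, map_mul, hc]
      congr 1
      have : m i ≤ q := Finset.le_sup (Finset.mem_univ i)
      rw [map_pow, map_pow, pow_add, ← Nat.sub_add_cancel this, Nat.add_sub_cancel, pow_add]
      ring
    rw [this]
    exact Submodule.sum_mem _ fun i _ ↦ Submodule.smul_mem _ _ (Submodule.subset_span (by simp))
  choose F hF using key
  classical
  refine ⟨⟨Finset.univ.biUnion F, eq_top_iff.2 fun s _ ↦ ?_⟩⟩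
  refine Submodule.mem_of_span_eq_top_of_smul_pow_mem _ (t : Set Γ(X, U)) ht s fun g ↦ ?_
  obtain ⟨k, hk⟩ := hF g s
  exact ⟨k, Submodule.span_mono (by
    exact_mod_cast Finset.subset_biUnion_of_mem F (Finset.mem_univ g)) hk⟩

theorem span_mres_basicOpen (hM : IsLocallyFreeOfRank M n) (hU : IsAffineOpen U)
    {ι : Type*} [Fintype ι] {b : ι → Γ(M, U)} (hb : Submodule.span Γ(X, U) (Set.range b) = ⊤)
    (g : Γ(X, U)) (hg : X.basicOpen g ≠ ⊥) (s : Γ(M, X.basicOpen g)) :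
    ∃ a : ι → Γ(X, X.basicOpen g), s = ∑ i, a i • mres M (X.basicOpen_le g) (b i) := by
  obtain ⟨m, y, hy⟩ := exists_pow_smul_eq_mres hM hU g hg s
  obtain ⟨c, hc⟩ := (Submodule.mem_span_range_iff_exists_fun _).1 (hb ▸ Submodule.mem_top (x := y))
  obtain ⟨u, hu⟩ := (isUnit_ores_basicOpen g).pow m
  refine ⟨fun i ↦ (↑u⁻¹ : Γ(X, X.basicOpen g)) * ores (X.basicOpen_le g) (c i), ?_⟩
  rw [← hc, ← hu, map_sum] at hy
  have := congrArg (fun z ↦ (↑u⁻¹ : Γ(X, X.basicOpen g)) • z) hy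
  simp only [← mul_smul, Units.inv_mul, one_smul, Finset.smul_sum, mres_smul] at this
  exact this.symm

/-- On an affine open set, `n` generators of a vector bundle of rank `n` form a frame: a surjective
endomorphism of a finite module is injective. -/
theorem isFrame_of_span_eq_top (hM : IsLocallyFreeOfRank M n) (hU : IsAffineOpen U)
    {b : Fin n → Γ(M, U)} (hb : Submodule.span Γ(X, U) (Set.range b) = ⊤) : IsFrame M U b := by
  obtain ⟨t, ht, hfr⟩ := exists_finset_isFrame hM hU
  refine isFrame_of_locally fun p hp ↦ ?_
  obtain ⟨g, hpg⟩ := Opens.mem_iSup.1 ((hU.self_le_iSup_basicOpen_iff (s := t)).2 ht hp)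
  obtain ⟨e, he⟩ := hfr g.1 g.2
  have hne : X.basicOpen g.1 ≠ ⊥ := (Opens.ne_bot_iff_nonempty _).2 ⟨p, hpg⟩
  refine ⟨_, X.basicOpen_le g.1, hpg, fun V hV ↦ ?_⟩
  choose c hc using fun i ↦ span_mres_basicOpen hM hU hb g.1 hne (e i)
  let β : (Fin n → Γ(X, V)) →ₗ[Γ(X, V)] Γ(M, V) :=
    Fintype.linearCombination Γ(X, V) fun i ↦ mres M hV (mres M (X.basicOpen_le g.1) (b i))
  let ε : (Fin n → Γ(X, V)) →ₗ[Γ(X, V)] Γ(M, V) :=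
    Fintype.linearCombination Γ(X, V) fun i ↦ mres M hV (e i)
  let ε' := LinearEquiv.ofBijective ε (he V hV)
  have hβ : Function.Surjective β := by
    rw [← LinearMap.range_eq_top, eq_top_iff]
    intro s _
    obtain ⟨a, rfl⟩ := he.exists_eq hV s
    refine Submodule.sum_mem _ fun i _ ↦ Submodule.smul_mem _ _ ⟨fun j ↦ ores hV (c i j), ?_⟩
    rw [hc i, map_sum, Fintype.linearCombination_apply]
    exact Finset.sum_congr rfl fun j _ ↦ (mres_smul _ _ _).symm
  have hinj := OrzechProperty.injective_of_surjective_endomorphism (ε'.symm.toLinearMap ∘ₗ β)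
    (ε'.symm.surjective.comp hβ)
  rw [LinearMap.coe_comp] at hinj
  exact ⟨hinj.of_comp, hβ⟩

theorem isDomain_sections (hU : U ≠ ⊥) : IsDomain Γ(X, U) := by
  obtain ⟨p, hp⟩ := (Opens.ne_bot_iff_nonempty U).1 hU
  have : Nonempty U := ⟨⟨p, hp⟩⟩
  infer_instance

theorem isTorsionFree_sections (hM : IsLocallyFreeOfRank M n) (hU : U ≠ ⊥) :
    Module.IsTorsionFree Γ(X, U) Γ(M, U) :=
  have := isDomain_sections hU
  ⟨fun _ ha ↦ smul_injective hM hU ha.ne_zero⟩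

/-- On an affine open set whose coordinate ring is a principal ideal domain, the sections of a
vector bundle of rank `n` are free of rank `n`, and any basis is a frame. -/
theorem exists_isFrame_of_isPrincipalIdealRing (hM : IsLocallyFreeOfRank M n) (hU : IsAffineOpen U)
    (hne : U ≠ ⊥) [IsPrincipalIdealRing Γ(X, U)] : ∃ e : Fin n → Γ(M, U), IsFrame M U e := by
  have := isDomain_sections hne
  have := finite_sections hM hU
  have := isTorsionFree_sections hM hne
  obtain ⟨t, ht, hfr⟩ := exists_finset_isFrame hM hU
  obtain ⟨p, hp⟩ := (Opens.ne_bot_iff_nonempty U).1 hne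
  obtain ⟨g, hpg⟩ := Opens.mem_iSup.1 ((hU.self_le_iSup_basicOpen_iff (s := t)).2 ht hp)
  obtain ⟨e, he⟩ := hfr g.1 g.2
  have hg : X.basicOpen g.1 ≠ ⊥ := (Opens.ne_bot_iff_nonempty _).2 ⟨p, hpg⟩
  have := isDomain_sections hg
  let b := Module.finBasis Γ(X, U) Γ(M, U)
  have hli : LinearIndependent Γ(X, X.basicOpen g.1)
      fun i ↦ mres M (X.basicOpen_le g.1) (b i) := by
    rw [Fintype.linearIndependent_iff]
    intro a ha
    choose r hr using fun i ↦ exists_pow_mul_eq_ores hU g.1 rfl (X.basicOpen_le g.1) (a i)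
    choose c hc using fun i ↦ hr i (Finset.univ.sup r) (Finset.le_sup (Finset.mem_univ i))
    have h0 : ∑ i, c i • b i = 0 := by
      apply mres_injective hM (X.basicOpen_le g.1) hg
      simp only [map_sum, mres_smul, hc, mul_smul, map_zero, ← Finset.smul_sum, ha, smul_zero]
    intro i
    have h1 := hc i
    rw [Fintype.linearIndependent_iff.1 b.linearIndependent c h0 i, map_zero] at h1
    exact (((isUnit_ores_basicOpen g.1).pow _).mul_right_eq_zero).1 h1.symm
  have hspan : ⊤ ≤ Submodule.span Γ(X, X.basicOpen g.1)
      (Set.range fun i ↦ mres M (X.basicOpen_le g.1) (b i)) := fun s _ ↦ by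
    obtain ⟨a, rfl⟩ := span_mres_basicOpen hM hU b.span_eq g.1 hg s
    exact Submodule.sum_mem _ fun i _ ↦ Submodule.smul_mem _ _ (Submodule.subset_span ⟨i, rfl⟩)
  have hn : Module.finrank Γ(X, U) Γ(M, U) = n := by
    have h1 := Module.finrank_eq_card_basis (Module.Basis.mk hli hspan)
    have h2 := Module.finrank_eq_card_basis he.basis
    simpa [h2] using h1.symm
  have hb : Submodule.span Γ(X, U) (Set.range (b.reindex (finCongr hn))) = ⊤ :=
    (b.reindex (finCongr hn)).span_eq
  exact ⟨_, isFrame_of_span_eq_top hM hU hb⟩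

/-- The rank of a vector bundle on a nonempty scheme is well defined. -/
theorem IsLocallyFreeOfRank.rank_eq (hM : IsLocallyFreeOfRank M n) : rank M = n := by
  have h : IsLocallyFreeOfRank M (rank M) := Nat.sInf_mem (s := {n | IsLocallyFreeOfRank M n}) ⟨n, hM⟩
  obtain ⟨p⟩ : Nonempty X := inferInstance
  obtain ⟨U, e, hpU, he⟩ := h.exists_isFrame p
  obtain ⟨V, f, hpV, hf⟩ := hM.exists_isFrame p
  have := isDomain_sections (U := U ⊓ V) ((Opens.ne_bot_iff_nonempty _).2 ⟨p, hpU, hpV⟩)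
  have h1 := Module.finrank_eq_card_basis (he.mono (inf_le_left : U ⊓ V ≤ U)).basis
  have h2 := Module.finrank_eq_card_basis (hf.mono (inf_le_right : U ⊓ V ≤ V)).basis
  simpa [h2] using h1.symm

theorem IsVectorBundle.isLocallyFreeOfRank (hM : IsVectorBundle M) :
    IsLocallyFreeOfRank M (rank M) := by
  obtain ⟨n, hn⟩ := hM
  rwa [hn.rank_eq]

end Integral

/-! ### The image of `M ⊗ 𝒪(-x) ⟶ M` -/

section TwistImage

variable {X : Scheme.{u}} {M : X.Modules} {U V W : X.Opens} {n : ℕ}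

variable (M) in
/-- The presheaf of modules `V ↦ M(V) ⊗ 𝒪(-x)(V)`, whose sheafification is `M ⊗ 𝒪(-x)`. -/
abbrev twistPresheaf (x : X) :
    PresheafOfModules.{u} (X.presheaf ⋙ forget₂ CommRingCat.{u} RingCat.{u}) :=
  (tensorRight (idealPresheaf x)).obj ((toPresheafModules X).obj M)

variable (M) in
/-- The multiplication map from `V ↦ M(V) ⊗ 𝒪(-x)(V)` to `M`. -/
def twistPresheafHom (x : X) : twistPresheaf M x ⟶ (toPresheafModules X).obj M :=
  (((curriedTensor _).flip.map (idealInclusion x)) ≫ (rightUnitorNatIso _).hom).app _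

/-- Elements of `M(V) ⊗ 𝒪(-x)(V)` as sections of the presheaf `twistPresheaf M x`. -/
def ofTensor (x : X) (V : X.Opens) :
    TensorProduct Γ(X, V) Γ(M, V) (pointIdeal x V) ≃ (twistPresheaf M x).obj (.op V) :=
  .refl _

theorem twistPresheafHom_ofTensor (x : X) (V : X.Opens)
    (z : TensorProduct Γ(X, V) Γ(M, V) (pointIdeal x V)) :
    ((twistPresheafHom M x).app (.op V) (ofTensor x V z) : Γ(M, V)) =
      TensorProduct.rid Γ(X, V) Γ(M, V) ((pointIdeal x V).subtype.lTensor Γ(M, V) z) := by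
  induction z using TensorProduct.induction_on with
  | zero => exact (map_zero _).trans (by
      rw [map_zero, map_zero]
      rfl)
  | tmul m f => rfl
  | add a b ha hb =>
    have h := (congrArg (TensorProduct.rid Γ(X, V) Γ(M, V)) (map_add
      ((pointIdeal x V).subtype.lTensor Γ(M, V)) a b)).trans (map_add _ _ _)
    exact (map_add ((twistPresheafHom M x).app (.op V)).hom (ofTensor x V a)
      (ofTensor x V b)).trans ((congrArg₂ (fun u v : Γ(M, V) ↦ u + v) ha hb).trans h.symm)

/-- The canonical map from `M(V) ⊗ 𝒪(-x)(V)` to the sections of `M ⊗ 𝒪(-x)` over `V`. -/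
def twistUnit (x : X) (V : X.Opens) (z : (twistPresheaf M x).obj (.op V)) :
    Γ((twist x).obj M, V) :=
  (CategoryTheory.toSheafify (Opens.grothendieckTopology X) (twistPresheaf M x).presheaf).app
    (.op V) z

theorem homEquiv_map_counit {C D : Type*} [Category* C] [Category* D] {F : C ⥤ D} {G : D ⥤ C}
    (adj : F ⊣ G) {P : C} {Q : D} (g : P ⟶ G.obj Q) :
    adj.homEquiv P Q (F.map g ≫ adj.counit.app Q) = g := by
  rw [← adj.homEquiv_counit, Equiv.apply_symm_apply]

theorem mapp_twistUnit (x : X) (V : X.Opens) (z : (twistPresheaf M x).obj (.op V)) :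
    mapp ((twistInclusion x).app M) V (twistUnit x V z) =
      ((twistPresheafHom M x).app (.op V) z : Γ(M, V)) := by
  have h : PresheafOfModules.sheafificationHomEquiv (𝟙 X.ringCatSheaf.obj)
      ((twistInclusion x).app M) = twistPresheafHom M x :=
    homEquiv_map_counit (PresheafOfModules.sheafificationAdjunction (𝟙 X.ringCatSheaf.obj))
      (P := twistPresheaf M x) (Q := M) (twistPresheafHom M x)
  exact congr((((PresheafOfModules.toPresheaf _).map $h).app (.op V)) z)

theorem exists_twistUnit_eq (x : X) (s : Γ((twist x).obj M, U)) {p : X} (hp : p ∈ U) :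
    ∃ (V : X.Opens) (hV : V ≤ U), p ∈ V ∧ ∀ (W : X.Opens) (hW : W ≤ V),
      ∃ z : TensorProduct Γ(X, W) Γ(M, W) (pointIdeal x W),
        twistUnit x W (ofTensor x W z) = mres _ (hW.trans hV) s := by
  have h : Presheaf.IsLocallySurjective (Opens.grothendieckTopology X)
    (CategoryTheory.toSheafify (Opens.grothendieckTopology X) (twistPresheaf M x).presheaf) :=
    inferInstance
  obtain ⟨V, i, ⟨z, hz⟩, hpV⟩ := h.imageSieve_mem (U := U) s p hp
  refine ⟨V, leOfHom i, hpV, fun W hW ↦ ?_⟩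
  refine ⟨(ofTensor x W).symm ((twistPresheaf M x).presheaf.map (homOfLE hW).op z), ?_⟩
  have h1 := congr($((CategoryTheory.toSheafify (Opens.grothendieckTopology X)
    (twistPresheaf M x).presheaf).naturality (homOfLE hW).op) z)
  refine h1.trans ?_
  have h2 := congrArg (mres ((twist x).obj M) hW) hz
  refine h2.trans ?_
  exact mres_mres (leOfHom i) hW s

theorem lTensor_pointIdeal_injective (x : X) {e : Fin n → Γ(M, V)} (he : IsFrame M V e) :
    Function.Injective ((pointIdeal x V).subtype.lTensor Γ(M, V)) := by
  have := Module.Free.of_basis he.basis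
  exact Module.Flat.lTensor_preserves_injective_linearMap _ Subtype.val_injective

theorem twistInclusion_injective (hM : IsLocallyFreeOfRank M n) (x : X) (U : X.Opens) :
    Function.Injective (mapp ((twistInclusion x).app M) U) := by
  rw [injective_iff_map_eq_zero]
  intro s hs
  have key (p : U) : ∃ (V : X.Opens) (hV : V ≤ U), p.1 ∈ V ∧ mres _ hV s = 0 := by
    obtain ⟨V, hV, hpV, hz⟩ := exists_twistUnit_eq x s p.2
    obtain ⟨D, e, hpD, hD⟩ := hM.exists_isFrame p.1
    obtain ⟨z, hz⟩ := hz (V ⊓ D) inf_le_left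
    refine ⟨V ⊓ D, inf_le_left.trans hV, ⟨hpV, hpD⟩, ?_⟩
    have h1 := congrArg (mapp ((twistInclusion x).app M) (V ⊓ D)) hz
    rw [mapp_mres, mapp_twistUnit, twistPresheafHom_ofTensor, hs] at h1
    have h2 : z = 0 := by
      apply lTensor_pointIdeal_injective x (hD.mono inf_le_right)
      apply (TensorProduct.rid _ _).injective
      rw [h1, map_zero, map_zero, map_zero]
    rw [← hz, h2]
    exact map_zero _
  choose V hV hp h0 using key
  exact section_ext V U hV (fun p hp' ↦ Opens.mem_iSup.2 ⟨⟨p, hp'⟩, hp _⟩) fun p ↦ by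
    rw [h0, map_zero]

/-- The image of `M ⊗ 𝒪(-x)` in `M` consists of the sections that are locally combinations of
sections with coefficients vanishing at `x`. -/
theorem mem_range_twistInclusion_iff (hM : IsLocallyFreeOfRank M n) (x : X) (s : Γ(M, U)) :
    s ∈ LinearMap.range (mapp ((twistInclusion x).app M) U) ↔
      ∀ p ∈ U, ∃ (V : X.Opens) (hV : V ≤ U), p ∈ V ∧
        mres M hV s ∈ pointIdeal x V • (⊤ : Submodule Γ(X, V) Γ(M, V)) := by
  constructor
  · rintro ⟨s, rfl⟩ p hp
    obtain ⟨V, hV, hpV, hz⟩ := exists_twistUnit_eq x s hp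
    obtain ⟨z, hz⟩ := hz V le_rfl
    refine ⟨V, hV, hpV, ?_⟩
    rw [← mapp_mres, ← hz, mapp_twistUnit, twistPresheafHom_ofTensor]
    clear hz
    induction z using TensorProduct.induction_on with
    | zero => simp
    | tmul m f => exact Submodule.smul_mem_smul f.2 trivial
    | add a b ha hb =>
      rw [map_add, map_add]
      exact add_mem ha hb
  · intro h
    refine mem_range_of_locally (twistInclusion_injective hM x) fun p hp ↦ ?_
    obtain ⟨V, hV, hpV, hs⟩ := h p hp
    refine ⟨V, hV, hpV, ?_⟩
    refine Submodule.smul_induction_on hs (fun f hf m _ ↦ ?_) fun a b ha hb ↦ add_mem ha hb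
    refine ⟨twistUnit x V (ofTensor x V (m ⊗ₜ[Γ(X, V)] ⟨f, hf⟩)), ?_⟩
    rw [mapp_twistUnit, twistPresheafHom_ofTensor]
    rfl

/-- `ℓ` is a local equation of the point `x` on `U`: it vanishes at `x` and locally divides every
function that does. -/
structure IsLocalEquation (x : X) (U : X.Opens) (ℓ : Γ(X, U)) : Prop where
  ne_zero : ℓ ≠ 0
  mem : ℓ ∈ pointIdeal x U
  dvd : ∀ (V : X.Opens) (h : V ≤ U), ∀ f ∈ pointIdeal x V, ∀ p ∈ V,
    ∃ (W : X.Opens) (hW : W ≤ V), p ∈ W ∧ ores (hW.trans h) ℓ ∣ ores hW f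

theorem mem_range_twistInclusion_iff_exists_smul [IsIntegral X] (hM : IsLocallyFreeOfRank M n)
    {x : X} {ℓ : Γ(X, U)} (hℓ : IsLocalEquation x U ℓ) (h : V ≤ U) (s : Γ(M, V)) :
    s ∈ LinearMap.range (mapp ((twistInclusion x).app M) V) ↔
      ∃ w : Γ(M, V), s = ores h ℓ • w := by
  rw [mem_range_twistInclusion_iff hM]
  constructor
  · intro hs
    have key (p : V) : ∃ (W : X.Opens) (hW : W ≤ V), p.1 ∈ W ∧
        ∃ w : Γ(M, W), mres M hW s = ores (hW.trans h) ℓ • w := by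
      obtain ⟨Z, hZ, hp, hs⟩ := hs p.1 p.2
      refine Submodule.smul_induction_on
        (p := fun t ↦ ∃ (W : X.Opens) (hW : W ≤ Z), p.1 ∈ W ∧
          ∃ w : Γ(M, W), mres M hW t = ores (hW.trans (hZ.trans h)) ℓ • w) hs
        (fun f hf m _ ↦ ?_) ?_ |>.elim fun W ⟨hW, hp, w, hw⟩ ↦
          ⟨W, hW.trans hZ, hp, w, by rw [← hw, mres_mres]⟩
      · obtain ⟨W, hW, hpW, c, hc⟩ := hℓ.dvd Z (hZ.trans h) f hf p.1 hp
        exact ⟨W, hW, hpW, c • mres M hW m, by rw [mres_smul, hc, mul_smul]⟩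
      · rintro a b ⟨W, hW, hpW, w, hw⟩ ⟨W', hW', hpW', w', hw'⟩
        refine ⟨W ⊓ W', inf_le_left.trans hW, ⟨hpW, hpW'⟩,
          mres M inf_le_left w + mres M inf_le_right w', ?_⟩
        have h1 := congrArg (mres M (inf_le_left : W ⊓ W' ≤ W)) hw
        have h2 := congrArg (mres M (inf_le_right : W ⊓ W' ≤ W')) hw'
        rw [mres_smul, mres_mres, ores_ores] at h1 h2
        rw [map_add, h1, h2, smul_add]
    choose W hW hp w hw using key
    have hcov : V ≤ iSup W := fun p hp' ↦ Opens.mem_iSup.2 ⟨⟨p, hp'⟩, hp _⟩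
    obtain ⟨t, ht⟩ := exists_section_gluing W V hW hcov w fun p q ↦ by
      by_cases hne : W p ⊓ W q = ⊥
      · have := subsingleton_sections_bot M
        rw [← hne] at this
        exact Subsingleton.elim _ _
      have hl : ores (U := U) (V := W p ⊓ W q) (inf_le_left.trans ((hW p).trans h)) ℓ ≠ 0 :=
        fun h0 ↦ hℓ.ne_zero (ores_injective _ hne (h0.trans (map_zero _).symm))
      apply smul_injective hM hne hl
      have h1 := congrArg (mres M (inf_le_left : W p ⊓ W q ≤ W p)) (hw p)
      have h2 := congrArg (mres M (inf_le_right : W p ⊓ W q ≤ W q)) (hw q)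
      rw [mres_smul, mres_mres, ores_ores] at h1 h2
      exact h1.symm.trans h2
    refine ⟨t, section_ext W V hW hcov fun p ↦ ?_⟩
    rw [hw, mres_smul, ht, ores_ores]
  · rintro ⟨w, rfl⟩ p hp
    refine ⟨V, le_rfl, hp, ?_⟩
    rw [mres_self]
    exact Submodule.smul_mem_smul (map_mem_pointIdeal x h hℓ.mem) trivial

end TwistImage

/-! ### The coordinate rings of the projective line -/

theorem proj_toSpecZero_appTop {A : Type u} {σ : Type*} [CommRing A] [SetLike σ A]
    [AddSubgroupClass σ A] (𝒜 : ℕ → σ) [GradedRing 𝒜] {f : A} {m : ℕ} (hf : f ∈ 𝒜 m) (hm : 0 < m) :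
    (Proj.toSpecZero 𝒜).appTop ≫ (Proj 𝒜).presheaf.map (Proj.basicOpen 𝒜 f).leTop.op =
      (Scheme.ΓSpecIso _).hom ≫ CommRingCat.ofHom
        (HomogeneousLocalization.fromZeroRingHom 𝒜 (.powers f)) ≫ Proj.awayToSection 𝒜 f := by
  have h1 : (Proj.basicOpen 𝒜 f).ι ≫ Proj.toSpecZero 𝒜 = Proj.basicOpenToSpec 𝒜 f ≫
      Spec.map (CommRingCat.ofHom (HomogeneousLocalization.fromZeroRingHom 𝒜 (.powers f))) := by
    rw [← Proj.awayι_toSpecZero 𝒜 f hf hm, ← Proj.basicOpenIsoSpec_hom 𝒜 f hf hm,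
      ← Proj.basicOpenIsoSpec_inv_ι, Category.assoc, Iso.hom_inv_id_assoc]
  have h2 := congr(Scheme.Hom.appTop $h1 ≫ (Proj.basicOpen 𝒜 f).topIso.hom)
  have h5 := Proj.basicOpenToSpec_app_top 𝒜 f
  have h6 := Scheme.ΓSpecIso_naturality (CommRingCat.ofHom
    (HomogeneousLocalization.fromZeroRingHom 𝒜 (.powers f)))
  rw [Scheme.Hom.comp_appTop, Scheme.Hom.comp_appTop, Category.assoc, Category.assoc] at h2
  rw [← Category.assoc, ← h6, Category.assoc]
  refine Eq.trans ?_ (h2.trans ?_)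
  · congr 1
  · congr 1
    rw [Scheme.Hom.appTop, h5, Category.assoc, Category.assoc, Iso.inv_hom_id, Category.comp_id]

section Geometry

variable (k : Type u) [Field k]

instance : IsReduced (P1 k) := by
  have (p : P1 k) : _root_.IsReduced ((P1 k).presheaf.stalk p) := by
    have e := (Proj.stalkIso (MvPolynomial.homogeneousSubmodule (Fin 2) k) p).commRingCatIsoToRingEquiv
    have : p.asHomogeneousIdeal.toIdeal.IsPrime := p.isPrime
    have : _root_.IsReduced (HomogeneousLocalization.AtPrime
        (MvPolynomial.homogeneousSubmodule (Fin 2) k) p.asHomogeneousIdeal.toIdeal) := by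
      have : IsDomain (Localization.AtPrime p.asHomogeneousIdeal.toIdeal) :=
        IsLocalization.isDomain_localization p.asHomogeneousIdeal.toIdeal.primeCompl_le_nonZeroDivisors
      exact isReduced_of_injective (algebraMap _ (Localization.AtPrime p.asHomogeneousIdeal.toIdeal))
        (HomogeneousLocalization.val_injective _)
    exact isReduced_of_injective e e.injective
  exact isReduced_of_isReduced_stalk _

theorem mem_chart_iff (i : Fin 2) (p : P1 k) :
    p ∈ chart k i ↔ (MvPolynomial.X i : MvPolynomial (Fin 2) k) ∉ p.asHomogeneousIdeal :=
  Iff.rfl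

theorem chart_sup_chart : chart k 0 ⊔ chart k 1 = ⊤ := by
  have h := Proj.iSup_basicOpen_eq_top' (MvPolynomial.homogeneousSubmodule (Fin 2) k)
    (fun i : Fin 2 ↦ (MvPolynomial.X i : MvPolynomial (Fin 2) k))
    (fun i ↦ ⟨1, MvPolynomial.isHomogeneous_X k i⟩) (by
      rw [eq_top_iff]
      rintro p -
      induction p using MvPolynomial.induction_on with
      | C a =>
        exact Subalgebra.algebraMap_mem _ (⟨MvPolynomial.C a, MvPolynomial.isHomogeneous_C _ a⟩ :
          MvPolynomial.homogeneousSubmodule (Fin 2) k 0)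
      | add p q hp hq => exact add_mem hp hq
      | mul_X p i hp => exact mul_mem hp (Algebra.subset_adjoin ⟨i, rfl⟩))
  rw [← h]
  apply le_antisymm
  · exact sup_le (le_iSup (fun i : Fin 2 ↦ Proj.basicOpen _ (MvPolynomial.X i)) 0)
      (le_iSup (fun i : Fin 2 ↦ Proj.basicOpen _ (MvPolynomial.X i)) 1)
  · refine iSup_le fun i ↦ ?_
    fin_cases i
    · exact le_sup_left (a := chart k 0)
    · exact le_sup_right (b := chart k 1)

/-- The generic point, i.e. the zero ideal. -/
def genericPt : P1 k where
  asHomogeneousIdeal := ⊥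
  isPrime := by
    rw [HomogeneousIdeal.toIdeal_bot]
    infer_instance
  not_irrelevant_le h := by
    have : (MvPolynomial.X 0 : MvPolynomial (Fin 2) k) ∈ (⊥ : HomogeneousIdeal
        (MvPolynomial.homogeneousSubmodule (Fin 2) k)) := by
      apply h
      rw [HomogeneousIdeal.mem_irrelevant_iff, GradedRing.proj_apply]
      exact DirectSum.decompose_of_mem_ne _ (MvPolynomial.isHomogeneous_X k 0) one_ne_zero
    exact MvPolynomial.X_ne_zero (R := k) (0 : Fin 2) (by
      rwa [← HomogeneousIdeal.mem_iff, HomogeneousIdeal.toIdeal_bot] at this)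

theorem genericPt_mem (U : (P1 k).Opens) (hU : U ≠ ⊥) : genericPt k ∈ U := by
  obtain ⟨p, hp⟩ : ∃ p, p ∈ U := by
    by_contra! h
    exact hU (eq_bot_iff.2 fun p hp ↦ (h p hp).elim)
  obtain ⟨_, ⟨f, rfl⟩, hpf, hfU⟩ := (Opens.isBasis_iff_nbhd.1
    (Proj.isBasis_basicOpen (MvPolynomial.homogeneousSubmodule (Fin 2) k))) hp
  refine hfU ?_
  rw [Proj.mem_basicOpen]
  intro h
  have : f = 0 := by
    rwa [← HomogeneousIdeal.mem_iff, show (genericPt k).asHomogeneousIdeal.toIdeal = ⊥ from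
      HomogeneousIdeal.toIdeal_bot] at h
  subst this
  exact (Proj.mem_basicOpen _ _ _).1 hpf (zero_mem _)

instance : IsIntegral (P1 k) := by
  have : IrreducibleSpace (P1 k) :=
    { isPreirreducible_univ := by
        rintro U V hU hV ⟨p, -, hp⟩ ⟨q, -, hq⟩
        exact ⟨genericPt k, trivial, genericPt_mem k ⟨U, hU⟩ fun h ↦ (h ▸ hp : p ∈ (⊥ : (P1 k).Opens)),
          genericPt_mem k ⟨V, hV⟩ fun h ↦ (h ▸ hq : q ∈ (⊥ : (P1 k).Opens))⟩
      toNonempty := ⟨genericPt k⟩ }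
  exact isIntegral_of_irreducibleSpace_of_isReduced _

theorem isAffineOpen_chart (i : Fin 2) : IsAffineOpen (chart k i) :=
  Proj.isAffineOpen_basicOpen _ _ (MvPolynomial.isHomogeneous_X k i) one_pos

theorem scalars_chart (i : Fin 2) (a : k) : scalars k (chart k i) a =
    Proj.awayToSection (MvPolynomial.homogeneousSubmodule (Fin 2) k) (MvPolynomial.X i)
      (HomogeneousLocalization.fromZeroRingHom _ _
        (algebraMap k (MvPolynomial.homogeneousSubmodule (Fin 2) k 0) a)) := by
  have h1 := proj_toSpecZero_appTop (MvPolynomial.homogeneousSubmodule (Fin 2) k)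
    (MvPolynomial.isHomogeneous_X k i) one_pos
  have h2 : (Scheme.ΓSpecIso (.of k)).inv ≫ (Spec.map (CommRingCat.ofHom
      (algebraMap k (MvPolynomial.homogeneousSubmodule (Fin 2) k 0)))).appTop = CommRingCat.ofHom
      (algebraMap k (MvPolynomial.homogeneousSubmodule (Fin 2) k 0)) ≫
        (Scheme.ΓSpecIso (.of (MvPolynomial.homogeneousSubmodule (Fin 2) k 0))).inv :=
    (Scheme.ΓSpecIso_inv_naturality _).symm
  have h3 := congr(((Proj.toSpecZero (MvPolynomial.homogeneousSubmodule (Fin 2) k)).appTop ≫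
    (P1 k).presheaf.map (chart k i).leTop.op) ($h2 a))
  have h4 := congr($h1 ((Scheme.ΓSpecIso (.of (MvPolynomial.homogeneousSubmodule (Fin 2) k 0))).inv
    (algebraMap k (MvPolynomial.homogeneousSubmodule (Fin 2) k 0) a)))
  refine (h3.trans h4).trans ?_
  have h5 := congr($((Scheme.ΓSpecIso (.of (MvPolynomial.homogeneousSubmodule (Fin 2) k 0))).inv_hom_id)
    (algebraMap k (MvPolynomial.homogeneousSubmodule (Fin 2) k 0) a))
  exact congrArg (fun z ↦ Proj.awayToSection _ _
    (HomogeneousLocalization.fromZeroRingHom _ (.powers (MvPolynomial.X i)) z)) h5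

variable {k}

/-- The polynomial `f(X_j / X_i)` as a function on the chart `X_i ≠ 0`. -/
def chartEval (i j : Fin 2) : Polynomial k →+* Γ(P1 k, chart k i) :=
  Polynomial.eval₂RingHom (scalars k (chart k i)) (coordinate k i j)

theorem chartEval_C (i j : Fin 2) (a : k) :
    chartEval i j (.C a) = scalars k (chart k i) a :=
  Polynomial.eval₂_C _ _

theorem chartEval_X (i j : Fin 2) : chartEval i j (.X : Polynomial k) = coordinate k i j :=
  Polynomial.eval₂_X _ _

/-- The inhomogeneous form of `chartEval`. -/
def awayEval (i j : Fin 2) : Polynomial k →+*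
    HomogeneousLocalization.Away (MvPolynomial.homogeneousSubmodule (Fin 2) k)
      (MvPolynomial.X i) :=
  Polynomial.eval₂RingHom ((HomogeneousLocalization.fromZeroRingHom _ _).comp
    (algebraMap k (MvPolynomial.homogeneousSubmodule (Fin 2) k 0)))
    (HomogeneousLocalization.Away.mk (MvPolynomial.homogeneousSubmodule (Fin 2) k)
      (MvPolynomial.isHomogeneous_X k i) 1 (MvPolynomial.X j)
      (by simpa using MvPolynomial.isHomogeneous_X k j))

theorem chartEval_eq (i j : Fin 2) (p : Polynomial k) : chartEval i j p =
    Proj.awayToSection (MvPolynomial.homogeneousSubmodule (Fin 2) k) (MvPolynomial.X i)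
      (awayEval i j p) := by
  have : chartEval i j = (Proj.awayToSection (MvPolynomial.homogeneousSubmodule (Fin 2) k)
      (MvPolynomial.X i)).hom.comp (awayEval i j) := by
    refine Polynomial.ringHom_ext (fun a ↦ ?_) ?_
    · rw [chartEval_C, scalars_chart]
      refine congrArg (Proj.awayToSection _ _) ?_
      rw [awayEval, Polynomial.coe_eval₂RingHom, Polynomial.eval₂_C]
      rfl
    · rw [chartEval_X]
      refine congrArg (Proj.awayToSection _ _) ?_
      rw [awayEval, Polynomial.coe_eval₂RingHom, Polynomial.eval₂_X]
  rw [this]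
  rfl

theorem awayEval_bijective {i j : Fin 2} (hij : i ≠ j) :
    Function.Bijective (awayEval (k := k) i j) := by
  let 𝒜 := MvPolynomial.homogeneousSubmodule (Fin 2) k
  let S := MvPolynomial (Fin 2) k
  -- setting `X_i = 1` and `X_j = X` inverts the evaluation
  let d : S →+* Polynomial k :=
    MvPolynomial.eval₂Hom Polynomial.C fun l ↦ if l = i then 1 else (Polynomial.X : Polynomial k)
  have hdi : d (MvPolynomial.X i) = 1 := (MvPolynomial.eval₂Hom_X' _ _ _).trans (if_pos rfl)
  have hdj : d (MvPolynomial.X j) = .X := (MvPolynomial.eval₂Hom_X' _ _ _).trans (if_neg hij.symm)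
  have hdC (a : k) : d (MvPolynomial.C a) = .C a := MvPolynomial.eval₂Hom_C _ _ _
  let L : Localization.Away (MvPolynomial.X i : S) →+* Polynomial k :=
    IsLocalization.Away.lift (MvPolynomial.X i : S) (g := d) (by rw [hdi]; exact isUnit_one)
  have hL (s : S) (n : ℕ) (hn) : L (Localization.mk s ⟨(MvPolynomial.X i) ^ n, hn⟩) = d s := by
    rw [Localization.mk_eq_mk']
    refine (IsLocalization.lift_mk'_spec _ _ _ _).2 ?_
    simp [map_pow, hdi]
  let D : HomogeneousLocalization.Away 𝒜 (MvPolynomial.X i) →+* Polynomial k :=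
    L.comp (algebraMap _ (Localization.Away (MvPolynomial.X i : S)))
  have hD (n s hs) : D (HomogeneousLocalization.Away.mk 𝒜 (MvPolynomial.isHomogeneous_X k i) n s hs)
      = d s := hL s n _
  have hDe : D.comp (awayEval i j) = RingHom.id _ := by
    refine Polynomial.ringHom_ext (fun a ↦ ?_) ?_
    · rw [RingHom.comp_apply, awayEval, Polynomial.coe_eval₂RingHom, Polynomial.eval₂_C]
      exact (hL (MvPolynomial.C a) 0 ⟨0, rfl⟩).trans (hdC a)
    · rw [RingHom.comp_apply, awayEval, Polynomial.coe_eval₂RingHom, Polynomial.eval₂_X]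
      exact (hD _ _ _).trans hdj
  refine ⟨fun p q h ↦ ?_, fun z ↦ ?_⟩
  · exact congr($hDe p).symm.trans ((congrArg D h).trans congr($hDe q))
  · obtain ⟨n, s, hs, rfl⟩ := HomogeneousLocalization.Away.mk_surjective 𝒜
      (MvPolynomial.isHomogeneous_X k i) z
    refine ⟨d s, HomogeneousLocalization.val_injective _ ?_⟩
    let θ : Polynomial k →+* Localization.Away (MvPolynomial.X i : S) :=
      (algebraMap (HomogeneousLocalization.Away 𝒜 (MvPolynomial.X i)) _).comp (awayEval i j)
    have hθC (a : k) : θ (d (MvPolynomial.C a)) = algebraMap S _ (MvPolynomial.C a) := by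
      rw [hdC, RingHom.comp_apply, awayEval, Polynomial.coe_eval₂RingHom, Polynomial.eval₂_C]
      rfl
    have hθX (l : Fin 2) : θ (d (MvPolynomial.X l)) * algebraMap S _ (MvPolynomial.X i) =
        algebraMap S _ (MvPolynomial.X l) := by
      by_cases hl : l = i
      · rw [hl, hdi, map_one, one_mul]
      · obtain rfl : l = j := by omega
        rw [hdj, RingHom.comp_apply, awayEval, Polynomial.coe_eval₂RingHom, Polynomial.eval₂_X]
        refine (congrArg (· * algebraMap S (Localization.Away (MvPolynomial.X i : S))
          (MvPolynomial.X i)) (Localization.mk_eq_mk'_apply (MvPolynomial.X l : S) _)).trans ?_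
        exact (congrArg (_ * algebraMap S (Localization.Away (MvPolynomial.X i : S)) ·)
          (pow_one _).symm).trans (IsLocalization.mk'_spec _ (MvPolynomial.X l : S)
          (⟨MvPolynomial.X i ^ 1, ⟨1, rfl⟩⟩ : Submonoid.powers (MvPolynomial.X i : S)))
    have key : algebraMap S (Localization.Away (MvPolynomial.X i : S)) s =
        θ (d s) * algebraMap S _ (MvPolynomial.X i) ^ n := by
      conv_lhs => rw [MvPolynomial.as_sum s]
      conv_rhs => rw [MvPolynomial.as_sum s]
      rw [map_sum, map_sum, map_sum, Finset.sum_mul]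
      refine Finset.sum_congr rfl fun v hv ↦ ?_
      have hvn : ∑ l, v l = n := by
        have := hs (MvPolynomial.mem_support_iff.1 hv)
        rw [Finsupp.weight_apply, Finsupp.sum_fintype _ _ (by simp)] at this
        simpa using this
      rw [MvPolynomial.monomial_eq, Finsupp.prod_fintype _ _ (by simp)]
      simp only [map_mul, map_prod, map_pow, hθC]
      rw [mul_assoc, ← hvn, ← Finset.prod_pow_eq_pow_sum, ← Finset.prod_mul_distrib]
      congr 1
      refine Finset.prod_congr rfl fun l _ ↦ ?_
      rw [← mul_pow, hθX]
    refine Eq.trans ?_ (Localization.mk_eq_mk'_apply s _).symm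
    exact (IsLocalization.eq_mk'_iff_mul_eq.2 (by rw [map_pow]; exact key.symm))

theorem chartEval_bijective {i j : Fin 2} (hij : i ≠ j) :
    Function.Bijective (chartEval (k := k) i j) := by
  have h : Function.Bijective (Proj.awayToSection (MvPolynomial.homogeneousSubmodule (Fin 2) k)
      (MvPolynomial.X i)) := by
    have := ConcreteCategory.bijective_of_isIso (Proj.basicOpenIsoAway
      (MvPolynomial.homogeneousSubmodule (Fin 2) k) (MvPolynomial.X i)
      (MvPolynomial.isHomogeneous_X k i) one_pos).hom
    exact this
  have e : (chartEval (k := k) i j : Polynomial k → Γ(P1 k, chart k i)) =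
    (Proj.awayToSection (MvPolynomial.homogeneousSubmodule (Fin 2) k)
      (MvPolynomial.X i)) ∘ awayEval i j := funext (chartEval_eq i j)
  rw [e]
  exact h.comp (awayEval_bijective hij)

instance (i : Fin 2) : IsPrincipalIdealRing Γ(P1 k, chart k i) := by
  obtain ⟨j, hij⟩ : ∃ j : Fin 2, i ≠ j := ⟨i + 1, by omega⟩
  exact IsPrincipalIdealRing.of_surjective _ (chartEval_bijective hij).surjective

theorem chart_ne_bot (i : Fin 2) : chart k i ≠ ⊥ := by
  intro h
  have : genericPt k ∈ chart k i := by
    rw [mem_chart_iff]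
    intro h
    exact MvPolynomial.X_ne_zero (R := k) i (by
      rwa [← HomogeneousIdeal.mem_iff, show (genericPt k).asHomogeneousIdeal.toIdeal = ⊥ from
        HomogeneousIdeal.toIdeal_bot] at h)
  rw [h] at this
  exact this

theorem coordinate_mul_coordinate (i j : Fin 2)
    {V : (P1 k).Opens} (hi : V ≤ chart k i) (hj : V ≤ chart k j) :
    ores hi (coordinate k i j) * ores hj (coordinate k j i) = 1 := by
  have hV : V ≤ Proj.basicOpen (MvPolynomial.homogeneousSubmodule (Fin 2) k)
      (MvPolynomial.X i * MvPolynomial.X j) := by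
    rw [Proj.basicOpen_mul]
    exact le_inf hi hj
  have h1 := congr($(Proj.awayMap_awayToSection (MvPolynomial.homogeneousSubmodule (Fin 2) k)
    (f := MvPolynomial.X i) (MvPolynomial.isHomogeneous_X k j) rfl)
    (HomogeneousLocalization.Away.mk (MvPolynomial.homogeneousSubmodule (Fin 2) k)
      (MvPolynomial.isHomogeneous_X k i) 1 (MvPolynomial.X j)
      (by simpa using MvPolynomial.isHomogeneous_X k j)))
  have h2 := congr($(Proj.awayMap_awayToSection (MvPolynomial.homogeneousSubmodule (Fin 2) k)
    (f := MvPolynomial.X j) (MvPolynomial.isHomogeneous_X k i) (mul_comm (MvPolynomial.X i) _))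
    (HomogeneousLocalization.Away.mk (MvPolynomial.homogeneousSubmodule (Fin 2) k)
      (MvPolynomial.isHomogeneous_X k j) 1 (MvPolynomial.X i)
      (by simpa using MvPolynomial.isHomogeneous_X k i)))
  have h3 := congrArg (ores hV) h1
  have h4 := congrArg (ores hV) h2
  have h5 : ores hV (Proj.awayToSection (MvPolynomial.homogeneousSubmodule (Fin 2) k) _
      (HomogeneousLocalization.awayMap _ (MvPolynomial.isHomogeneous_X k j) rfl
        (HomogeneousLocalization.Away.mk (MvPolynomial.homogeneousSubmodule (Fin 2) k)
      (MvPolynomial.isHomogeneous_X k i) 1 (MvPolynomial.X j)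
      (by simpa using MvPolynomial.isHomogeneous_X k j)))) =
      ores hi (coordinate k i j) := h3.trans (ores_ores _ _ _)
  have h6 : ores hV (Proj.awayToSection (MvPolynomial.homogeneousSubmodule (Fin 2) k) _
      (HomogeneousLocalization.awayMap _ (MvPolynomial.isHomogeneous_X k i)
        (mul_comm (MvPolynomial.X i) _)
        (HomogeneousLocalization.Away.mk (MvPolynomial.homogeneousSubmodule (Fin 2) k)
      (MvPolynomial.isHomogeneous_X k j) 1 (MvPolynomial.X i)
      (by simpa using MvPolynomial.isHomogeneous_X k i)))) =
      ores hj (coordinate k j i) := h4.trans (ores_ores _ _ _)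
  rw [← h5, ← h6, ← map_mul, ← map_mul]
  refine Eq.trans ?_ (map_one (ores hV))
  refine congrArg (ores hV) ?_
  refine Eq.trans ?_ (map_one (Proj.awayToSection (MvPolynomial.homogeneousSubmodule (Fin 2) k)
    (MvPolynomial.X i * MvPolynomial.X j)).hom)
  refine congrArg _ ?_
  apply HomogeneousLocalization.val_injective
  rw [HomogeneousLocalization.val_mul, HomogeneousLocalization.val_one]
  refine (congrArg₂ (· * ·)
    (HomogeneousLocalization.val_awayMap_mk (MvPolynomial.homogeneousSubmodule (Fin 2) k)
      (f := MvPolynomial.X i) (MvPolynomial.isHomogeneous_X k j) rfl (1 • 1)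
      ⟨MvPolynomial.X j, by simpa using MvPolynomial.isHomogeneous_X k j⟩ 1
      (by simpa using MvPolynomial.isHomogeneous_X k i))
    (HomogeneousLocalization.val_awayMap_mk (MvPolynomial.homogeneousSubmodule (Fin 2) k)
      (f := MvPolynomial.X j) (MvPolynomial.isHomogeneous_X k i) (mul_comm (MvPolynomial.X i) _)
      (1 • 1) ⟨MvPolynomial.X i, by simpa using MvPolynomial.isHomogeneous_X k i⟩ 1
      (by simpa using MvPolynomial.isHomogeneous_X k j))).trans ?_
  rw [Localization.mk_mul, ← Localization.mk_one, Localization.mk_eq_mk_iff,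
    Localization.r_iff_exists]
  refine ⟨1, ?_⟩
  simp
  ring

theorem isUnit_germ_coordinate_iff (i j : Fin 2) (p : P1 k) (hp : p ∈ chart k i) :
    IsUnit ((P1 k).presheaf.germ _ p hp (coordinate k i j)) ↔ p ∈ chart k j := by
  have h := congr($(ProjectiveSpectrum.Proj.awayToSection_germ
    (MvPolynomial.homogeneousSubmodule (Fin 2) k) (MvPolynomial.X i) p hp)
    (HomogeneousLocalization.Away.mk (MvPolynomial.homogeneousSubmodule (Fin 2) k)
      (MvPolynomial.isHomogeneous_X k i) 1 (MvPolynomial.X j)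
      (by simpa using MvPolynomial.isHomogeneous_X k j)))
  have hprime : p.asHomogeneousIdeal.toIdeal.IsPrime := p.isPrime
  have h1 : IsUnit ((P1 k).presheaf.germ _ p hp (coordinate k i j)) ↔
      IsUnit (HomogeneousLocalization.mapId (MvPolynomial.homogeneousSubmodule (Fin 2) k)
        (Submonoid.powers_le.mpr hp : _ ≤ p.asHomogeneousIdeal.toIdeal.primeCompl)
        (HomogeneousLocalization.Away.mk (MvPolynomial.homogeneousSubmodule (Fin 2) k)
          (MvPolynomial.isHomogeneous_X k i) 1 (MvPolynomial.X j)
          (by simpa using MvPolynomial.isHomogeneous_X k j))) :=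
    (iff_of_eq (congrArg IsUnit h)).trans (isUnit_map_iff
      (Proj.stalkIso' (MvPolynomial.homogeneousSubmodule (Fin 2) k) p).symm
      (HomogeneousLocalization.mapId (MvPolynomial.homogeneousSubmodule (Fin 2) k)
        (Submonoid.powers_le.mpr hp : _ ≤ p.asHomogeneousIdeal.toIdeal.primeCompl)
        (HomogeneousLocalization.Away.mk (MvPolynomial.homogeneousSubmodule (Fin 2) k)
          (MvPolynomial.isHomogeneous_X k i) 1 (MvPolynomial.X j)
          (by simpa using MvPolynomial.isHomogeneous_X k j))))
  rw [h1, ← HomogeneousLocalization.isUnit_iff_isUnit_val, mem_chart_iff]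
  refine (iff_of_eq (congrArg IsUnit (Localization.mk_eq_mk'_apply
    (MvPolynomial.X j : MvPolynomial (Fin 2) k)
    ⟨MvPolynomial.X i ^ 1, pow_mem (show MvPolynomial.X i ∈ p.asHomogeneousIdeal.toIdeal.primeCompl
      from hp) 1⟩))).trans ?_
  exact IsLocalization.AtPrime.isUnit_mk'_iff _ p.asHomogeneousIdeal.toIdeal _ _

theorem basicOpen_coordinate (i j : Fin 2) :
    (P1 k).basicOpen (coordinate k i j) = chart k i ⊓ chart k j := by
  ext p
  constructor
  · intro hp
    have hpi := (P1 k).basicOpen_le _ hp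
    exact ⟨hpi, (isUnit_germ_coordinate_iff i j p hpi).1 (((P1 k).mem_basicOpen _ _ hpi).1 hp)⟩
  · rintro ⟨hpi, hpj⟩
    exact ((P1 k).mem_basicOpen _ _ hpi).2 ((isUnit_germ_coordinate_iff i j p hpi).2 hpj)

theorem overlap_ne_bot : chart k 0 ⊓ chart k 1 ≠ ⊥ :=
  inf_ne_bot (chart_ne_bot 0) (chart_ne_bot 1)

end Geometry

section LocalEquation

theorem isUnit_ores_of_le_basicOpen {X : Scheme.{u}} {U V : X.Opens} (f : Γ(X, U)) (hV : V ≤ U)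
    (h : V ≤ X.basicOpen f) : IsUnit (ores hV f) := by
  have := (isUnit_ores_basicOpen f).map (ores h)
  rwa [ores_ores] at this

theorem mem_pointIdeal_iff {X : Scheme.{u}} {x : X} {U : X.Opens} {f : Γ(X, U)} :
    f ∈ pointIdeal x U ↔ x ∉ X.basicOpen f := by
  simp only [pointIdeal, Ideal.mem_iInf, RingHom.mem_ker]
  constructor
  · intro h hx
    exact (X.evaluation_ne_zero_iff_mem_basicOpen x (X.basicOpen_le f hx) f).2 hx
      (h (X.basicOpen_le f hx))
  · intro h hx
    exact (X.evaluation_eq_zero_iff_notMem_basicOpen x hx f).2 h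

theorem mem_primeIdealOf_iff {X : Scheme.{u}} {U : X.Opens} (hU : IsAffineOpen U) (p : U)
    (f : Γ(X, U)) : f ∈ (hU.primeIdealOf p).asIdeal ↔ p.1 ∉ X.basicOpen f := by
  have h : hU.primeIdealOf p ∈ hU.fromSpec ⁻¹ᵁ X.basicOpen f ↔ p.1 ∈ X.basicOpen f :=
    iff_of_eq (congrArg (· ∈ X.basicOpen f) (hU.fromSpec_primeIdealOf p))
  rw [← h, hU.fromSpec_preimage_basicOpen]
  exact not_not.symm

theorem pointIdeal_eq_primeIdealOf {X : Scheme.{u}} {U : X.Opens} (hU : IsAffineOpen U) (p : U) :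
    pointIdeal p.1 U = (hU.primeIdealOf p).asIdeal :=
  Ideal.ext fun f ↦ by rw [mem_pointIdeal_iff, mem_primeIdealOf_iff]

/-- On an affine open set, a generator of the ideal of a closed point is a local equation. -/
theorem isLocalEquation_of_pointIdeal_eq {X : Scheme.{u}} [IsIntegral X] {U : X.Opens}
    (hU : IsAffineOpen U) {x : X} (hx : IsClosed {x}) (hxU : x ∈ U) {ℓ : Γ(X, U)} (h0 : ℓ ≠ 0)
    (h : pointIdeal x U = Ideal.span {ℓ}) : IsLocalEquation x U ℓ where
  ne_zero := h0
  mem := h ▸ Ideal.mem_span_singleton_self ℓ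
  dvd V hV f hf p hp := by
    by_cases hpx : p = x
    · subst hpx
      obtain ⟨g, hgV, hpg⟩ := hU.exists_basicOpen_le ⟨p, hp⟩ (hV hp)
      refine ⟨X.basicOpen g, hgV, hpg, ?_⟩
      obtain ⟨m, hm⟩ := exists_pow_mul_eq_ores hU g rfl (X.basicOpen_le g) (ores hgV f)
      obtain ⟨y, hy⟩ := hm m le_rfl
      have hyp : y ∈ pointIdeal p U := by
        have h1 : ores (X.basicOpen_le g) y ∈ pointIdeal p (X.basicOpen g) := by
          rw [hy]
          exact Ideal.mul_mem_left _ _ (map_mem_pointIdeal p hgV hf)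
        rw [mem_pointIdeal_iff] at h1 ⊢
        have h2 := X.basicOpen_res y (homOfLE (X.basicOpen_le g)).op
        intro h3
        exact h1 (h2.ge ⟨hpg, h3⟩)
      rw [h, Ideal.mem_span_singleton] at hyp
      have hd := _root_.map_dvd (ores (X.basicOpen_le g)) hyp
      rw [hy] at hd
      exact (((isUnit_ores_basicOpen g).pow m).dvd_mul_left).1 hd
    · have hpl : p ∈ X.basicOpen ℓ := by
        by_contra hpl
        have hmax := hU.primeIdealOf_isMaximal_of_isClosed ⟨x, hxU⟩ hx
        rw [← pointIdeal_eq_primeIdealOf hU ⟨x, hxU⟩] at hmax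
        have hle : pointIdeal x U ≤ (hU.primeIdealOf ⟨p, hV hp⟩).asIdeal := by
          rw [h, Ideal.span_singleton_le_iff_mem, mem_primeIdealOf_iff]
          exact hpl
        have heq := hmax.eq_of_le (hU.primeIdealOf ⟨p, hV hp⟩).isPrime.ne_top hle
        have h1 : hU.primeIdealOf ⟨x, hxU⟩ = hU.primeIdealOf ⟨p, hV hp⟩ := by
          ext1
          rw [← heq, ← pointIdeal_eq_primeIdealOf hU ⟨x, hxU⟩]
        have h2 := congrArg hU.fromSpec h1
        rw [hU.fromSpec_primeIdealOf, hU.fromSpec_primeIdealOf] at h2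
        exact hpx h2.symm
      exact ⟨V ⊓ X.basicOpen ℓ, inf_le_left, ⟨hp, hpl⟩,
        (isUnit_ores_of_le_basicOpen ℓ _ inf_le_right).dvd⟩

variable {k : Type u} [Field k]

theorem exists_pointIdeal_chart_eq [IsAlgClosed k] {x : P1 k} (hx : IsClosed {x}) {i j : Fin 2}
    (hij : i ≠ j) (hxi : x ∈ chart k i) : ∃ a : k, pointIdeal x (chart k i) =
      Ideal.span {coordinate k i j - scalars k (chart k i) a} := by
  let e : Polynomial k ≃+* Γ(P1 k, chart k i) := .ofBijective _ (chartEval_bijective hij)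
  have hmax := (isAffineOpen_chart k i).primeIdealOf_isMaximal_of_isClosed ⟨x, hxi⟩ hx
  rw [← pointIdeal_eq_primeIdealOf (isAffineOpen_chart k i) ⟨x, hxi⟩] at hmax
  have hJ : (Ideal.comap e (pointIdeal x (chart k i))).IsMaximal :=
    Ideal.comap_isMaximal_of_equiv e
  obtain ⟨q, hq⟩ := (inferInstance : (Ideal.comap e (pointIdeal x (chart k i))).IsPrincipal)
  have hq' : Ideal.comap e (pointIdeal x (chart k i)) = Ideal.span {q} := hq
  have hq0 : q ≠ 0 := by
    rintro rfl
    rw [hq'] at hJ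
    exact Ring.ne_bot_of_isMaximal_of_not_isField hJ (Polynomial.not_isField k) (by simp)
  have hqirr : Irreducible q := by
    rw [hq'] at hJ
    exact ((Ideal.span_singleton_prime hq0).1 hJ.isPrime).irreducible
  obtain ⟨a, ha⟩ := IsAlgClosed.exists_root q
    (by rw [IsAlgClosed.degree_eq_one_of_irreducible k hqirr]; exact one_ne_zero)
  refine ⟨a, ?_⟩
  have hass : Associated (Polynomial.X - Polynomial.C a) q :=
    (Polynomial.irreducible_X_sub_C a).associated_of_dvd hqirr (Polynomial.dvd_iff_isRoot.2 ha)
  have h1 : Ideal.comap e (pointIdeal x (chart k i)) =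
      Ideal.span {Polynomial.X - Polynomial.C a} := by
    rw [hq', Ideal.span_singleton_eq_span_singleton.2 hass]
  have h2 : Ideal.map e (Ideal.comap e (pointIdeal x (chart k i))) = pointIdeal x (chart k i) :=
    Ideal.map_comap_of_surjective e e.surjective _
  rw [← h2, h1, Ideal.map_span, Set.image_singleton]
  congr 2
  change chartEval i j _ = _
  rw [map_sub, chartEval_X, chartEval_C]

theorem ores_scalars {U V : (P1 k).Opens} (h : V ≤ U) (a : k) :
    ores h (scalars k U a) = scalars k V a := rfl

/-- If `u_i - a` generates the ideal of `x` on a chart, then `1 - a u_j` is a local equation on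
the other chart. -/
theorem isLocalEquation_one_sub {x : P1 k} {i j : Fin 2} (hxi : x ∈ chart k i) {a : k}
    (h : IsLocalEquation x (chart k i) (coordinate k i j - scalars k (chart k i) a)) :
    IsLocalEquation x (chart k j) (1 - scalars k (chart k j) a * coordinate k j i) := by
  have key {V : (P1 k).Opens} (hi : V ≤ chart k i) (hj : V ≤ chart k j) :
      ores hi (coordinate k i j - scalars k (chart k i) a) =
        ores hi (coordinate k i j) *
          ores hj (1 - scalars k (chart k j) a * coordinate k j i) := by
    have := coordinate_mul_coordinate i j hi hj
    simp only [map_sub, map_mul, map_one, ores_scalars, mul_sub, mul_one]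
    rw [mul_left_comm, this, mul_one]
  refine ⟨fun h0 ↦ ?_, ?_, fun V hV f hf p hp ↦ ?_⟩
  · refine h.ne_zero (ores_injective (inf_le_left : chart k i ⊓ chart k j ≤ _)
      (inf_ne_bot (chart_ne_bot i) (chart_ne_bot j)) ?_)
    rw [key inf_le_left inf_le_right, h0, map_zero, map_zero, mul_zero]
  · rw [mem_pointIdeal_iff]
    intro hxl
    have hxj := (P1 k).basicOpen_le _ hxl
    let W : (P1 k).Opens := chart k i ⊓ (P1 k).basicOpen
      (1 - scalars k (chart k j) a * coordinate k j i)
    have hWj : W ≤ chart k j := inf_le_right.trans ((P1 k).basicOpen_le _)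
    have hWi : W ≤ chart k i := inf_le_left
    have h1 : IsUnit (ores hWi (coordinate k i j - scalars k (chart k i) a)) := by
      rw [key hWi hWj]
      exact (IsUnit.of_mul_eq_one _ (coordinate_mul_coordinate i j hWi hWj)).mul
        (isUnit_ores_of_le_basicOpen _ _ inf_le_right)
    have h2 := map_mem_pointIdeal x hWi h.mem
    rw [mem_pointIdeal_iff] at h2
    exact h2 (((P1 k).basicOpen_of_isUnit h1).ge ⟨hxi, hxl⟩)
  · by_cases hpi : p ∈ chart k i
    · obtain ⟨W, hW, hpW, hd⟩ := h.dvd (V ⊓ chart k i) inf_le_right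
        (ores inf_le_left f) (map_mem_pointIdeal x inf_le_left hf) p ⟨hp, hpi⟩
      refine ⟨W, hW.trans inf_le_left, hpW, ?_⟩
      rw [ores_ores, key _ (hW.trans (inf_le_left.trans hV))] at hd
      exact (dvd_mul_left _ _).trans hd
    · have hpl : p ∈ (P1 k).basicOpen (1 - scalars k (chart k j) a * coordinate k j i) := by
        rw [(P1 k).mem_basicOpen _ p (hV hp)]
        have h1 := IsLocalRing.isUnit_or_isUnit_one_sub_self ((P1 k).presheaf.germ _ p (hV hp)
          (scalars k (chart k j) a * coordinate k j i))
        rw [map_sub, map_one]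
        refine h1.resolve_left fun h2 ↦ hpi ?_
        rw [map_mul] at h2
        exact (isUnit_germ_coordinate_iff j i p (hV hp)).1 (isUnit_of_mul_isUnit_right h2)
      exact ⟨V ⊓ (P1 k).basicOpen _, inf_le_left, ⟨hp, hpl⟩,
        (isUnit_ores_of_le_basicOpen _ _ inf_le_right).dvd⟩

/-- A closed point of the projective line is the zero of a linear form, given here by its
dehomogenizations on the two charts. -/
theorem exists_isLocalEquation [IsAlgClosed k] {x : P1 k} (hx : IsClosed {x}) :
    ∃ (ℓ₀ : Γ(P1 k, chart k 0)) (ℓ₁ : Γ(P1 k, chart k 1)),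
      IsLocalEquation x (chart k 0) ℓ₀ ∧ IsLocalEquation x (chart k 1) ℓ₁ ∧
        ores (V := chart k 0 ⊓ chart k 1) inf_le_left ℓ₀ =
          ores inf_le_left (coordinate k 0 1) * ores inf_le_right ℓ₁ := by
  have hne {i j : Fin 2} (hij : i ≠ j) (a : k) :
      coordinate k i j - scalars k (chart k i) a ≠ 0 := by
    rw [← chartEval_C i j, ← chartEval_X i j, ← map_sub]
    rw [Ne, map_eq_zero_iff _ (chartEval_bijective hij).injective]
    exact Polynomial.X_sub_C_ne_zero a
  have hu := coordinate_mul_coordinate (k := k) 0 1 (V := chart k 0 ⊓ chart k 1)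
    inf_le_left inf_le_right
  rcases (chart_sup_chart k).ge (trivial : x ∈ (⊤ : (P1 k).Opens)) with h | h
  · obtain ⟨a, ha⟩ := exists_pointIdeal_chart_eq hx zero_ne_one h
    have h1 := isLocalEquation_of_pointIdeal_eq (isAffineOpen_chart k 0) hx h
      (hne zero_ne_one a) ha
    refine ⟨_, _, h1, isLocalEquation_one_sub h h1, ?_⟩
    simp only [map_sub, map_mul, map_one, ores_scalars, mul_sub, mul_one]
    rw [mul_left_comm, hu, mul_one]
  · obtain ⟨a, ha⟩ := exists_pointIdeal_chart_eq hx one_ne_zero h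
    have h1 := isLocalEquation_of_pointIdeal_eq (isAffineOpen_chart k 1) hx h
      (hne one_ne_zero a) ha
    refine ⟨_, _, isLocalEquation_one_sub h h1, h1, ?_⟩
    simp only [map_sub, map_mul, map_one, ores_scalars, mul_sub]
    rw [hu, mul_comm (scalars _ _ a)]

end LocalEquation
/-! ### Pairs of lattices over `k[t]` and `k[t⁻¹]` -/

section Lattices

variable {k : Type*} [Field k] {W : Type*} [AddCommGroup W] [Module k W]

/-- With `T` acting on `W` as multiplication by `t`, a `k[t]`-lattice of rank `n` in the
`k[t, t⁻¹]`-module `W`: a `k[t]`-submodule that generates `W` over `k[t, t⁻¹]`, is finitely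
generated, has fibre `kⁿ` at `t = 0`, and has a `k[t⁻¹]`-stable complement. -/
structure IsLattice (T : W ≃ₗ[k] W) (n : ℕ) (M : Submodule k W) : Prop where
  map_mem : ∀ w ∈ M, T w ∈ M
  exists_pow_mem : ∀ w, ∃ j : ℕ, (T ^ j) w ∈ M
  exists_fibre : ∃ f : M →ₗ[k] (Fin n → k), Function.Surjective f ∧
    ∀ w : M, f w = 0 ↔ T.symm w.1 ∈ M
  exists_generators : ∃ S : Finset W, (S : Set W) ⊆ M ∧
    ∀ P : Submodule k W, (S : Set W) ⊆ P → (∀ w ∈ P, T w ∈ P) → M ≤ P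
  exists_complement : ∃ N : Submodule k W, (∀ w ∈ N, T.symm w ∈ N) ∧ M ⊓ N = ⊥ ∧
    ∀ w, ∃ j : ℕ, (T.symm ^ j) w ∈ N

variable {T : W ≃ₗ[k] W} {n m : ℕ} {M M₀ M₁ : Submodule k W}

theorem pow_mem_of_map_mem (h : ∀ w ∈ M, T w ∈ M) (j : ℕ) : ∀ w ∈ M, (T ^ j) w ∈ M := by
  induction j with
  | zero => exact fun w hw ↦ hw
  | succ j ih =>
    intro w hw
    rw [pow_succ']
    exact h _ (ih w hw)

theorem pow_mem_of_le (h : ∀ w ∈ M, T w ∈ M) {i j : ℕ} (hij : i ≤ j) {w : W}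
    (hw : (T ^ i) w ∈ M) : (T ^ j) w ∈ M := by
  obtain ⟨l, rfl⟩ := Nat.exists_eq_add_of_le' hij
  rw [pow_add]
  exact pow_mem_of_map_mem h l _ hw

theorem exists_pow_mem_finset (h : ∀ w ∈ M, T w ∈ M) (h' : ∀ w, ∃ j : ℕ, (T ^ j) w ∈ M)
    (S : Finset W) : ∃ j : ℕ, ∀ w ∈ S, (T ^ j) w ∈ M := by
  choose d hd using h'
  exact ⟨S.sup d, fun w hw ↦ pow_mem_of_le h (Finset.le_sup hw) (hd w)⟩

/-- The powers `T ^ (-j)` exhaust `W` from a lattice. -/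
theorem IsLattice.induction (h : IsLattice T n M) {p : W → Prop} (hM : ∀ w ∈ M, p w)
    (hT : ∀ w, p (T w) → p w) (w : W) : p w := by
  obtain ⟨j, hj⟩ := h.exists_pow_mem w
  have : p ((T ^ j) w) := hM _ hj
  clear hj
  induction j with
  | zero => exact this
  | succ j ih => exact ih (hT _ (by rwa [pow_succ'] at this))

theorem pow_pow_symm (j : ℕ) (w : W) : (T ^ j) ((T.symm ^ j) w) = w := by
  rw [← LinearEquiv.mul_apply, show T.symm = T⁻¹ from rfl, inv_pow, mul_inv_cancel]
  rfl

theorem pow_symm_pow (j : ℕ) (w : W) : (T.symm ^ j) ((T ^ j) w) = w :=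
  pow_pow_symm (T := T.symm) j w

/-- After enough twisting, two opposite lattices meet trivially. -/
theorem exists_pow_inf_eq_bot (h₀ : IsLattice T n M₀) (h₁ : IsLattice T.symm m M₁) :
    ∃ B : ℕ, ∀ w ∈ M₀, (T ^ B) w ∈ M₁ → w = 0 := by
  obtain ⟨N, hN, hMN, hex⟩ := h₀.exists_complement
  obtain ⟨S, -, hS⟩ := h₁.exists_generators
  obtain ⟨B, hB⟩ := exists_pow_mem_finset hN hex S
  have hle : M₁ ≤ N.comap (T.symm ^ B).toLinearMap := by
    refine hS _ (fun w hw ↦ hB w hw) fun w hw ↦ ?_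
    change (T.symm ^ B) (T.symm w) ∈ N
    rw [← LinearEquiv.mul_apply, ← pow_succ, pow_succ']
    exact hN _ hw
  refine ⟨B, fun w hw hw' ↦ ?_⟩
  have h2 : (T.symm ^ B) ((T ^ B) w) ∈ N := hle hw'
  rw [pow_symm_pow] at h2
  have h3 : w ∈ M₀ ⊓ N := ⟨hw, h2⟩
  rwa [hMN] at h3

/-- After enough twisting in the other direction, two opposite lattices span everything. -/
theorem exists_pow_sup_eq_top (h₀ : IsLattice T n M₀) (h₁ : IsLattice T.symm m M₁) :
    ∃ B : ℕ, M₀ ⊔ M₁.comap (T.symm ^ B).toLinearMap = ⊤ := by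
  obtain ⟨S, hSM, hS⟩ := h₀.exists_generators
  obtain ⟨B, hB⟩ := exists_pow_mem_finset h₁.map_mem h₁.exists_pow_mem S
  refine ⟨B, ?_⟩
  set Q := M₀ ⊔ M₁.comap (T.symm ^ B).toLinearMap
  let P : Submodule k W := M₀ ⊓ ⨅ j : ℕ, Q.comap (T.symm ^ j).toLinearMap
  have hP (w : W) : w ∈ P ↔ w ∈ M₀ ∧ ∀ j : ℕ, (T.symm ^ j) w ∈ Q := by
    simp [P]
  have hMP : M₀ ≤ P := by
    refine hS _ (fun w hw ↦ (hP w).2 ⟨hSM hw, fun j ↦ ?_⟩) fun w hw ↦ ?_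
    · refine Submodule.mem_sup_right ?_
      change (T.symm ^ B) ((T.symm ^ j) w) ∈ M₁
      rw [← LinearEquiv.mul_apply, ← pow_add]
      exact pow_mem_of_le h₁.map_mem (Nat.le_add_right B j) (hB w hw)
    · rw [hP] at hw ⊢
      refine ⟨h₀.map_mem _ hw.1, fun j ↦ ?_⟩
      cases j with
      | zero => exact Submodule.mem_sup_left (h₀.map_mem _ hw.1)
      | succ j =>
        rw [pow_succ, LinearEquiv.mul_apply, LinearEquiv.symm_apply_apply]
        exact hw.2 j
  rw [eq_top_iff]
  rintro w -
  obtain ⟨j, hj⟩ := h₀.exists_pow_mem w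
  have := ((hP _).1 (hMP hj)).2 j
  rwa [pow_symm_pow] at this

/-- The dimension of `M₀ ∩ M₁`. -/
def pairH0 (M₀ M₁ : Submodule k W) : ℕ := Module.finrank k ↥(M₀ ⊓ M₁)

/-- The dimension of `W / (M₀ + M₁)`. -/
def pairH1 (M₀ M₁ : Submodule k W) : ℕ := Module.finrank k (W ⧸ (M₀ ⊔ M₁))

theorem pairH0_eq_zero_of_inf (h : M₀ ⊓ M₁ = ⊥) : pairH0 M₀ M₁ = 0 := by
  rw [pairH0, h, finrank_bot]

theorem pairH1_eq_zero_of_sup (h : M₀ ⊔ M₁ = ⊤) : pairH1 M₀ M₁ = 0 := by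
  have : Subsingleton (W ⧸ (M₀ ⊔ M₁)) := Submodule.Quotient.subsingleton_iff.2 h
  exact Module.finrank_zero_of_subsingleton

section Step

variable {M₁' : Submodule k W} {f : M₁ →ₗ[k] (Fin n → k)}

theorem finite_inf_of_step (hf : ∀ w : M₁, f w = 0 ↔ w.1 ∈ M₁')
    [Module.Finite k ↥(M₀ ⊓ M₁')] : Module.Finite k ↥(M₀ ⊓ M₁) := by
  let α : ↥(M₀ ⊓ M₁) →ₗ[k] (Fin n → k) := f ∘ₗ Submodule.inclusion inf_le_right
  let i : LinearMap.ker α →ₗ[k] ↥(M₀ ⊓ M₁') :=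
    LinearMap.codRestrict _ ((M₀ ⊓ M₁).subtype ∘ₗ (LinearMap.ker α).subtype)
      fun w ↦ ⟨w.1.2.1, (hf _).1 w.2⟩
  have : Module.Finite k (LinearMap.ker α) := Module.Finite.of_injective i fun a b h ↦
    Subtype.ext (Subtype.ext congr(($h).1))
  have : Module.Finite k (↥(M₀ ⊓ M₁) ⧸ LinearMap.ker α) :=
    Module.Finite.equiv α.quotKerEquivRange.symm
  exact Module.Finite.of_submodule_quotient (LinearMap.ker α)

/-- The exact sequence `H⁰(M) ⟶ kⁿ ⟶ H¹(M') ⟶ H¹(M) ⟶ 0` of a pair `M = (M₀, M₁)` and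
`M' = (M₀, M₁')` with `M₁ / M₁' ≅ kⁿ`. -/
theorem step_exact (h : M₁' ≤ M₁) (hsurj : Function.Surjective f)
    (hf : ∀ w : M₁, f w = 0 ↔ w.1 ∈ M₁') :
    ∃ (α : ↥(M₀ ⊓ M₁) →ₗ[k] (Fin n → k)) (g : (Fin n → k) →ₗ[k] W ⧸ (M₀ ⊔ M₁'))
      (q : (W ⧸ (M₀ ⊔ M₁')) →ₗ[k] W ⧸ (M₀ ⊔ M₁)),
      (∀ w, α w = 0 ↔ w.1 ∈ M₁') ∧ LinearMap.ker g = LinearMap.range α ∧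
        LinearMap.ker q = LinearMap.range g ∧ Function.Surjective q := by
  obtain ⟨s, hs⟩ := f.exists_rightInverse_of_surjective (LinearMap.range_eq_top.2 hsurj)
  have hs' (v) : f (s v) = v := congr($hs v)
  refine ⟨f ∘ₗ Submodule.inclusion inf_le_right, (M₀ ⊔ M₁').mkQ ∘ₗ M₁.subtype ∘ₗ s,
    Submodule.factor (sup_le_sup_left h M₀), fun w ↦ hf _, ?_, ?_,
    Submodule.factor_surjective _⟩
  · ext v
    simp only [LinearMap.mem_ker, LinearMap.comp_apply, Submodule.mkQ_apply,
      Submodule.Quotient.mk_eq_zero, LinearMap.mem_range, Submodule.subtype_apply]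
    constructor
    · intro hv
      obtain ⟨p, hp, q, hq, hpq⟩ := Submodule.mem_sup.1 hv
      have hp1 : p ∈ M₁ := by
        rw [eq_sub_of_add_eq hpq]
        exact sub_mem (s v).2 (h hq)
      refine ⟨⟨p, hp, hp1⟩, ?_⟩
      have : Submodule.inclusion inf_le_right (⟨p, hp, hp1⟩ : ↥(M₀ ⊓ M₁)) = s v - ⟨q, h hq⟩ :=
        Subtype.ext (eq_sub_of_add_eq hpq)
      rw [this, map_sub, hs', (hf ⟨q, h hq⟩).2 hq, sub_zero]
    · rintro ⟨w, rfl⟩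
      have h1 := (hf (s (f (Submodule.inclusion inf_le_right w)) -
        Submodule.inclusion inf_le_right w)).1 (by rw [map_sub, hs', sub_self])
      have h2 := Submodule.add_mem_sup w.2.1 h1
      rwa [AddSubgroupClass.coe_sub, Submodule.coe_inclusion, add_sub_cancel] at h2
  · ext w
    obtain ⟨w, rfl⟩ := Submodule.mkQ_surjective _ w
    simp only [LinearMap.mem_ker, LinearMap.mem_range, LinearMap.comp_apply,
      Submodule.mkQ_apply, Submodule.subtype_apply]
    refine (show _ ↔ w ∈ M₀ ⊔ M₁ from Submodule.Quotient.mk_eq_zero _).trans ?_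
    constructor
    · intro hw
      obtain ⟨p, hp, q, hq, rfl⟩ := Submodule.mem_sup.1 hw
      refine ⟨f ⟨q, hq⟩, (Submodule.Quotient.eq _).2 ?_⟩
      have h1 := (hf (s (f ⟨q, hq⟩) - ⟨q, hq⟩)).1 (by rw [map_sub, hs', sub_self])
      have h2 := Submodule.add_mem_sup (neg_mem hp) h1
      convert! h2 using 1
      rw [AddSubgroupClass.coe_sub]
      abel
    · rintro ⟨v, hv⟩
      have h1 := (Submodule.Quotient.eq _).1 hv
      have h2 := sub_mem (Submodule.mem_sup_right (S := M₀) (s v).2) (sup_le_sup_left h M₀ h1)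
      rwa [sub_sub_cancel] at h2

theorem finite_quotient_of_step (h : M₁' ≤ M₁) (hsurj : Function.Surjective f)
    (hf : ∀ w : M₁, f w = 0 ↔ w.1 ∈ M₁') [Module.Finite k (W ⧸ (M₀ ⊔ M₁))] :
    Module.Finite k (W ⧸ (M₀ ⊔ M₁')) := by
  obtain ⟨α, g, q, hα, hg, hq, hqs⟩ := step_exact (M₀ := M₀) h hsurj hf
  have : Module.Finite k (LinearMap.ker q) := by
    rw [hq]
    infer_instance
  have : Module.Finite k ((W ⧸ (M₀ ⊔ M₁')) ⧸ LinearMap.ker q) :=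
    Module.Finite.equiv (q.quotKerEquivOfSurjective hqs).symm
  exact Module.Finite.of_submodule_quotient (LinearMap.ker q)

theorem pair_step (h : M₁' ≤ M₁) (hsurj : Function.Surjective f)
    (hf : ∀ w : M₁, f w = 0 ↔ w.1 ∈ M₁') [Module.Finite k (W ⧸ (M₀ ⊔ M₁'))]
    [Module.Finite k ↥(M₀ ⊓ M₁)] :
    (pairH0 M₀ M₁' : ℤ) - pairH1 M₀ M₁' = pairH0 M₀ M₁ - pairH1 M₀ M₁ - n := by
  obtain ⟨α, g, q, hα, hg, hq, hqs⟩ := step_exact (M₀ := M₀) h hsurj hf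
  have e1 := α.finrank_range_add_finrank_ker
  have e2 := g.finrank_range_add_finrank_ker
  have e3 := q.finrank_range_add_finrank_ker
  rw [LinearMap.range_eq_top.2 hqs, finrank_top] at e3
  rw [Module.finrank_fin_fun] at e2
  let i : LinearMap.ker α ≃ₗ[k] ↥(M₀ ⊓ M₁') :=
    { toFun w := ⟨w.1.1, w.1.2.1, (hα _).1 w.2⟩
      invFun w := ⟨⟨w.1, w.2.1, h w.2.2⟩, (hα _).2 w.2.2⟩
      map_add' _ _ := rfl
      map_smul' _ _ := rfl
      left_inv _ := rfl
      right_inv _ := rfl }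
  have e4 := i.finrank_eq
  rw [hg] at e2
  rw [hq] at e3
  simp only [pairH0, pairH1]
  omega

end Step

theorem IsLattice.comap_step (h₁ : IsLattice T.symm n M₁) (A : W ≃ₗ[k] W) :
    ∃ f : ↥(M₁.comap A.toLinearMap) →ₗ[k] (Fin n → k),
      Function.Surjective f ∧ (∀ w, f w = 0 ↔ w.1 ∈ M₁.comap (T * A).toLinearMap) ∧
        M₁.comap (T * A).toLinearMap ≤ M₁.comap A.toLinearMap := by
  obtain ⟨f, hf, hf'⟩ := h₁.exists_fibre
  refine ⟨f ∘ₗ LinearMap.restrict A.toLinearMap fun w hw ↦ hw, fun v ↦ ?_, fun w ↦ hf' _,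
    fun w hw ↦ ?_⟩
  · obtain ⟨w, rfl⟩ := hf v
    exact ⟨⟨A.symm w.1, by simp⟩, congrArg f (Subtype.ext (A.apply_symm_apply _))⟩
  · have := h₁.map_mem _ hw
    change T.symm (T (A w)) ∈ M₁ at this
    rwa [LinearEquiv.symm_apply_apply] at this

theorem finite_inf (h₀ : IsLattice T n M₀) (h₁ : IsLattice T.symm m M₁) :
    Module.Finite k ↥(M₀ ⊓ M₁) := by
  obtain ⟨B, hB⟩ := exists_pow_inf_eq_bot h₀ h₁
  have hfin : Module.Finite k ↥(M₀ ⊓ M₁.comap (T ^ B).toLinearMap) := by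
    have : M₀ ⊓ M₁.comap (T ^ B).toLinearMap = ⊥ :=
      (Submodule.eq_bot_iff _).2 fun w hw ↦ hB w hw.1 hw.2
    rw [this]
    infer_instance
  clear hB
  induction B with
  | zero => exact hfin
  | succ B ih =>
    obtain ⟨f, -, hf, -⟩ := h₁.comap_step (T ^ B)
    rw [pow_succ'] at hfin
    exact ih (finite_inf_of_step hf)

theorem finite_quotient (h₀ : IsLattice T n M₀) (h₁ : IsLattice T.symm m M₁) :
    Module.Finite k (W ⧸ (M₀ ⊔ M₁)) := by
  obtain ⟨B, hB⟩ := exists_pow_sup_eq_top h₀ h₁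
  have hfin : Module.Finite k (W ⧸ (M₀ ⊔ M₁.comap (T.symm ^ B).toLinearMap)) := by
    rw [hB]
    infer_instance
  clear hB
  induction B with
  | zero => exact hfin
  | succ B ih =>
    obtain ⟨f, hs, hf, hle⟩ := h₁.comap_step (T.symm ^ (B + 1))
    rw [show T * T.symm ^ (B + 1) = T.symm ^ B by
      rw [pow_succ', ← mul_assoc, show T.symm = T⁻¹ from rfl, mul_inv_cancel, one_mul]] at hf hle
    exact ih (finite_quotient_of_step hle hs hf)

/-- Twisting by a point lowers the Euler characteristic by the rank. -/
theorem pair_twist (h₀ : IsLattice T n M₀) (h₁ : IsLattice T.symm m M₁) :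
    (pairH0 M₀ (M₁.comap T.toLinearMap) : ℤ) - pairH1 M₀ (M₁.comap T.toLinearMap) =
      pairH0 M₀ M₁ - pairH1 M₀ M₁ - m := by
  obtain ⟨f, hs, hf, hle⟩ := h₁.comap_step 1
  rw [mul_one] at hf hle
  have := finite_inf h₀ h₁
  have : Module.Finite k (W ⧸ (M₀ ⊔ M₁)) := finite_quotient h₀ h₁
  have : Module.Finite k (W ⧸ (M₀ ⊔ M₁.comap T.toLinearMap)) :=
    finite_quotient_of_step (M₁ := M₁) (M₁' := M₁.comap T.toLinearMap) (f := f) hle hs hf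
  exact pair_step (M₁ := M₁) (f := f) hle hs hf

/-- If the sections in `M₀ ∩ M₁` span `M₁` modulo `t⁻¹`, then they generate `M₀` over `k[t]`. -/
theorem le_of_inf_le (h₁ : IsLattice T.symm n M₁)
    (h : ∀ w ∈ M₁, ∃ s ∈ M₀ ⊓ M₁, T (w - s) ∈ M₁) (hT : ∀ w ∈ M₀, T w ∈ M₀)
    (P : Submodule k W) (hP : M₀ ⊓ M₁ ≤ P) (hPT : ∀ w ∈ P, T w ∈ P) : M₀ ≤ P := by
  intro w hw
  obtain ⟨j, hj⟩ := h₁.exists_pow_mem w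
  induction j generalizing w with
  | zero => exact hP ⟨hw, hj⟩
  | succ j ih =>
    obtain ⟨s, hs, hs'⟩ := h _ hj
    have h1 : (T ^ (j + 1)) s ∈ P := pow_mem_of_map_mem hPT _ _ (hP hs)
    have h2 : (T ^ (j + 1)) s ∈ M₀ := pow_mem_of_map_mem hT _ _ hs.1
    have h3 := ih (w := w - (T ^ (j + 1)) s) (sub_mem hw h2) (by
      convert! hs' using 1
      rw [map_sub, map_sub, pow_succ' T j, pow_succ' T.symm j]
      simp only [LinearEquiv.mul_apply, LinearEquiv.apply_symm_apply]
      congr 1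
      have := pow_symm_pow (T := T) (j := j) (T s)
      rw [← LinearEquiv.mul_apply (T ^ j), ← pow_succ, pow_succ'] at this
      exact this)
    simpa using add_mem h3 h1

theorem sup_eq_top_of_inf_le (h₁ : IsLattice T.symm n M₁)
    (h : ∀ w ∈ M₁, ∃ s ∈ M₀ ⊓ M₁, T (w - s) ∈ M₁) (hT : ∀ w ∈ M₀, T w ∈ M₀) :
    M₀ ⊔ M₁.comap T.toLinearMap = ⊤ := by
  have key (w : W) (hw : w ∈ M₁) : w ∈ M₀ ⊔ M₁.comap T.toLinearMap := by
    obtain ⟨s, hs, hs'⟩ := h w hw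
    simpa using Submodule.add_mem_sup hs.1 (show w - s ∈ M₁.comap T.toLinearMap from hs')
  rw [eq_top_iff]
  rintro w -
  refine h₁.induction (p := fun w ↦ w ∈ M₀ ⊔ M₁.comap T.toLinearMap) key (fun w hw ↦ ?_) w
  obtain ⟨p, hp, q, hq, hpq⟩ := Submodule.mem_sup.1 hw
  have h1 : w = T p + T q := by rw [← map_add, hpq, LinearEquiv.apply_symm_apply]
  rw [h1]
  exact add_mem (Submodule.mem_sup_left (hT p hp)) (key _ hq)

/-- If the twist of the pair `(M₀, M₁)` has no `H¹`, then the elements of `H⁰ = M₀ ⊓ M₁` generate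
`M₀`. -/
theorem le_of_twist_eq_top (h₀ : IsLattice T n M₀) (h₁ : IsLattice T.symm n M₁)
    (hsup : M₀ ⊔ M₁.comap T.toLinearMap = ⊤) (P : Submodule k W) (hP : M₀ ⊓ M₁ ≤ P) (hPT : ∀ w ∈ P, T w ∈ P) :
    M₀ ≤ P := by
  refine le_of_inf_le h₁ (fun w hw ↦ ?_) h₀.map_mem P hP hPT
  obtain ⟨p, hp, q, hq, hpq⟩ := Submodule.mem_sup.1
    (show w ∈ M₀ ⊔ M₁.comap T.toLinearMap from hsup.ge trivial)
  subst hpq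
  have hq' : T q ∈ M₁ := hq
  refine ⟨p, ⟨hp, ?_⟩, by rwa [add_sub_cancel_left]⟩
  have h2 := h₁.map_mem _ hq'
  rw [LinearEquiv.symm_apply_apply] at h2
  simpa using sub_mem hw h2

theorem le_of_twist_eq_top' (h₀ : IsLattice T n M₀) (h₁ : IsLattice T.symm n M₁)
    (hsup : M₀ ⊔ M₁.comap T.toLinearMap = ⊤) (P : Submodule k W) (hP : M₀ ⊓ M₁ ≤ P)
    (hPT : ∀ w ∈ P, T.symm w ∈ P) : M₁ ≤ P := by
  refine le_of_inf_le (T := T.symm) h₀ (fun w hw ↦ ?_) h₁.map_mem P (by rwa [inf_comm]) hPT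
  obtain ⟨p, hp, q, hq, hpq⟩ := Submodule.mem_sup.1
    (hsup.ge (trivial : T.symm w ∈ (⊤ : Submodule k W)))
  have hq' : T q ∈ M₁ := hq
  have h1 : w = T p + T q := by rw [← map_add, hpq, LinearEquiv.apply_symm_apply]
  refine ⟨T q, ⟨hq', ?_⟩, ?_⟩
  · rw [← sub_eq_iff_eq_add'.2 h1]
    exact sub_mem hw (h₀.map_mem _ hp)
  · rw [h1, add_sub_cancel_right, LinearEquiv.symm_apply_apply]
    exact hp

theorem finrank_inf_of_twist_eq_top (h₀ : IsLattice T n M₀) (h₁ : IsLattice T.symm n M₁)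
    (hinf : M₀ ⊓ M₁.comap T.toLinearMap = ⊥) (hsup : M₀ ⊔ M₁.comap T.toLinearMap = ⊤) :
    Module.finrank k ↥(M₀ ⊓ M₁) = n := by
  have h1 := pair_twist h₀ h₁
  have hle : M₁.comap T.toLinearMap ≤ M₁ := fun w hw ↦ by
    have := h₁.map_mem _ hw
    change T.symm (T w) ∈ M₁ at this
    rwa [LinearEquiv.symm_apply_apply] at this
  have h2 : M₀ ⊔ M₁ = ⊤ := top_le_iff.1 (hsup.ge.trans (sup_le_sup_left hle _))
  rw [pairH0_eq_zero_of_inf hinf, pairH1_eq_zero_of_sup hsup, pairH1_eq_zero_of_sup h2] at h1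
  rw [pairH0] at h1
  omega

theorem inf_eq_bot_of_pairH0 (h₀ : IsLattice T n M₀) (h₁ : IsLattice T.symm m M₁)
    (h : pairH0 M₀ M₁ = 0) : M₀ ⊓ M₁ = ⊥ :=
  have := finite_inf h₀ h₁
  Submodule.finrank_eq_zero.1 h

theorem sup_eq_top_of_pairH1 (h₀ : IsLattice T n M₀) (h₁ : IsLattice T.symm m M₁)
    (h : pairH1 M₀ M₁ = 0) : M₀ ⊔ M₁ = ⊤ :=
  have := finite_quotient h₀ h₁
  Submodule.Quotient.subsingleton_iff.1 (Module.finrank_zero_iff.1 h)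

/-- A section `s` of a line bundle on the projective line that does not vanish at `t⁻¹ = 0` spans
`M₁` together with `t⁻¹ M₁`. -/
theorem twist_eq_top_of_rank_one (h₀ : IsLattice T 1 M₀) (h₁ : IsLattice T.symm 1 M₁) {s : W}
    (hs : s ∈ M₀ ⊓ M₁) (hTs : T s ∉ M₁) : M₀ ⊔ M₁.comap T.toLinearMap = ⊤ := by
  obtain ⟨f, hf, hf'⟩ := h₁.exists_fibre
  have hfs : f ⟨s, hs.2⟩ 0 ≠ 0 := fun h ↦ hTs ((hf' ⟨s, hs.2⟩).1
    (funext fun i ↦ by rw [Fin.fin_one_eq_zero i]; exact h))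
  refine sup_eq_top_of_inf_le h₁ (fun w hw ↦ ?_) h₀.map_mem
  refine ⟨(f ⟨w, hw⟩ 0 / f ⟨s, hs.2⟩ 0) • s, Submodule.smul_mem _ _ hs, ?_⟩
  refine (hf' (⟨w, hw⟩ - (f ⟨w, hw⟩ 0 / f ⟨s, hs.2⟩ 0) • ⟨s, hs.2⟩)).1 ?_
  ext i
  rw [Fin.fin_one_eq_zero i, map_sub, map_smul]
  simp [hfs]

/-- A line bundle on the projective line with a nonzero section has no first cohomology: divide
the section by the largest possible power of `t⁻¹`. -/
theorem sup_eq_top_of_rank_one (h₀ : IsLattice T 1 M₀) (h₁ : IsLattice T.symm 1 M₁)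
    (hne : M₀ ⊓ M₁ ≠ ⊥) : M₀ ⊔ M₁ = ⊤ := by
  obtain ⟨v, hv, hv0⟩ := Submodule.exists_mem_ne_zero_of_ne_bot hne
  obtain ⟨s, hs, hTs⟩ : ∃ s ∈ M₀ ⊓ M₁, T s ∉ M₁ := by
    obtain ⟨B, hB⟩ := exists_pow_inf_eq_bot h₀ h₁
    by_contra! h
    have (j : ℕ) : (T ^ j) v ∈ M₀ ⊓ M₁ := pow_mem_of_map_mem
      (M := M₀ ⊓ M₁) (fun w hw ↦ ⟨h₀.map_mem w hw.1, h w hw⟩) j v hv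
    exact hv0 (hB v hv.1 (this B).2)
  refine top_le_iff.1 ((twist_eq_top_of_rank_one h₀ h₁ hs hTs).ge.trans
    (sup_le_sup_left (fun w hw ↦ ?_) _))
  have := h₁.map_mem _ hw
  change T.symm (T w) ∈ M₁ at this
  rwa [LinearEquiv.symm_apply_apply] at this

/-- A line bundle on the projective line with Euler characteristic zero has no cohomology. -/
theorem inf_eq_bot_of_rank_one (h₀ : IsLattice T 1 M₀) (h₁ : IsLattice T.symm 1 M₁)
    (hχ : pairH0 M₀ M₁ = pairH1 M₀ M₁) : M₀ ⊓ M₁ = ⊥ := by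
  by_contra hne
  exact hne (inf_eq_bot_of_pairH0 h₀ h₁
    (hχ.trans (pairH1_eq_zero_of_sup (sup_eq_top_of_rank_one h₀ h₁ hne))))

/-- A section that vanishes to no order at `t⁻¹ = 0` vanishes at no other point. -/
theorem eq_zero_of_eq_sub (h₁ : IsLattice T.symm n M₁)
    (hinf : M₀ ⊓ M₁.comap T.toLinearMap = ⊥) {s w : W} (hs : s ∈ M₁) (hw : w ∈ M₀) (a : k)
    (h : s = T w - a • w) : s = 0 := by
  have hw1 : T w ∈ M₁ := by
    obtain ⟨j, hj⟩ := h₁.exists_pow_mem w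
    have hj' : (T.symm ^ (j + 1)) (T w) ∈ M₁ := by
      rw [pow_succ, LinearEquiv.mul_apply, LinearEquiv.symm_apply_apply]
      exact hj
    clear hj
    have hT : T w = s + a • T.symm (T w) := by
      rw [h, LinearEquiv.symm_apply_apply, sub_add_cancel]
    generalize T w = v at hj' hT
    generalize j + 1 = l at hj'
    induction l with
    | zero => exact hj'
    | succ l ih =>
      refine ih ?_
      rw [hT, map_add, map_smul, ← LinearEquiv.mul_apply, ← pow_succ]
      exact add_mem (pow_mem_of_map_mem h₁.map_mem _ _ hs) (Submodule.smul_mem _ _ hj')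
  have : w ∈ M₀ ⊓ M₁.comap T.toLinearMap := ⟨hw, hw1⟩
  rw [hinf] at this
  rw [h, (Submodule.mem_bot k).1 this, map_zero, smul_zero, sub_zero]

end Lattices
/-! ### The lattice pair of a vector bundle on the projective line -/

section BundleLattices

variable {k : Type u} [Field k] {M N : (P1 k).Modules} {n : ℕ} {V : (P1 k).Opens} {i j : Fin 2}

theorem scalars_smul {U : (P1 k).Opens} (c : k) (s : Γ(M, U)) : scalars k U c • s = c • s := rfl

instance (U : (P1 k).Opens) : Algebra k Γ(P1 k, U) := (scalars k U).toAlgebra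

instance (U : (P1 k).Opens) : IsScalarTower k Γ(P1 k, U) Γ(M, U) :=
  ⟨fun c f s ↦ mul_smul (scalars k U c) f s⟩

/-- A function that is both a polynomial in `t` and `t⁻¹` times a polynomial in `t⁻¹` vanishes. -/
theorem eq_zero_of_ores_eq (hij : i ≠ j) (hi : V ≤ chart k i) (hj : V ≤ chart k j) (hV : V ≠ ⊥)
    {p : Γ(P1 k, chart k i)} {c : Γ(P1 k, chart k j)}
    (h : ores hi p = ores hj (coordinate k j i * c)) : p = 0 := by
  obtain ⟨P, rfl⟩ := (chartEval_bijective hij).surjective p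
  obtain ⟨Q, rfl⟩ := (chartEval_bijective hij.symm).surjective c
  set x := ores hi (coordinate k i j)
  set y := ores hj (coordinate k j i)
  have hxy : x * y = 1 := coordinate_mul_coordinate i j hi hj
  have hx (R : Polynomial k) : ores hi (chartEval i j R) = R.eval₂ (scalars k V) x :=
    Polynomial.hom_eval₂ _ _ _ _
  have hy (R : Polynomial k) : ores hj (chartEval j i R) = R.eval₂ (scalars k V) y :=
    Polynomial.hom_eval₂ _ _ _ _
  let _ : Invertible y := ⟨x, hxy, by rw [mul_comm, hxy]⟩
  have hr := Polynomial.eval₂_reflect_mul_pow (scalars k V) y Q.natDegree Q le_rfl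
  rw [show ⅟y = x from rfl] at hr
  have key : Polynomial.X ^ (Q.natDegree + 1) * P = Q.reflect Q.natDegree := by
    refine (chartEval_bijective hij).injective (ores_injective hi hV ?_)
    rw [hx, hx, Polynomial.eval₂_mul, Polynomial.eval₂_pow, Polynomial.eval₂_X, ← hx P, h, map_mul,
      hy, ← hr]
    change _ * (y * (_ * y ^ _)) = _
    rw [mul_left_comm y, mul_left_comm, ← pow_succ', ← mul_pow, hxy, one_pow, mul_one]
  have : P = 0 := by
    ext d
    have h1 := congr(($key).coeff (d + (Q.natDegree + 1)))
    rw [Polynomial.coeff_X_pow_mul, Polynomial.coeff_reflect,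
      Polynomial.revAt_eq_self_of_lt (by omega),
      Q.coeff_eq_zero_of_natDegree_lt (by omega)] at h1
    rw [h1, Polynomial.coeff_zero]
  rw [this, map_zero]

theorem smul_pow_apply {W : Type*} [AddCommGroup W] [Module k W] {A : Type*} [Semiring A]
    [Module A W] {T : W ≃ₗ[k] W} {t : A} (hT : ∀ w, T w = t • w) (m : ℕ) (w : W) :
    (T ^ m) w = t ^ m • w := by
  induction m with
  | zero => rw [pow_zero, pow_zero, one_smul]; rfl
  | succ m ih => rw [pow_succ', pow_succ', mul_smul, ← ih, ← hT]; rfl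

theorem restrictSections_apply {U : (P1 k).Opens} (h : V ≤ U) (s : Γ(M, U)) :
    restrictSections M h s = mres M h s := rfl

/-- A frame over a chart identifies the fibre at the origin of the chart with `kⁿ`. -/
theorem exists_fibre_map (hij : i ≠ j) {e : Fin n → Γ(M, chart k i)}
    (he : IsFrame M (chart k i) e) : ∃ g : Γ(M, chart k i) →ₗ[k] (Fin n → k),
      Function.Surjective g ∧ ∀ s, g s = 0 ↔ ∃ s', s = coordinate k i j • s' := by
  let E : Polynomial k ≃+* Γ(P1 k, chart k i) := .ofBijective _ (chartEval_bijective hij)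
  have hE (p : Polynomial k) : E p = chartEval i j p := rfl
  let g : Γ(M, chart k i) →ₗ[k] (Fin n → k) :=
    { toFun s a := (E.symm (he.basis.repr s a)).coeff 0
      map_add' s t := by ext a; simp
      map_smul' c s := by
        ext a
        rw [← scalars_smul, map_smul, Finsupp.smul_apply, smul_eq_mul, map_mul,
          ← chartEval_C i j, ← hE, E.symm_apply_apply, Polynomial.coeff_C_mul]
        rfl }
  refine ⟨g, fun v ↦ ⟨∑ a, scalars k (chart k i) (v a) • e a, ?_⟩, fun s ↦ ⟨fun h ↦ ?_, ?_⟩⟩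
  · ext a
    change (E.symm (he.basis.repr _ a)).coeff 0 = _
    simp_rw [← he.basis_apply]
    rw [he.basis.repr_sum_self, ← chartEval_C i j, ← hE, E.symm_apply_apply, Polynomial.coeff_C_zero]
  · have h1 (a : Fin n) : ∃ q, he.basis.repr s a = coordinate k i j * q := by
      have h2 : (E.symm (he.basis.repr s a)).coeff 0 = 0 := congr($h a)
      obtain ⟨q, hq⟩ := Polynomial.X_dvd_iff.2 h2
      refine ⟨E q, ?_⟩
      rw [← chartEval_X, ← hE, ← map_mul, ← hq, E.apply_symm_apply]
    choose q hq using h1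
    refine ⟨∑ a, q a • e a, ?_⟩
    rw [← he.basis.sum_repr s, Finset.smul_sum]
    simp_rw [hq, mul_smul, he.basis_apply]
  · rintro ⟨s', rfl⟩
    ext a
    change (E.symm (he.basis.repr _ a)).coeff 0 = 0
    rw [map_smul, Finsupp.smul_apply, smul_eq_mul, map_mul, ← chartEval_X, ← hE,
      E.symm_apply_apply, Polynomial.coeff_X_mul_zero]

/-- The sections over a chart of a vector bundle are a lattice in the sections over the overlap
of the two charts. -/
theorem isLattice_range_restrictSections (hM : IsLocallyFreeOfRank M n) (hij : i ≠ j)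
    (hi : V ≤ chart k i) (hj : V ≤ chart k j) (hV : V ≠ ⊥)
    (hVi : V = (P1 k).basicOpen (coordinate k i j)) (hVj : V = (P1 k).basicOpen (coordinate k j i))
    (T : Γ(M, V) ≃ₗ[k] Γ(M, V)) (hT : ∀ w, T w = ores hi (coordinate k i j) • w)
    (hT' : ∀ w, T.symm w = ores hj (coordinate k j i) • w) :
    IsLattice T n (LinearMap.range (restrictSections M hi)) := by
  obtain ⟨e, he⟩ := exists_isFrame_of_isPrincipalIdealRing hM (isAffineOpen_chart k i)
    (chart_ne_bot i)
  have hinj : Function.Injective (restrictSections M hi) := mres_injective hM hi hV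
  refine ⟨?_, fun w ↦ ?_, ?_, ?_, ?_⟩
  · rintro _ ⟨s, rfl⟩
    exact ⟨coordinate k i j • s, by rw [hT]; exact mres_smul _ _ _⟩
  · subst hVi
    obtain ⟨m, y, hy⟩ := exists_pow_smul_eq_mres hM (isAffineOpen_chart k i) _ hV w
    exact ⟨m, y, by rw [smul_pow_apply hT]; exact hy⟩
  · obtain ⟨g, hg, hg'⟩ := exists_fibre_map hij he
    let ρ := LinearEquiv.ofInjective (restrictSections M hi) hinj
    refine ⟨g ∘ₗ ρ.symm.toLinearMap, hg.comp ρ.symm.surjective, fun w ↦ ?_⟩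
    obtain ⟨s, rfl⟩ := ρ.surjective w
    rw [LinearMap.comp_apply, LinearEquiv.coe_coe, LinearEquiv.symm_apply_apply, hg']
    constructor
    · rintro ⟨s', rfl⟩
      refine ⟨s', ?_⟩
      rw [LinearEquiv.eq_symm_apply, hT]
      exact (mres_smul _ _ _).symm
    · rintro ⟨s', hs'⟩
      refine ⟨s', hinj ?_⟩
      rw [LinearEquiv.eq_symm_apply, hT] at hs'
      exact hs'.symm.trans (mres_smul _ _ _).symm
  · classical
    refine ⟨Finset.univ.image fun a ↦ mres M hi (e a), ?_, fun P hP hPT ↦ ?_⟩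
    · intro w hw
      obtain ⟨a, -, rfl⟩ := Finset.mem_image.1 (Finset.mem_coe.1 hw)
      exact ⟨e a, rfl⟩
    · rintro _ ⟨s, rfl⟩
      obtain ⟨c, rfl⟩ := he.exists_eq le_rfl s
      rw [map_sum]
      refine sum_mem fun a _ ↦ ?_
      obtain ⟨p, hp⟩ := (chartEval_bijective hij).surjective (c a)
      rw [← hp, restrictSections_apply, mres_smul, mres_self]
      have ha : mres M hi (e a) ∈ P := hP (by simp)
      generalize mres M hi (e a) = v at ha
      clear hp
      induction p using Polynomial.induction_on' with
      | add p q hp hq =>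
        rw [map_add, map_add, add_smul]
        exact add_mem hp hq
      | monomial m b =>
        rw [← Polynomial.C_mul_X_pow_eq_monomial, map_mul, map_mul, chartEval_C, ores_scalars,
          map_pow, map_pow, chartEval_X, mul_smul, ← smul_pow_apply hT]
        exact P.smul_mem b (pow_mem_of_map_mem hPT m v ha)
  · -- the combinations of the frame with coefficients in `t⁻¹ k[t⁻¹]`
    let N : Submodule k Γ(M, V) :=
      { carrier := {w | ∃ c : Fin n → Γ(P1 k, chart k j),
          w = ∑ a, ores hj (coordinate k j i * c a) • mres M hi (e a)}
        zero_mem' := ⟨0, by simp⟩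
        add_mem' := by
          rintro _ _ ⟨c, rfl⟩ ⟨d, rfl⟩
          exact ⟨c + d, by simp [mul_add, add_smul, Finset.sum_add_distrib]⟩
        smul_mem' := by
          rintro b _ ⟨c, rfl⟩
          refine ⟨fun a ↦ scalars k _ b * c a, ?_⟩
          rw [Finset.smul_sum]
          refine Finset.sum_congr rfl fun a _ ↦ ?_
          rw [mul_left_comm, map_mul (ores hj) (scalars k _ b), ores_scalars, mul_smul,
            scalars_smul] }
    refine ⟨N, ?_, ?_, fun w ↦ ?_⟩
    · rintro _ ⟨c, rfl⟩
      refine ⟨fun a ↦ coordinate k j i * c a, ?_⟩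
      rw [hT', Finset.smul_sum]
      refine Finset.sum_congr rfl fun a _ ↦ ?_
      rw [map_mul (ores hj) _ (_ * _), mul_smul]
    · rw [Submodule.eq_bot_iff]
      rintro w ⟨⟨s, rfl⟩, c, hc⟩
      obtain ⟨d, rfl⟩ := he.exists_eq le_rfl s
      rw [restrictSections_apply, map_sum] at hc
      simp_rw [mres_smul, mres_self] at hc
      have h1 := he.eq_of_sum_eq hi hc
      have h2 (a : Fin n) : d a = 0 := eq_zero_of_ores_eq hij hi hj hV (congrFun h1 a)
      simp [h2]
    · obtain ⟨d, rfl⟩ := he.exists_eq hi w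
      choose m hm using fun a ↦ exists_pow_mul_eq_ores (isAffineOpen_chart k j)
        (coordinate k j i) hVj hj (d a)
      choose y hy using fun a ↦ hm a (Finset.univ.sup m) (Finset.le_sup (Finset.mem_univ a))
      refine ⟨Finset.univ.sup m + 1, y, ?_⟩
      rw [smul_pow_apply hT', Finset.smul_sum]
      refine Finset.sum_congr rfl fun a _ ↦ ?_
      rw [map_mul, hy, pow_succ', smul_smul, mul_assoc]

variable (k) in
/-- The overlap of the two standard charts. -/
abbrev overlap : (P1 k).Opens := chart k 0 ⊓ chart k 1

variable (k) in
/-- The coordinate `t = X₁ / X₀` on the overlap. -/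
def tCoord : Γ(P1 k, overlap k) := ores inf_le_left (coordinate k 0 1)

variable (k) in
/-- The coordinate `t⁻¹ = X₀ / X₁` on the overlap. -/
def tInv : Γ(P1 k, overlap k) := ores inf_le_right (coordinate k 1 0)

theorem tCoord_mul_tInv : tCoord k * tInv k = 1 := coordinate_mul_coordinate 0 1 _ _

theorem tInv_mul_tCoord : tInv k * tCoord k = 1 := by rw [mul_comm, tCoord_mul_tInv]

/-- Multiplication by `t` on the sections over the overlap. -/
def mulT (M : (P1 k).Modules) : Γ(M, overlap k) ≃ₗ[k] Γ(M, overlap k) where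
  toFun w := tCoord k • w
  invFun w := tInv k • w
  map_add' _ _ := smul_add _ _ _
  map_smul' c w := by
    rw [RingHom.id_apply, ← scalars_smul, ← scalars_smul, smul_smul, smul_smul, mul_comm]
  left_inv w := (smul_smul _ _ _).trans (by rw [tInv_mul_tCoord, one_smul])
  right_inv w := (smul_smul _ _ _).trans (by rw [tCoord_mul_tInv, one_smul])

theorem mulT_apply (w : Γ(M, overlap k)) : mulT M w = tCoord k • w := rfl

theorem mulT_symm_apply (w : Γ(M, overlap k)) : (mulT M).symm w = tInv k • w := rfl

/-- The sections over the chart `X₀ ≠ 0`, as a subspace of the sections over the overlap. -/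
def lattice₀ (M : (P1 k).Modules) : Submodule k Γ(M, overlap k) :=
  LinearMap.range (restrictSections M inf_le_left)

/-- The sections over the chart `X₁ ≠ 0`, as a subspace of the sections over the overlap. -/
def lattice₁ (M : (P1 k).Modules) : Submodule k Γ(M, overlap k) :=
  LinearMap.range (restrictSections M inf_le_right)

theorem isLattice₀ (hM : IsLocallyFreeOfRank M n) : IsLattice (mulT M) n (lattice₀ M) :=
  isLattice_range_restrictSections hM zero_ne_one inf_le_left inf_le_right overlap_ne_bot
    (basicOpen_coordinate 0 1).symm ((inf_comm _ _).trans (basicOpen_coordinate 1 0).symm) _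
    mulT_apply mulT_symm_apply

theorem isLattice₁ (hM : IsLocallyFreeOfRank M n) : IsLattice (mulT M).symm n (lattice₁ M) :=
  isLattice_range_restrictSections hM one_ne_zero inf_le_right inf_le_left overlap_ne_bot
    ((inf_comm _ _).trans (basicOpen_coordinate 1 0).symm) (basicOpen_coordinate 0 1).symm _
    mulT_symm_apply mulT_apply

/-- The Euler characteristic of a vector bundle is that of its pair of lattices. -/
theorem eulerChar_eq (hM : IsLocallyFreeOfRank M n) : eulerChar M =
    (pairH0 (lattice₀ M) (lattice₁ M) : ℤ) - pairH1 (lattice₀ M) (lattice₁ M) := by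
  have h0 : Function.Injective (restrictSections M (inf_le_left : overlap k ≤ chart k 0)) :=
    mres_injective hM _ overlap_ne_bot
  have h1 : Function.Injective (restrictSections M (inf_le_right : overlap k ≤ chart k 1)) :=
    mres_injective hM _ overlap_ne_bot
  have hmem (w : Γ(M, chart k 0) × Γ(M, chart k 1)) :
      w ∈ LinearMap.ker (cechDifferential M) ↔
        restrictSections M (inf_le_left : overlap k ≤ chart k 0) w.1 =
        restrictSections M (inf_le_right : overlap k ≤ chart k 1) w.2 := by
    rw [LinearMap.mem_ker]
    exact sub_eq_zero
  let f : LinearMap.ker (cechDifferential M) →ₗ[k] ↥(lattice₀ M ⊓ lattice₁ M) :=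
    LinearMap.codRestrict _ (restrictSections M inf_le_left ∘ₗ LinearMap.fst k _ _ ∘ₗ
      (LinearMap.ker (cechDifferential M)).subtype)
      fun w ↦ ⟨⟨w.1.1, rfl⟩, w.1.2, ((hmem _).1 w.2).symm⟩
  have hf : Function.Bijective f := by
    constructor
    · intro a b hab
      have h2 : a.1.1 = b.1.1 := h0 congr(($hab).1)
      refine Subtype.ext (Prod.ext h2 (h1 ?_))
      rw [← (hmem _).1 a.2, ← (hmem _).1 b.2, h2]
    · rintro ⟨_, ⟨a, rfl⟩, b, hb⟩
      exact ⟨⟨(a, b), (hmem _).2 hb.symm⟩, rfl⟩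
  have hr : LinearMap.range (cechDifferential M) = lattice₀ M ⊔ lattice₁ M := by
    apply le_antisymm
    · rintro _ ⟨w, rfl⟩
      exact sub_mem (Submodule.mem_sup_left ⟨w.1, rfl⟩) (Submodule.mem_sup_right ⟨w.2, rfl⟩)
    · refine sup_le ?_ ?_
      · rintro _ ⟨s, rfl⟩
        refine ⟨(s, 0), ?_⟩
        change restrictSections M _ s - restrictSections M _ 0 = _
        rw [map_zero, sub_zero]
      · rintro _ ⟨s, rfl⟩
        refine ⟨(0, -s), ?_⟩
        change restrictSections M _ 0 - restrictSections M _ (-s) = _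
        rw [map_zero, map_neg, zero_sub, neg_neg]
  rw [eulerChar, pairH0, pairH1, (LinearEquiv.ofBijective f hf).finrank_eq, hr]

end BundleLattices
/-! ### Sections of parabolic bundles -/

namespace ParabolicBundle

section Integral

variable {X : Scheme.{u}} {x : X} {r : ℕ} (E F : ParabolicBundle X x r) {i j l : ℤ}

/-- The structure map `E_{j/r} ⟶ E_{i/r}` for `i ≤ j`. -/
def incl (h : i ≤ j) : E.bundle j ⟶ E.bundle i :=
  E.functor.map (homOfLE h).op

/-- The isomorphism `E_{i/r} ⊗ 𝒪(-x) ≅ E_{i/r + 1}`. -/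
def jIso (i : ℤ) : (twist x).obj (E.bundle i) ≅ E.bundle (i + r) :=
  E.j.app (.op i)

variable {E F} in
/-- The component at `i / r` of a natural transformation. -/
def comp (φ : E.functor ⟶ F.functor) (i : ℤ) : E.bundle i ⟶ F.bundle i :=
  φ.app (.op i)

theorem incl_comp_incl (h : i ≤ j) (h' : j ≤ l) : E.incl h' ≫ E.incl h = E.incl (h.trans h') :=
  (E.functor.map_comp (homOfLE h').op (homOfLE h).op).symm

theorem incl_self (h : i ≤ i) : E.incl h = 𝟙 _ :=
  E.functor.map_id _

variable {E F} in
theorem incl_comp (φ : E.functor ⟶ F.functor) (h : i ≤ j) :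
    E.incl h ≫ comp φ i = comp φ j ≫ F.incl h :=
  φ.naturality (homOfLE h).op

theorem jIso_hom_incl (i : ℤ) : (E.jIso i).hom ≫ E.incl (show i ≤ i + (r : ℤ) by simp) =
    (twistInclusion x).app (E.bundle i) :=
  E.triangle i

theorem incl_period_eq (i : ℤ) : E.incl (show i ≤ i + (r : ℤ) by simp) =
    (E.jIso i).inv ≫ (twistInclusion x).app (E.bundle i) :=
  (Iso.eq_inv_comp _).2 (E.jIso_hom_incl i)

theorem incl_incl_apply (h : i ≤ j) (h' : j ≤ l) {V : X.Opens} (w : Γ(E.bundle l, V)) :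
    mapp (E.incl h) V (mapp (E.incl h') V w) = mapp (E.incl (h.trans h')) V w := by
  rw [← incl_comp_incl E h h', mapp_comp]

variable [IsIntegral X]

theorem isLocallyFree (i : ℤ) : IsLocallyFreeOfRank (E.bundle i) (ParabolicP1.rank (E.bundle i)) :=
  (E.isVectorBundle i).isLocallyFreeOfRank

theorem incl_period_injective (h : i ≤ j) (hj : j = i + r) (V : X.Opens) :
    Function.Injective (mapp (E.incl h) V) := by
  subst hj
  rw [incl_period_eq]
  exact (twistInclusion_injective (E.isLocallyFree i) x V).comp
    (mapp_bijective_of_isIso (E.jIso i).inv V).1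

theorem mem_range_incl_period_iff {U V : X.Opens} {ℓ : Γ(X, U)} (hℓ : IsLocalEquation x U ℓ)
    (hV : V ≤ U) (h : i ≤ j) (hj : j = i + r) (s : Γ(E.bundle i, V)) :
    s ∈ LinearMap.range (mapp (E.incl h) V) ↔ ∃ w, s = ores hV ℓ • w := by
  subst hj
  rw [← mem_range_twistInclusion_iff_exists_smul (E.isLocallyFree i) hℓ hV, incl_period_eq]
  constructor
  · rintro ⟨w, rfl⟩
    exact ⟨mapp (E.jIso i).inv V w, rfl⟩
  · rintro ⟨w, rfl⟩
    obtain ⟨v, rfl⟩ := (mapp_bijective_of_isIso (E.jIso i).inv V).2 w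
    exact ⟨v, rfl⟩

theorem incl_injective (hr : 0 < r) (h : i ≤ j) (V : X.Opens) :
    Function.Injective (mapp (E.incl h) V) := by
  have key (N : ℕ) : ∀ (i j : ℤ) (h : i ≤ j), j = i + r * N →
      Function.Injective (mapp (E.incl h) V) := by
    induction N with
    | zero =>
      rintro i j h hj
      obtain rfl : j = i := by simpa using hj
      rw [incl_self]
      exact (mapp_bijective_of_isIso _ V).1
    | succ N ih =>
      intro i j h hj
      have h1 : i ≤ i + r * N := le_add_of_nonneg_right (by positivity)
      have h2 : i + r * N ≤ j := by rw [hj]; push_cast; nlinarith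
      rw [← incl_comp_incl E h1 h2]
      intro a b hab
      rw [mapp_comp, mapp_comp] at hab
      exact E.incl_period_injective h2 (by rw [hj]; push_cast; ring) V (ih _ _ h1 rfl hab)
  obtain ⟨N, hN⟩ : ∃ N : ℕ, j - i ≤ r * N := ⟨(j - i).toNat, by
    have : (1 : ℤ) ≤ r := by exact_mod_cast hr
    have h3 : ((j - i).toNat : ℤ) = j - i := Int.toNat_of_nonneg (by omega)
    rw [h3]
    nlinarith⟩
  have h1 : j - r * N ≤ i := by omega
  have := key N (j - r * N) j (h1.trans h) (by ring)
  intro a b hab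
  refine this ?_
  rw [← incl_incl_apply E h1 h, hab, incl_incl_apply]

/-- Sections of `E_{i/r + N}` are `ℓ ^ N` times sections of `E_{i/r}`. -/
theorem exists_equiv_nat {U V : X.Opens} {ℓ : Γ(X, U)} (hℓ : IsLocalEquation x U ℓ)
    (hV : V ≤ U) (hne : V ≠ ⊥) (N : ℕ) : ∀ (i j : ℤ) (h : i ≤ j), j = i + r * N →
      ∃ κ : Γ(E.bundle j, V) ≃ₗ[Γ(X, V)] Γ(E.bundle i, V),
        ∀ w, mapp (E.incl h) V w = ores hV ℓ ^ N • κ w := by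
  induction N with
  | zero =>
    rintro i j h hj
    obtain rfl : j = i := by simpa using hj
    exact ⟨.refl _ _, fun w ↦ by rw [incl_self, mapp_id, pow_zero, one_smul]; rfl⟩
  | succ N ih =>
    intro i j h hj
    have h1 : i ≤ i + r * N := le_add_of_nonneg_right (by positivity)
    have h2 : i + r * N ≤ j := by rw [hj]; push_cast; nlinarith
    obtain ⟨κ, hκ⟩ := ih _ _ h1 rfl
    have hj' : j = i + r * N + r := by rw [hj]; push_cast; ring
    have hℓ0 : ores hV ℓ ≠ 0 := fun h0 ↦ hℓ.ne_zero (ores_injective hV hne (h0.trans (map_zero _).symm))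
    let μ : Γ(E.bundle (i + r * N), V) →ₗ[Γ(X, V)] Γ(E.bundle (i + r * N), V) :=
      LinearMap.lsmul _ _ (ores hV ℓ)
    have hμ : Function.Injective μ := smul_injective (E.isLocallyFree _) hne hℓ0
    have hrange : LinearMap.range (mapp (E.incl h2) V) = LinearMap.range μ := by
      ext s
      rw [E.mem_range_incl_period_iff hℓ hV h2 hj']
      exact ⟨fun ⟨w, hw⟩ ↦ ⟨w, hw.symm⟩, fun ⟨w, hw⟩ ↦ ⟨w, hw.symm⟩⟩
    let κ' : Γ(E.bundle j, V) ≃ₗ[Γ(X, V)] Γ(E.bundle (i + r * N), V) :=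
      (LinearEquiv.ofInjective _ (E.incl_period_injective h2 hj' V)).trans
        ((LinearEquiv.ofEq _ _ hrange).trans (LinearEquiv.ofInjective μ hμ).symm)
    have hκ' (w) : mapp (E.incl h2) V w = ores hV ℓ • κ' w := by
      have : (LinearEquiv.ofInjective μ hμ (κ' w)).1 = mapp (E.incl h2) V w := by
        simp [κ']
      exact this.symm
    refine ⟨κ'.trans κ, fun w ↦ ?_⟩
    rw [← incl_incl_apply E h1 h2, hκ', map_smul, hκ, smul_smul, pow_succ']
    rfl

/-- Sections of `E_{i/r + b}` are `ℓ ^ b` times sections of `E_{i/r}`, for any integer `b`.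
The comparison takes place in `E_{l/r}` with `l` small, after clearing denominators. -/
theorem exists_equiv {U V : X.Opens} {ℓ : Γ(X, U)} (hℓ : IsLocalEquation x U ℓ)
    (hV : V ≤ U) (hne : V ≠ ⊥) (b : ℤ) (hj : j = i + r * b) :
    ∃ κ : Γ(E.bundle j, V) ≃ₗ[Γ(X, V)] Γ(E.bundle i, V),
      ∀ (w) (l : ℤ) (hi : l ≤ i) (hj : l ≤ j) (p q : ℕ), (q : ℤ) = p + b →
        ores hV ℓ ^ q • mapp (E.incl hi) V (κ w) = ores hV ℓ ^ p • mapp (E.incl hj) V w := by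
  obtain ⟨N, rfl | rfl⟩ := Int.eq_nat_or_neg b
  · have h : i ≤ j := hj ▸ le_add_of_nonneg_right (by positivity)
    obtain ⟨κ, hκ⟩ := E.exists_equiv_nat hℓ hV hne N i j h hj
    refine ⟨κ, fun w l hi hj p q hq ↦ ?_⟩
    obtain rfl : q = p + N := by omega
    rw [← incl_incl_apply E hi h, hκ, map_smul, smul_smul, ← pow_add]
  · have hj' : i = j + r * N := by rw [hj]; ring
    have h : j ≤ i := hj' ▸ le_add_of_nonneg_right (by positivity)
    obtain ⟨κ, hκ⟩ := E.exists_equiv_nat hℓ hV hne N j i h hj'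
    refine ⟨κ.symm, fun w l hi hj p q hq ↦ ?_⟩
    obtain rfl : p = q + N := by omega
    rw [← incl_incl_apply E hj h, hκ, LinearEquiv.apply_symm_apply, map_smul, smul_smul, ← pow_add]

/-- Compatibility with `j` is automatic for natural transformations. -/
theorem comm_of_natTrans {E F : ParabolicBundle X x r} (φ : E.functor ⟶ F.functor) :
    Functor.whiskerRight φ (twist x) ≫ F.j.hom = E.j.hom ≫ Functor.whiskerLeft (shiftFunctor r) φ := by
  ext ⟨i⟩ : 2
  have : Mono (F.incl (show i ≤ i + (r : ℤ) by simp)) :=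
    mono_of_mapp_injective _ fun V ↦ F.incl_period_injective _ rfl V
  have h4 : (twist x).map (comp φ i) ≫ (twistInclusion x).app (F.bundle i) =
    (twistInclusion x).app (E.bundle i) ≫ comp φ i := (twistInclusion x).naturality _
  have key : (twist x).map (comp φ i) ≫ (F.jIso i).hom = (E.jIso i).hom ≫ comp φ (i + r) := by
    rw [← cancel_mono (F.incl (show i ≤ i + (r : ℤ) by simp)), Category.assoc, jIso_hom_incl, h4,
      Category.assoc, ← incl_comp, ← jIso_hom_incl, Category.assoc]
  exact key

/-- A natural transformation as a morphism of parabolic bundles. -/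
def homOfNatTrans {E F : ParabolicBundle X x r} (φ : E.functor ⟶ F.functor) : E ⟶ F :=
  (⟨φ, comm_of_natTrans φ⟩ : Hom E F)

end Integral

end ParabolicBundle
/-! ### Euler characteristics and global sections of parabolic bundles on the projective line -/

section Basics

variable {k : Type u} [Field k] {M N : (P1 k).Modules} {m n : ℕ}

/-- The two local equations of a closed point `x` obtained by dehomogenizing a linear form. -/
structure LinearEquation (x : P1 k) where
  /-- the local equation on the chart `X_c ≠ 0` -/
  eqn : ∀ c : Fin 2, Γ(P1 k, chart k c)
  isLocal : ∀ c, IsLocalEquation x (chart k c) (eqn c)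
  compat : ores (V := overlap k) inf_le_left (eqn 0) =
    tCoord k * ores (V := overlap k) inf_le_right (eqn 1)

theorem nonempty_linearEquation [IsAlgClosed k] {x : P1 k} (hx : IsClosed {x}) :
    Nonempty (LinearEquation x) := by
  obtain ⟨ℓ₀, ℓ₁, h₀, h₁, h⟩ := exists_isLocalEquation hx
  exact ⟨⟨Fin.cons ℓ₀ (Fin.cons ℓ₁ fun i ↦ i.elim0), Fin.cases h₀ (Fin.cases h₁ fun i ↦ i.elim0), h⟩⟩

theorem tCoord_smul_injective (M : (P1 k).Modules) :
    Function.Injective fun w : Γ(M, overlap k) ↦ tCoord k • w :=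
  (mulT M).injective

theorem ores_eqn_ne_zero {x : P1 k} (ℓ : LinearEquation x) {c : Fin 2} {V : (P1 k).Opens}
    (h : V ≤ chart k c) (hV : V ≠ ⊥) : ores h (ℓ.eqn c) ≠ 0 := fun h0 ↦
  (ℓ.isLocal c).ne_zero (ores_injective h hV (h0.trans (map_zero _).symm))

theorem finrank_sections_chart (hM : IsLocallyFreeOfRank M n) :
    Module.finrank Γ(P1 k, chart k 0) Γ(M, chart k 0) = n := by
  have := isDomain_sections (chart_ne_bot (k := k) 0)
  obtain ⟨e, he⟩ := exists_isFrame_of_isPrincipalIdealRing hM (isAffineOpen_chart k 0)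
    (chart_ne_bot 0)
  rw [Module.finrank_eq_card_basis he.basis, Fintype.card_fin]

theorem rank_le_of_injective (hM : IsLocallyFreeOfRank M m) (hN : IsLocallyFreeOfRank N n)
    (φ : M ⟶ N) (h : Function.Injective (mapp φ (chart k 0))) : m ≤ n := by
  have := isDomain_sections (chart_ne_bot (k := k) 0)
  have := finite_sections hN (isAffineOpen_chart k 0)
  rw [← finrank_sections_chart hM, ← finrank_sections_chart hN]
  exact LinearMap.finrank_le_finrank_of_injective h

/-- The space `H⁰` of global sections, as a subspace of the sections over the overlap. -/
def globalSections (M : (P1 k).Modules) : Submodule k Γ(M, overlap k) :=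
  lattice₀ M ⊓ lattice₁ M

theorem mapp_mem_lattice₀ (φ : M ⟶ N) {w : Γ(M, overlap k)} (hw : w ∈ lattice₀ M) :
    mapp φ _ w ∈ lattice₀ N := by
  obtain ⟨s, rfl⟩ := hw
  exact ⟨mapp φ _ s, (mapp_mres φ _ s).symm⟩

theorem mapp_mem_lattice₁ (φ : M ⟶ N) {w : Γ(M, overlap k)} (hw : w ∈ lattice₁ M) :
    mapp φ _ w ∈ lattice₁ N := by
  obtain ⟨s, rfl⟩ := hw
  exact ⟨mapp φ _ s, (mapp_mres φ _ s).symm⟩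

theorem mapp_mem_globalSections (φ : M ⟶ N) {w : Γ(M, overlap k)} (hw : w ∈ globalSections M) :
    mapp φ _ w ∈ globalSections N :=
  ⟨mapp_mem_lattice₀ φ hw.1, mapp_mem_lattice₁ φ hw.2⟩

theorem pairH0_map {W W' : Type*} [AddCommGroup W] [Module k W] [AddCommGroup W'] [Module k W']
    (κ : W ≃ₗ[k] W') (A B : Submodule k W) :
    pairH0 (A.map κ.toLinearMap) (B.map κ.toLinearMap) = pairH0 A B := by
  rw [pairH0, ← Submodule.map_inf _ κ.injective]
  exact (LinearEquiv.finrank_eq (κ.submoduleMap (A ⊓ B))).symm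

theorem pairH1_map {W W' : Type*} [AddCommGroup W] [Module k W] [AddCommGroup W'] [Module k W']
    (κ : W ≃ₗ[k] W') (A B : Submodule k W) :
    pairH1 (A.map κ.toLinearMap) (B.map κ.toLinearMap) = pairH1 A B := by
  rw [pairH1, ← Submodule.map_sup]
  exact (LinearEquiv.finrank_eq (Submodule.Quotient.equiv _ _ κ rfl)).symm

theorem eulerChar_eq_zero (hM : IsLocallyFreeOfRank M n) (h₀ : globalSections M = ⊥)
    (h₁ : lattice₀ M ⊔ lattice₁ M = ⊤) : eulerChar M = 0 := by
  rw [eulerChar_eq hM, pairH0_eq_zero_of_inf h₀, pairH1_eq_zero_of_sup h₁]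
  rfl

theorem eulerChar_nonpos (hM : IsLocallyFreeOfRank M n) (h₀ : globalSections M = ⊥) :
    eulerChar M ≤ 0 := by
  rw [eulerChar_eq hM, pairH0_eq_zero_of_inf h₀]
  simp

theorem sup_eq_top_of_eulerChar (hM : IsLocallyFreeOfRank M n) (h₀ : globalSections M = ⊥)
    (h : eulerChar M = 0) : lattice₀ M ⊔ lattice₁ M = ⊤ := by
  rw [eulerChar_eq hM, pairH0_eq_zero_of_inf h₀] at h
  exact sup_eq_top_of_pairH1 (isLattice₀ hM) (isLattice₁ hM) (by simpa using h)

theorem globalSections_ne_bot (hM : IsLocallyFreeOfRank M n) (h : 0 < eulerChar M) :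
    globalSections M ≠ ⊥ := fun h₀ ↦ absurd (eulerChar_nonpos hM h₀) (by omega)

end Basics

namespace ParabolicBundle

variable {k : Type u} [Field k] {x : P1 k} {r : ℕ} (E F : ParabolicBundle (P1 k) x r) {i j : ℤ}

/-- The rank of `E_{i/r}` decreases with `i`, as the structure maps are injective, and is periodic, so
it is constant. -/
theorem rank_bundle (hr : 0 < r) (ℓ : LinearEquation x) (i : ℤ) :
    ParabolicP1.rank (E.bundle i) = E.rank := by
  have anti {i j : ℤ} (h : i ≤ j) : ParabolicP1.rank (E.bundle j) ≤ ParabolicP1.rank (E.bundle i) :=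
    rank_le_of_injective (E.isLocallyFree j) (E.isLocallyFree i) (E.incl h) (E.incl_injective hr h _)
  have per (i b : ℤ) : ParabolicP1.rank (E.bundle (i + r * b)) = ParabolicP1.rank (E.bundle i) := by
    obtain ⟨κ, -⟩ := E.exists_equiv (ℓ.isLocal 0) le_rfl (chart_ne_bot 0) b (i := i) rfl
    rw [← finrank_sections_chart (E.isLocallyFree (i + r * b)),
      ← finrank_sections_chart (E.isLocallyFree i)]
    exact κ.finrank_eq
  have hr' : (1 : ℤ) ≤ r := by exact_mod_cast hr
  have hi : |i| ≤ r * |i| := le_mul_of_one_le_left (abs_nonneg i) hr'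
  apply le_antisymm
  · rw [rank, underlying, ← per 0 (-|i|)]
    exact anti (by rw [zero_add, mul_neg]; exact (neg_le_neg hi).trans (neg_abs_le i))
  · rw [rank, underlying, ← per 0 |i|]
    exact anti (by rw [zero_add]; exact (le_abs_self i).trans hi)

theorem isLocallyFreeOfRank_bundle (hr : 0 < r) (ℓ : LinearEquation x) (i : ℤ) :
    IsLocallyFreeOfRank (E.bundle i) E.rank :=
  E.rank_bundle hr ℓ i ▸ E.isLocallyFree i

/-- The lattice pair of `E_{i/r + 1}` is that of `E_{i/r}`, twisted by a point. -/
theorem exists_lattice_equiv (ℓ : LinearEquation x) (hj : j = i + r) :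
    ∃ κ : Γ(E.bundle j, overlap k) ≃ₗ[k] Γ(E.bundle i, overlap k),
      (lattice₀ (E.bundle j)).map κ.toLinearMap = lattice₀ (E.bundle i) ∧
      (lattice₁ (E.bundle j)).map κ.toLinearMap =
        (lattice₁ (E.bundle i)).comap (mulT _).toLinearMap := by
  have h : i ≤ j := by omega
  have hj' : j = i + r * (1 : ℕ) := by simpa using hj
  obtain ⟨κ, hκ⟩ := E.exists_equiv_nat (ℓ.isLocal 0) (inf_le_left : overlap k ≤ _)
    overlap_ne_bot 1 i j h hj'
  obtain ⟨κ₀, hκ₀⟩ := E.exists_equiv_nat (ℓ.isLocal 0) le_rfl (chart_ne_bot 0) 1 i j h hj'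
  obtain ⟨κ₁, hκ₁⟩ := E.exists_equiv_nat (ℓ.isLocal 1) le_rfl (chart_ne_bot 1) 1 i j h hj'
  simp only [pow_one, ores_self] at hκ hκ₀ hκ₁
  have h₀ (w) : κ (mres _ inf_le_left w) = mres _ inf_le_left (κ₀ w) := by
    refine smul_injective (E.isLocallyFree i) overlap_ne_bot
      (ores_eqn_ne_zero ℓ (inf_le_left : overlap k ≤ _) overlap_ne_bot) ?_
    change ores _ (ℓ.eqn 0) • _ = ores _ (ℓ.eqn 0) • _
    rw [← hκ, mapp_mres, hκ₀, mres_smul]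
  have h₁ (w) : tCoord k • κ (mres _ inf_le_right w) = mres _ inf_le_right (κ₁ w) := by
    refine smul_injective (E.isLocallyFree i) overlap_ne_bot
      (ores_eqn_ne_zero ℓ (inf_le_right : overlap k ≤ _) overlap_ne_bot) ?_
    change ores _ (ℓ.eqn 1) • _ = ores _ (ℓ.eqn 1) • _
    rw [smul_smul, mul_comm, ← ℓ.compat, ← hκ, mapp_mres, hκ₁, mres_smul]
  refine ⟨κ.restrictScalars k, ?_, ?_⟩
  · ext w
    constructor
    · rintro ⟨_, ⟨s, rfl⟩, rfl⟩
      exact ⟨κ₀ s, (h₀ s).symm⟩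
    · rintro ⟨s, rfl⟩
      refine ⟨_, ⟨κ₀.symm s, rfl⟩, (h₀ _).trans ?_⟩
      rw [LinearEquiv.apply_symm_apply]
      rfl
  · ext w
    constructor
    · rintro ⟨_, ⟨s, rfl⟩, rfl⟩
      exact ⟨κ₁ s, (h₁ s).symm⟩
    · rintro ⟨s, hs⟩
      refine ⟨_, ⟨κ₁.symm s, rfl⟩, tCoord_smul_injective _ ((h₁ _).trans ?_)⟩
      rw [LinearEquiv.apply_symm_apply]
      exact hs

theorem globalSections_eq_bot_iff (ℓ : LinearEquation x) (hj : j = i + r) :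
    globalSections (E.bundle j) = ⊥ ↔
      lattice₀ (E.bundle i) ⊓ (lattice₁ (E.bundle i)).comap (mulT _).toLinearMap = ⊥ := by
  obtain ⟨κ, h₀, h₁⟩ := E.exists_lattice_equiv ℓ hj
  rw [← h₀, ← h₁, ← Submodule.map_inf _ κ.injective]
  exact Submodule.map_eq_bot_iff.symm

theorem sup_eq_top_iff (ℓ : LinearEquation x) (hj : j = i + r) :
    lattice₀ (E.bundle j) ⊔ lattice₁ (E.bundle j) = ⊤ ↔
      lattice₀ (E.bundle i) ⊔ (lattice₁ (E.bundle i)).comap (mulT _).toLinearMap = ⊤ := by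
  obtain ⟨κ, h₀, h₁⟩ := E.exists_lattice_equiv ℓ hj
  rw [← h₀, ← h₁, ← Submodule.map_sup]
  exact Submodule.map_eq_top_iff.symm

theorem eulerChar_period (hr : 0 < r) (ℓ : LinearEquation x) (hj : j = i + r) :
    eulerChar (E.bundle j) = eulerChar (E.bundle i) - E.rank := by
  have hi := E.isLocallyFreeOfRank_bundle hr ℓ i
  obtain ⟨κ, h₀, h₁⟩ := E.exists_lattice_equiv ℓ hj
  rw [eulerChar_eq (E.isLocallyFree j), eulerChar_eq hi, ← pairH0_map κ, ← pairH1_map κ, h₀, h₁]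
  exact pair_twist (isLattice₀ hi) (isLattice₁ hi)

theorem eulerChar_add_mul (hr : 0 < r) (ℓ : LinearEquation x) (i b : ℤ) :
    eulerChar (E.bundle (i + r * b)) = eulerChar (E.bundle i) - E.rank * b := by
  induction b using Int.induction_on with
  | zero => simp
  | succ b ih =>
    rw [E.eulerChar_period hr ℓ (show i + r * ((b : ℤ) + 1) = i + r * b + r by ring), ih]
    ring
  | pred b ih =>
    have := E.eulerChar_period hr ℓ (show i + r * (-(b : ℤ)) = i + r * (-b - 1) + r by ring)
    rw [ih] at this
    linarith

/-- The sections of `E_B` are `ℓ ^ B` times sections of `E_0`, and a sufficiently negative twist of a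
lattice pair has no common element. -/
theorem exists_globalSections_eq_bot (ℓ : LinearEquation x) :
    ∃ B : ℕ, globalSections (E.bundle (r * B)) = ⊥ := by
  obtain ⟨B, hB⟩ := exists_pow_inf_eq_bot (isLattice₀ (E.isLocallyFree 0))
    (isLattice₁ (E.isLocallyFree 0))
  refine ⟨B, (Submodule.eq_bot_iff _).2 ?_⟩
  rintro s ⟨⟨a, ha⟩, b, hb⟩
  have h : (0 : ℤ) ≤ r * B := by positivity
  obtain ⟨κ, hκ⟩ := E.exists_equiv_nat (ℓ.isLocal 0) (inf_le_left : overlap k ≤ _)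
    overlap_ne_bot B 0 (r * B) h (by ring)
  obtain ⟨κ₀, hκ₀⟩ := E.exists_equiv_nat (ℓ.isLocal 0) le_rfl (chart_ne_bot 0) B 0 (r * B) h
    (by ring)
  obtain ⟨κ₁, hκ₁⟩ := E.exists_equiv_nat (ℓ.isLocal 1) le_rfl (chart_ne_bot 1) B 0 (r * B) h
    (by ring)
  rw [ores_self] at hκ₀ hκ₁
  have h₀ : κ s = mres _ inf_le_left (κ₀ a) := by
    refine smul_injective (E.isLocallyFree 0) overlap_ne_bot (pow_ne_zero B
      (ores_eqn_ne_zero ℓ (inf_le_left : overlap k ≤ _) overlap_ne_bot)) ?_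
    change ores _ (ℓ.eqn 0) ^ B • _ = ores _ (ℓ.eqn 0) ^ B • _
    rw [← hκ, ← ha, restrictSections_apply, mapp_mres, hκ₀, mres_smul, map_pow]
  have h₁ : tCoord k ^ B • κ s = mres _ inf_le_right (κ₁ b) := by
    refine smul_injective (E.isLocallyFree 0) overlap_ne_bot (pow_ne_zero B
      (ores_eqn_ne_zero ℓ (inf_le_right : overlap k ≤ _) overlap_ne_bot)) ?_
    change ores _ (ℓ.eqn 1) ^ B • _ = ores _ (ℓ.eqn 1) ^ B • _
    rw [smul_smul, mul_comm, ← mul_pow, ← ℓ.compat, ← hκ, ← hb, restrictSections_apply, mapp_mres,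
      hκ₁, mres_smul, map_pow]
  have h2 := hB (κ s) ⟨κ₀ a, h₀.symm⟩ (by
    rw [smul_pow_apply mulT_apply, h₁]
    exact ⟨κ₁ b, rfl⟩)
  exact (map_eq_zero_iff κ κ.injective).1 h2

/-- The global sections of `E_{i/r}` decrease with `i`, from nonzero to zero. -/
theorem exists_greatest_globalSections (hr : 0 < r) (ℓ : LinearEquation x) (hE : 0 < E.rank) :
    ∃ m : ℤ, globalSections (E.bundle m) ≠ ⊥ ∧ ∀ j, m < j → globalSections (E.bundle j) = ⊥ := by
  obtain ⟨B, hB⟩ := E.exists_globalSections_eq_bot ℓ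
  have anti {i j : ℤ} (h : i ≤ j) (hi : globalSections (E.bundle i) = ⊥) :
      globalSections (E.bundle j) = ⊥ := by
    refine (Submodule.eq_bot_iff _).2 fun s hs ↦ ?_
    have h1 := mapp_mem_globalSections (E.incl h) hs
    rw [hi] at h1
    exact (map_eq_zero_iff _ (E.incl_injective hr h _)).1 h1
  obtain ⟨b, hb⟩ : ∃ b : ℤ, globalSections (E.bundle b) ≠ ⊥ := by
    refine ⟨0 + r * -(|eulerChar (E.bundle 0)| + 1),
      globalSections_ne_bot (E.isLocallyFree _) ?_⟩
    rw [E.eulerChar_add_mul hr ℓ]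
    have h1 : (1 : ℤ) ≤ E.rank := by exact_mod_cast hE
    have h2 := neg_abs_le (eulerChar (E.bundle 0))
    have h3 := abs_nonneg (eulerChar (E.bundle 0))
    nlinarith
  obtain ⟨m, hm, hm'⟩ := Int.exists_greatest_of_bdd
    (P := fun m ↦ globalSections (E.bundle m) ≠ ⊥)
    ⟨r * B, fun z hz ↦ by
      by_contra! h
      exact hz (anti h.le hB)⟩ ⟨b, hb⟩
  exact ⟨m, hm, fun j hj ↦ by
    by_contra h
    exact absurd (hm' j h) (by omega)⟩

end ParabolicBundle
/-! ### Line bundles given by frames -/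

section LineBundles

variable {X : Scheme.{u}} {L M : X.Modules} {U V : X.Opens}

theorem IsFrame.exists_eq_smul {g : Γ(L, U)} (hg : IsFrame L U fun _ : Fin 1 ↦ g) (h : V ≤ U)
    (s : Γ(L, V)) : ∃ a : Γ(X, V), s = a • mres L h g := by
  obtain ⟨a, ha⟩ := hg.exists_eq h s
  exact ⟨a 0, by rw [ha, Fin.sum_univ_one]⟩

theorem IsFrame.eq_of_smul_eq {g : Γ(L, U)} (hg : IsFrame L U fun _ : Fin 1 ↦ g) (h : V ≤ U)
    {a b : Γ(X, V)} (hab : a • mres L h g = b • mres L h g) : a = b :=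
  congrFun (hg.eq_of_sum_eq h (a := fun _ ↦ a) (b := fun _ ↦ b)
    (by simpa only [Fin.sum_univ_one] using hab)) 0

theorem isFrame_one_of_bijective {g : Γ(L, U)}
    (h : ∀ (V : X.Opens) (hV : V ≤ U), Function.Bijective fun a : Γ(X, V) ↦ a • mres L hV g) :
    IsFrame L U fun _ : Fin 1 ↦ g := by
  intro V hV
  have : (fun a : Fin 1 → Γ(X, V) ↦ ∑ i, a i • mres L hV g) =
      (fun a : Γ(X, V) ↦ a • mres L hV g) ∘ Equiv.funUnique (Fin 1) _ := by
    ext a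
    rw [Fin.sum_univ_one]
    rfl
  rw [this]
  exact (h V hV).comp (Equiv.bijective _)

/-- Morphisms that agree on local generators are equal. -/
theorem hom_ext_of_frames {ι : Type*} {W : ι → X.Opens} (hW : iSup W = ⊤) {g : ∀ i, Γ(L, W i)}
    (hg : ∀ i, IsFrame L (W i) fun _ : Fin 1 ↦ g i) {φ ψ : L ⟶ M}
    (h : ∀ i, mapp φ (W i) (g i) = mapp ψ (W i) (g i)) : φ = ψ := by
  refine hom_ext_mapp fun U s ↦ section_ext (fun i ↦ U ⊓ W i) U (fun i ↦ inf_le_left)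
    (by rw [← inf_iSup_eq, hW, inf_top_eq]) fun i ↦ ?_
  obtain ⟨a, ha⟩ := (hg i).exists_eq_smul inf_le_right (mres L (inf_le_left : U ⊓ W i ≤ U) s)
  rw [← mapp_mres, ← mapp_mres, ha, map_smul, map_smul, mapp_mres, mapp_mres, h]

/-- A line bundle with local generators `g i` maps to `M` by `g i ↦ σ i` whenever the `σ i` satisfy
the transition rules of the `g i`. -/
theorem exists_hom_of_frames {ι : Type*} {W : ι → X.Opens} (hW : iSup W = ⊤) {g : ∀ i, Γ(L, W i)}
    (hg : ∀ i, IsFrame L (W i) fun _ : Fin 1 ↦ g i) (σ : ∀ i, Γ(M, W i))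
    (h : ∀ i j, ∃ θ : Γ(X, W i ⊓ W j),
      mres L inf_le_left (g i) = θ • mres L inf_le_right (g j) ∧
      mres M inf_le_left (σ i) = θ • mres M inf_le_right (σ j)) :
    ∃ φ : L ⟶ M, ∀ i, mapp φ (W i) (g i) = σ i := by
  have hcov (U : X.Opens) : U ≤ ⨆ i, U ⊓ W i := by rw [← inf_iSup_eq, hW, inf_top_eq]
  choose a ha using fun (U : X.Opens) (s : Γ(L, U)) i ↦
    (hg i).exists_eq_smul inf_le_right (mres L (inf_le_left : U ⊓ W i ≤ U) s)
  have key (U : X.Opens) (s : Γ(L, U)) : ∃ t : Γ(M, U), ∀ i,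
      mres M (inf_le_left : U ⊓ W i ≤ U) t = a U s i • mres M inf_le_right (σ i) := by
    refine exists_section_gluing (fun i ↦ U ⊓ W i) U (fun i ↦ inf_le_left) (hcov U) _
      fun i j ↦ ?_
    obtain ⟨θ, h1, h2⟩ := h i j
    have hV : U ⊓ W i ⊓ (U ⊓ W j) ≤ W i ⊓ W j := inf_le_inf inf_le_right inf_le_right
    have e1 := congrArg (mres L hV) h1
    have e2 := congrArg (mres M hV) h2
    have e3 := congrArg (mres L (inf_le_left : U ⊓ W i ⊓ (U ⊓ W j) ≤ _)) (ha U s i)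
    have e4 := congrArg (mres L (inf_le_right : U ⊓ W i ⊓ (U ⊓ W j) ≤ _)) (ha U s j)
    simp only [mres_smul, mres_mres] at e1 e2 e3 e4 ⊢
    rw [e3, e1, smul_smul] at e4
    rw [e2, smul_smul, (hg j).eq_of_smul_eq _ e4]
  choose t ht using key
  -- the section `t U s` does not depend on the choice of coefficients
  have huniq {U V : X.Opens} (hV : V ≤ U) (s : Γ(L, U)) (i : ι) (hi : V ≤ W i) (b : Γ(X, V))
      (hb : mres L hV s = b • mres L hi (g i)) : mres M hV (t U s) = b • mres M hi (σ i) := by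
    have e1 := congrArg (mres L (le_inf hV hi)) (ha U s i)
    have e2 := congrArg (mres M (le_inf hV hi)) (ht U s i)
    simp only [mres_smul, mres_mres] at e1 e2
    rw [hb] at e1
    rw [e2, (hg i).eq_of_smul_eq _ e1]
  refine ⟨homOfSections (fun U ↦
    { toFun := t U
      map_add' := fun s s' ↦ section_ext (fun i ↦ U ⊓ W i) U (fun i ↦ inf_le_left) (hcov U)
        fun i ↦ by
          rw [map_add, ht U s, ht U s', ← add_smul]
          exact huniq _ _ _ _ _ (by rw [map_add, ha, ha, ← add_smul])
      map_smul' := fun f s ↦ section_ext (fun i ↦ U ⊓ W i) U (fun i ↦ inf_le_left) (hcov U)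
        fun i ↦ by
          rw [RingHom.id_apply, mres_smul, ht U s, smul_smul]
          exact huniq _ _ _ _ _ (by rw [mres_smul, ha, smul_smul]) })
    fun U V hV s ↦ ?_, fun i ↦ ?_⟩
  · refine section_ext (fun i ↦ V ⊓ W i) V (fun i ↦ inf_le_left) (hcov V) fun i ↦ ?_
    change mres M _ (t V _) = mres M _ (mres M hV (t U s))
    rw [ht V, mres_mres]
    exact (huniq _ _ _ _ _ (by rw [← ha V, mres_mres])).symm
  · change t _ _ = _
    have := huniq le_rfl (g i) i le_rfl 1 (one_smul _ _).symm
    rwa [mres_self, mres_self, one_smul] at this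

end LineBundles

/-! ### The line bundles `𝒪(a)` -/

section Serre

variable {k : Type u} [Field k] {x : P1 k} {V : (P1 k).Opens}

variable (k) in
/-- The coordinate `t = X₁ / X₀` as a unit on the overlap of the charts. -/
def tUnit : Γ(P1 k, overlap k)ˣ :=
  ⟨tCoord k, tInv k, tCoord_mul_tInv, tInv_mul_tCoord⟩

theorem transition_eq (a : ℤ) : transition k a = ↑(tUnit k ^ a) := by
  obtain ⟨m, rfl | rfl⟩ := Int.eq_nat_or_neg a
  · rw [zpow_natCast, Units.val_pow_eq_pow_val, transition, Int.toNat_natCast,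
      Int.toNat_of_nonpos (by simp), pow_zero, mul_one]
    rfl
  · rw [zpow_neg, zpow_natCast, ← inv_pow, Units.val_pow_eq_pow_val, transition, neg_neg,
      Int.toNat_natCast, Int.toNat_of_nonpos (by simp), pow_zero, one_mul]
    rfl

theorem iSup_chart : ⨆ c, chart k c = ⊤ := by
  rw [← top_le_iff, ← chart_sup_chart]
  exact sup_le (le_iSup _ 0) (le_iSup _ 1)

/-- The section of `𝒪(a)` with the given coordinates. -/
def serreSection {a : ℤ} (s : serreSections a V) : Γ(serreTwist k a, V) := s

variable (k) in
/-- The standard generators of `𝒪(a)` over the two charts. -/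
def serreGen (a : ℤ) : ∀ c : Fin 2, Γ(serreTwist k a, chart k c)
  | 0 => serreSection ⟨(1, res (V := chart k 0 ⊓ chart k 1) le_rfl ↑(tUnit k ^ (-a))), by
      rw [mem_serreSections, transition_eq, map_one, res_res, ← map_mul, ← Units.val_mul,
        ← zpow_add, add_neg_cancel, zpow_zero, Units.val_one, map_one]⟩
  | 1 => serreSection ⟨(res (V := chart k 1 ⊓ chart k 0) (inf_comm _ _).le ↑(tUnit k ^ a), 1), by
      rw [mem_serreSections, transition_eq, map_one, res_res, mul_one]⟩

theorem isFrame_serreGen (a : ℤ) (c : Fin 2) :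
    IsFrame (serreTwist k a) (chart k c) fun _ : Fin 1 ↦ serreGen k a c := by
  refine isFrame_one_of_bijective fun V hV ↦ ?_
  match c with
  | 0 =>
    have hV0 : V ≤ V ⊓ chart k 0 := le_inf le_rfl hV
    refine ⟨fun f g hfg ↦ ?_, fun s ↦ ?_⟩
    · have h1 : res inf_le_left f * res _ 1 = res inf_le_left g * res _ 1 := congrArg
        (fun s : serreSections a V ↦ s.1.1) hfg
      rw [map_one, mul_one, mul_one] at h1
      have := congrArg (res hV0) h1
      rwa [res_res, res_res, res_self, res_self] at this
    · change serreSections a V at s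
      refine ⟨res hV0 s.1.1, serre_ext ?_ ?_⟩
      · change res _ (res _ _) * res _ 1 = _
        rw [map_one, mul_one, res_res, res_self]
      · have hle : V ⊓ chart k 1 ≤ V ⊓ (chart k 0 ⊓ chart k 1) :=
          le_inf inf_le_left (le_inf (inf_le_left.trans hV) inf_le_right)
        have hs := congrArg (res hle) (mem_serreSections.1 s.2)
        change res _ (res _ _) * res _ (res _ _) = _
        rw [map_mul, res_res, res_res, res_res, res_self, transition_eq] at hs
        rw [res_res, res_res, hs, mul_right_comm, ← map_mul, ← Units.val_mul, ← zpow_add,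
          add_neg_cancel, zpow_zero, Units.val_one, map_one, one_mul]
  | 1 =>
    have hV0 : V ≤ V ⊓ chart k 1 := le_inf le_rfl hV
    refine ⟨fun f g hfg ↦ ?_, fun s ↦ ?_⟩
    · have h1 : res inf_le_left f * res _ 1 = res inf_le_left g * res _ 1 := congrArg
        (fun s : serreSections a V ↦ s.1.2) hfg
      rw [map_one, mul_one, mul_one] at h1
      have := congrArg (res hV0) h1
      rwa [res_res, res_res, res_self, res_self] at this
    · change serreSections a V at s
      refine ⟨res hV0 s.1.2, serre_ext ?_ ?_⟩
      · have hle : V ⊓ chart k 0 ≤ V ⊓ (chart k 0 ⊓ chart k 1) :=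
          le_inf inf_le_left (le_inf inf_le_right (inf_le_left.trans hV))
        have hs := congrArg (res hle) (mem_serreSections.1 s.2)
        change res _ (res _ _) * res _ (res _ _) = _
        rw [map_mul, res_res, res_res, res_res, res_self, transition_eq] at hs
        rw [res_res, res_res, hs, mul_comm]
      · change res _ (res _ _) * res _ 1 = _
        rw [map_one, mul_one, res_res, res_self]

theorem mres_serreGen (a : ℤ) (h₀ : V ≤ chart k 0) (h₁ : V ≤ chart k 1) :
    mres _ h₁ (serreGen k a 1) = res (le_inf h₀ h₁) ↑(tUnit k ^ a) • mres _ h₀ (serreGen k a 0) := by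
  refine serre_ext ?_ ?_
  · change res _ (res _ _) = res _ (res _ _) * res _ 1
    rw [map_one, mul_one, res_res, res_res]
  · change res _ 1 = res _ (res _ _) * res _ (res _ _)
    rw [res_res, res_res, ← map_mul, ← Units.val_mul, ← zpow_add, add_neg_cancel, zpow_zero,
      Units.val_one, map_one, map_one]

theorem isLocallyFreeOfRank_serreTwist (a : ℤ) : IsLocallyFreeOfRank (serreTwist k a) 1 :=
  isLocallyFreeOfRank_of_isFrame fun p ↦ by
    obtain ⟨c, hc⟩ := Opens.mem_iSup.1 ((iSup_chart (k := k)).ge (trivial : p ∈ (⊤ : (P1 k).Opens)))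
    exact ⟨_, _, hc, isFrame_serreGen a c⟩

/-- A morphism from `𝒪(a)` is given by two sections that satisfy its transition rule. -/
theorem exists_hom_serreTwist {M : (P1 k).Modules} (a : ℤ) (σ : ∀ c, Γ(M, chart k c))
    (h : mres M (V := overlap k) inf_le_right (σ 1) =
      (↑(tUnit k ^ a) : Γ(P1 k, overlap k)) • mres M inf_le_left (σ 0)) :
    ∃ φ : serreTwist k a ⟶ M, ∀ c, mapp φ _ (serreGen k a c) = σ c := by
  have h' (V : (P1 k).Opens) (h₀ : V ≤ chart k 0) (h₁ : V ≤ chart k 1) : mres M h₁ (σ 1) =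
      res (le_inf h₀ h₁) (↑(tUnit k ^ a) : Γ(P1 k, overlap k)) • mres M h₀ (σ 0) := by
    have := congrArg (mres M (le_inf h₀ h₁)) h
    rwa [mres_smul, mres_mres, mres_mres] at this
  have hu (V : (P1 k).Opens) (h : V ≤ overlap k) :
      res h (↑(tUnit k ^ (-a)) : Γ(P1 k, overlap k)) * res h ↑(tUnit k ^ a) = 1 := by
    rw [← map_mul, ← Units.val_mul, ← zpow_add, neg_add_cancel, zpow_zero, Units.val_one, map_one]
  refine exists_hom_of_frames iSup_chart (isFrame_serreGen a) σ fun i j ↦ ?_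
  match i, j with
  | 0, 0 => exact ⟨1, (one_smul _ _).symm, (one_smul _ _).symm⟩
  | 1, 1 => exact ⟨1, (one_smul _ _).symm, (one_smul _ _).symm⟩
  | 1, 0 => exact ⟨res (le_inf inf_le_right inf_le_left) ↑(tUnit k ^ a),
      mres_serreGen a _ _, h' _ _ _⟩
  | 0, 1 =>
    refine ⟨res le_rfl ↑(tUnit k ^ (-a)), ?_, ?_⟩
    · rw [mres_serreGen a inf_le_left, smul_smul, hu, one_smul]
    · rw [h' _ inf_le_left, smul_smul, hu, one_smul]

end Serre
/-! ### Parabolic line bundles on the projective line -/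

section ParabolicLineBundles

variable {k : Type u} [Field k] {x : P1 k} {r : ℕ} (ℓ : LinearEquation x)

theorem mem_serreSections_smul {a b : ℤ} {d : ℕ} (h : b = a + d) {V : (P1 k).Opens}
    {s : Γ(P1 k, V ⊓ chart k 0) × Γ(P1 k, V ⊓ chart k 1)} (hs : s ∈ serreSections a V) :
    (res inf_le_right (ℓ.eqn 0) ^ d * s.1, res inf_le_right (ℓ.eqn 1) ^ d * s.2) ∈
      serreSections b V := by
  have hc := congrArg (res (inf_le_right : V ⊓ (chart k 0 ⊓ chart k 1) ≤ _)) ℓ.compat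
  change res _ (res _ _) = res _ (_ * res _ _) at hc
  rw [map_mul, res_res, res_res] at hc
  have hb : (↑(tUnit k ^ b) : Γ(P1 k, overlap k)) = tCoord k ^ d * ↑(tUnit k ^ a) := by
    rw [h, add_comm, zpow_add, zpow_natCast, Units.val_mul, Units.val_pow_eq_pow_val]
    rfl
  rw [mem_serreSections, transition_eq] at hs ⊢
  rw [map_mul, map_mul, hs, map_pow, map_pow, res_res, res_res, hc, hb, map_mul, map_pow]
  ring

/-- Multiplication by the `d`-th power of the linear form `ℓ`, as a morphism `𝒪(a) ⟶ 𝒪(a + d)`. -/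
def serreMul {a b : ℤ} {d : ℕ} (h : b = a + d) : serreTwist k a ⟶ serreTwist k b :=
  homOfSections (fun V ↦
    { toFun := fun s ↦ serreSection
        ⟨_, mem_serreSections_smul ℓ h (show serreSections a V from s).2⟩
      map_add' := fun s t ↦ serre_ext (mul_add _ _ _) (mul_add _ _ _)
      map_smul' := fun f s ↦ serre_ext (mul_left_comm _ _ _) (mul_left_comm _ _ _) })
    fun U V hV s ↦ serre_ext (by
        change res _ (ℓ.eqn 0) ^ d * res _ _ = res _ (res _ (ℓ.eqn 0) ^ d * _)
        rw [map_mul, map_pow, res_res]) (by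
        change res _ (ℓ.eqn 1) ^ d * res _ _ = res _ (res _ (ℓ.eqn 1) ^ d * _)
        rw [map_mul, map_pow, res_res])

theorem serreMul_zero {a : ℤ} (h : a = a + (0 : ℕ)) : serreMul ℓ h = 𝟙 _ :=
  hom_ext_mapp fun _ _ ↦ serre_ext
    ((congrArg (· * _) (pow_zero _)).trans (one_mul _))
    ((congrArg (· * _) (pow_zero _)).trans (one_mul _))

theorem serreMul_comp {a b c : ℤ} {d e f : ℕ} (h : b = a + d) (h' : c = b + e) (h'' : c = a + f) :
    serreMul ℓ h ≫ serreMul ℓ h' = serreMul ℓ h'' := by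
  obtain rfl : f = e + d := by omega
  exact hom_ext_mapp fun _ _ ↦ serre_ext
    ((mul_assoc _ _ _).symm.trans (congrArg (· * _) (pow_add _ _ _).symm))
    ((mul_assoc _ _ _).symm.trans (congrArg (· * _) (pow_add _ _ _).symm))

theorem serreMul_congr {a b : ℤ} {d e : ℕ} (h : b = a + d) (h' : b = a + e) :
    serreMul ℓ h = serreMul ℓ h' := by
  obtain rfl : d = e := by omega
  rfl

theorem compat_of_le {V : (P1 k).Opens} (h : V ≤ overlap k) :
    ores (h.trans inf_le_left) (ℓ.eqn 0) =
      ores h (tCoord k) * ores (h.trans inf_le_right) (ℓ.eqn 1) := by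
  have := congrArg (ores h) ℓ.compat
  rwa [ores_ores, map_mul, ores_ores] at this

theorem mapp_serreMul_serreGen {a b : ℤ} {d : ℕ} (h : b = a + d) (c : Fin 2) :
    mapp (serreMul ℓ h) _ (serreGen k a c) = ℓ.eqn c ^ d • serreGen k b c := by
  have hb : (↑(tUnit k ^ (-a)) : Γ(P1 k, overlap k)) = tCoord k ^ d * ↑(tUnit k ^ (-b)) := by
    rw [show -a = -b + d by omega, add_comm, zpow_add, zpow_natCast, Units.val_mul,
      Units.val_pow_eq_pow_val]
    rfl
  have hb' : (↑(tUnit k ^ b) : Γ(P1 k, overlap k)) = tCoord k ^ d * ↑(tUnit k ^ a) := by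
    rw [h, add_comm, zpow_add, zpow_natCast, Units.val_mul, Units.val_pow_eq_pow_val]
    rfl
  match c with
  | 0 =>
    refine serre_ext ?_ ?_
    · change ores _ (ℓ.eqn 0) ^ d * 1 = ores _ (ℓ.eqn 0 ^ d) * 1
      rw [map_pow]
    · change ores _ (ℓ.eqn 1) ^ d * ores _ _ = ores _ (ℓ.eqn 0 ^ d) * ores _ _
      rw [hb, map_pow (ores _) (ℓ.eqn 0), compat_of_le ℓ (V := chart k 0 ⊓ chart k 1) le_rfl,
        map_mul, map_pow]
      ring
  | 1 =>
    refine serre_ext ?_ ?_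
    · change ores _ (ℓ.eqn 0) ^ d * ores _ _ = ores _ (ℓ.eqn 1 ^ d) * ores _ _
      rw [hb', map_pow (ores _) (ℓ.eqn 1),
        compat_of_le ℓ (V := chart k 1 ⊓ chart k 0) (inf_comm _ _).le, map_mul, map_pow]
      ring
    · change ores _ (ℓ.eqn 1) ^ d * 1 = ores _ (ℓ.eqn 1 ^ d) * 1
      rw [map_pow]

theorem mapp_serreMul_mres_serreGen {a b : ℤ} {d : ℕ} (h : b = a + d) {c : Fin 2}
    {V : (P1 k).Opens} (hV : V ≤ chart k c) :
    mapp (serreMul ℓ h) _ (mres _ hV (serreGen k a c)) =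
      ores hV (ℓ.eqn c) ^ d • mres _ hV (serreGen k b c) := by
  rw [mapp_mres, mapp_serreMul_serreGen, mres_smul, map_pow]

theorem serreMul_injective {a b : ℤ} {d : ℕ} (h : b = a + d) (V : (P1 k).Opens) :
    Function.Injective (mapp (serreMul ℓ h) V) := by
  have key (c : Fin 2) (f g : Γ(P1 k, V ⊓ chart k c))
      (hfg : ores inf_le_right (ℓ.eqn c) ^ d * f = ores inf_le_right (ℓ.eqn c) ^ d * g) :
      f = g := by
    by_cases hne : V ⊓ chart k c = ⊥
    · rw [ores_eq_zero_of_bot le_rfl hne f, ores_eq_zero_of_bot le_rfl hne g]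
    · have := isDomain_sections hne
      exact mul_left_cancel₀ (pow_ne_zero _ (ores_eqn_ne_zero ℓ _ hne)) hfg
  intro s t hst
  change serreSections a V at s t
  exact serre_ext (key 0 _ _ (congrArg (fun s : serreSections b V ↦ s.1.1) hst))
    (key 1 _ _ (congrArg (fun s : serreSections b V ↦ s.1.2) hst))

theorem mem_range_serreMul_iff {a b : ℤ} (h : b = a + (1 : ℕ)) {c : Fin 2} {V : (P1 k).Opens}
    (hV : V ≤ chart k c) (s : Γ(serreTwist k b, V)) :
    s ∈ LinearMap.range (mapp (serreMul ℓ h) V) ↔ ∃ w, s = ores hV (ℓ.eqn c) • w := by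
  constructor
  · rintro ⟨w, rfl⟩
    obtain ⟨f, rfl⟩ := (isFrame_serreGen a c).exists_eq_smul hV w
    refine ⟨f • mres _ hV (serreGen k b c), ?_⟩
    rw [map_smul, mapp_serreMul_mres_serreGen, pow_one, smul_comm]
  · rintro ⟨w, rfl⟩
    obtain ⟨f, rfl⟩ := (isFrame_serreGen b c).exists_eq_smul hV w
    refine ⟨f • mres _ hV (serreGen k a c), ?_⟩
    rw [map_smul, mapp_serreMul_mres_serreGen, pow_one, smul_comm]

/-- The image of `𝒪(a)` in `𝒪(a + 1)` under multiplication by `ℓ` is `𝒪(a + 1) ⊗ 𝒪(-x)`. -/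
theorem exists_iso_twist_serreTwist {a b : ℤ} (h : b = a + (1 : ℕ)) :
    ∃ γ : (twist x).obj (serreTwist k b) ≅ serreTwist k a,
      γ.hom ≫ serreMul ℓ h = (twistInclusion x).app (serreTwist k b) := by
  have hb := isLocallyFreeOfRank_serreTwist (k := k) b
  refine exists_iso_of_range_eq _ _ (twistInclusion_injective hb x) (serreMul_injective ℓ h)
    fun U ↦ ?_
  have loc (p : P1 k) : ∃ c, p ∈ chart k c :=
    Opens.mem_iSup.1 (iSup_chart.ge (trivial : p ∈ (⊤ : (P1 k).Opens)))
  apply le_antisymm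
  · rintro _ ⟨s, rfl⟩
    refine mem_range_of_locally (serreMul_injective ℓ h) fun p hp ↦ ?_
    obtain ⟨c, hc⟩ := loc p
    refine ⟨U ⊓ chart k c, inf_le_left, ⟨hp, hc⟩, (mem_range_serreMul_iff ℓ h inf_le_right _).2 ?_⟩
    rw [← mem_range_twistInclusion_iff_exists_smul hb (ℓ.isLocal c)]
    exact ⟨_, mapp_mres _ _ _⟩
  · rintro _ ⟨s, rfl⟩
    refine mem_range_of_locally (twistInclusion_injective hb x) fun p hp ↦ ?_
    obtain ⟨c, hc⟩ := loc p
    refine ⟨U ⊓ chart k c, inf_le_left, ⟨hp, hc⟩, ?_⟩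
    refine (mem_range_twistInclusion_iff_exists_smul hb (ℓ.isLocal c) inf_le_right _).2 ?_
    rw [← mem_range_serreMul_iff ℓ h]
    exact ⟨_, mapp_mres _ _ _⟩

variable (r) in
/-- The degree of the component at `i / r` of the parabolic line bundle that jumps at `m / r`. -/
def lineDegree (m i : ℤ) : ℤ := (m - i) / r

theorem lineDegree_eq_add (m : ℤ) {i j : ℤ} (h : i ≤ j) :
    lineDegree r m i = lineDegree r m j + (lineDegree r m i - lineDegree r m j).toNat := by
  have : lineDegree r m j ≤ lineDegree r m i := by
    obtain rfl | hr := Nat.eq_zero_or_pos r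
    · simp [lineDegree]
    · exact Int.ediv_le_ediv (by omega) (by omega)
  omega

theorem lineDegree_sub_mul (hr : 0 < r) (m i b : ℤ) :
    lineDegree r m (i + r * b) = lineDegree r m i - b := by
  rw [lineDegree, lineDegree, show m - (i + r * b) = m - i + r * -b by ring,
    Int.add_mul_ediv_left _ _ (by omega)]
  ring

variable (r) in
/-- The functor `i ↦ 𝒪(⌊(m - i) / r⌋)`, with powers of `ℓ` as structure maps. -/
def lineFunctor (m : ℤ) : ℤᵒᵖ ⥤ (P1 k).Modules where
  obj i := serreTwist k (lineDegree r m i.unop)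
  map f := serreMul ℓ (lineDegree_eq_add m (leOfHom f.unop))
  map_id i := (serreMul_congr ℓ _ (by simp)).trans (serreMul_zero ℓ (by simp))
  map_comp f g := (serreMul_comp ℓ _ _ _).symm

theorem lineDegree_period (hr : 0 < r) (m i : ℤ) :
    lineDegree r m i = lineDegree r m (i + r) + (1 : ℕ) := by
  have := lineDegree_sub_mul hr m i 1
  rw [mul_one] at this
  simp [this]

/-- The isomorphism `L_{i/r} ⊗ 𝒪(-x) ≅ L_{i/r + 1}`. -/
def lineIso (hr : 0 < r) (m i : ℤ) :
    (twist x).obj (serreTwist k (lineDegree r m i)) ≅ serreTwist k (lineDegree r m (i + r)) :=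
  (exists_iso_twist_serreTwist ℓ (lineDegree_period hr m i)).choose

theorem lineIso_hom (hr : 0 < r) (m i : ℤ) : (lineIso ℓ hr m i).hom ≫
    serreMul ℓ (lineDegree_period hr m i) = (twistInclusion x).app _ :=
  (exists_iso_twist_serreTwist ℓ (lineDegree_period hr m i)).choose_spec

/-- The isomorphisms `L_{i/r} ⊗ 𝒪(-x) ≅ L_{i/r + 1}` are natural in `i`. -/
def lineShiftIso (hr : 0 < r) (m : ℤ) :
    lineFunctor r ℓ m ⋙ twist x ≅ shiftFunctor r ⋙ lineFunctor r ℓ m :=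
  NatIso.ofComponents (fun i ↦ lineIso ℓ hr m i.unop) fun {i j} f ↦ by
    have : Mono (serreMul ℓ (lineDegree_period hr m j.unop)) :=
      mono_of_mapp_injective _ (serreMul_injective ℓ _)
    have hf := leOfHom f.unop
    have h₁ := lineDegree_eq_add (r := r) m hf
    have h₂ := lineDegree_eq_add (r := r) m (add_le_add_left hf (r : ℤ))
    change (twist x).map (serreMul ℓ h₁) ≫ (lineIso ℓ hr m j.unop).hom =
      (lineIso ℓ hr m i.unop).hom ≫ serreMul ℓ h₂
    have h3 : (twist x).map (serreMul ℓ h₁) ≫ (twistInclusion x).app _ =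
      (twistInclusion x).app (serreTwist k (lineDegree r m i.unop)) ≫ serreMul ℓ h₁ := (twistInclusion x).naturality _
    have h4 := lineDegree_period hr m i.unop
    have h5 := lineDegree_period hr m j.unop
    have h6 : lineDegree r m j.unop = lineDegree r m (i.unop + r) +
        (1 + (lineDegree r m j.unop - lineDegree r m i.unop).toNat : ℕ) := by omega
    rw [← cancel_mono (serreMul ℓ h5), Category.assoc, lineIso_hom, h3, Category.assoc,
      serreMul_comp ℓ h₂ h5 h6, ← lineIso_hom ℓ hr, Category.assoc,
      serreMul_comp ℓ h4 h₁ h6]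

/-- The parabolic line bundle whose component at `i / r` is `𝒪(⌊(m - i) / r⌋)`. -/
def lineBundle (hr : 0 < r) (m : ℤ) : ParabolicBundle (P1 k) x r where
  functor := lineFunctor r ℓ m
  isVectorBundle i := ⟨1, isLocallyFreeOfRank_serreTwist _⟩
  j := lineShiftIso ℓ hr m
  triangle i := by
    change (lineIso ℓ hr m i).hom ≫ serreMul ℓ (lineDegree_eq_add m (by simp)) = _
    rw [serreMul_congr ℓ _ (lineDegree_period hr m i)]
    exact lineIso_hom ℓ hr m i

theorem lineBundle_rank (hr : 0 < r) (m : ℤ) : (lineBundle ℓ hr m).rank = 1 :=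
  (isLocallyFreeOfRank_serreTwist (k := k) (lineDegree r m 0)).rank_eq

theorem lineBundle_incl_serreGen (hr : 0 < r) (m : ℤ) {i j : ℤ} (h : i ≤ j) (c : Fin 2) :
    mapp ((lineBundle ℓ hr m).incl h) _ (serreGen k (lineDegree r m j) c) =
      ℓ.eqn c ^ (lineDegree r m i - lineDegree r m j).toNat • serreGen k (lineDegree r m i) c :=
  mapp_serreMul_serreGen ℓ (lineDegree_eq_add m h) c

theorem mres_serreGen_ne_zero (a : ℤ) {c : Fin 2} {V : (P1 k).Opens} (hV : V ≤ chart k c)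
    (hne : V ≠ ⊥) : mres _ hV (serreGen k a c) ≠ 0 := fun h ↦ by
  have := isDomain_sections hne
  exact one_ne_zero ((isFrame_serreGen a c).eq_of_smul_eq hV (a := 1) (b := 0)
    (by rw [one_smul, zero_smul, h]))

theorem globalSections_serreTwist_zero : globalSections (serreTwist k 0) ≠ ⊥ := by
  refine (Submodule.ne_bot_iff _).2 ⟨mres _ inf_le_left (serreGen k 0 0),
    ⟨⟨_, rfl⟩, serreGen k 0 1, (mres_serreGen 0 inf_le_left inf_le_right).trans ?_⟩,
    mres_serreGen_ne_zero 0 _ overlap_ne_bot⟩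
  rw [zpow_zero, Units.val_one, map_one, one_smul]

theorem globalSections_serreTwist_neg_one : globalSections (serreTwist k (-1)) = ⊥ := by
  refine (Submodule.eq_bot_iff _).2 ?_
  rintro s ⟨⟨a, rfl⟩, b, hb⟩
  obtain ⟨p, rfl⟩ := (isFrame_serreGen (-1) 0).exists_eq_smul le_rfl a
  obtain ⟨q, rfl⟩ := (isFrame_serreGen (-1) 1).exists_eq_smul le_rfl b
  rw [restrictSections_apply, restrictSections_apply, mres_smul, mres_smul, mres_mres, mres_mres,
    mres_serreGen (-1) inf_le_left inf_le_right, smul_smul] at hb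
  have h1 := (isFrame_serreGen (-1) 0).eq_of_smul_eq _ hb
  have h2 : p = 0 := by
    refine eq_zero_of_ores_eq zero_ne_one inf_le_left inf_le_right overlap_ne_bot (c := q) ?_
    rw [← h1, mul_comm, map_mul (ores _) (coordinate k 1 0), zpow_neg_one]
    exact congrArg (· * _) (res_self _ _)
  rw [h2, zero_smul, map_zero]

/-- The components of the parabolic line bundle just above the jump are copies of `𝒪(-1)`, which
has no cohomology. -/
theorem lineBundle_eulerChar (hr : 0 < r) {m i : ℤ} (h₁ : m < i) (h₂ : i ≤ m + r) :
    eulerChar ((lineBundle ℓ hr m).bundle i) = 0 := by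
  set L := lineBundle ℓ hr m
  have hi : i = i - r + r := by ring
  have e0 : lineDegree r m (i - r) = 0 := by
    rw [lineDegree]
    exact Int.ediv_eq_zero_of_lt (by omega) (by omega)
  have e1 : lineDegree r m i = -1 := by
    have := lineDegree_period hr m (i - r)
    rw [← hi, e0] at this
    omega
  have hL : IsLocallyFreeOfRank (L.bundle (i - r)) 1 := isLocallyFreeOfRank_serreTwist _
  have g0 : globalSections (L.bundle (i - r)) ≠ ⊥ := by
    change globalSections (serreTwist k (lineDegree r m (i - r))) ≠ ⊥
    rw [e0]
    exact globalSections_serreTwist_zero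
  have g1 : globalSections (L.bundle i) = ⊥ := by
    change globalSections (serreTwist k (lineDegree r m i)) = ⊥
    rw [e1]
    exact globalSections_serreTwist_neg_one
  refine eulerChar_eq_zero (L.isLocallyFree i) g1 ((L.sup_eq_top_iff ℓ hi).2 ?_)
  obtain ⟨s, hs, hs0⟩ := Submodule.exists_mem_ne_zero_of_ne_bot g0
  refine twist_eq_top_of_rank_one (isLattice₀ hL) (isLattice₁ hL) hs fun h ↦ hs0 ?_
  have := (L.globalSections_eq_bot_iff ℓ hi).1 g1
  exact (Submodule.mem_bot k).1 (this ▸ ⟨hs.1, h⟩)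

end ParabolicLineBundles
namespace ParabolicBundle

/-! ### Direct sums of copies of a parabolic line bundle are semistable -/

variable {k : Type u} [Field k] {x : P1 k} {r : ℕ} {E F L : ParabolicBundle (P1 k) x r} {n : ℕ}

theorem slope_eq (hE : 0 < E.rank) : E.slope = (1 - eulerChar (structureModule (P1 k))) +
    1 / r * ((∑ i ∈ Finset.Icc 1 r, eulerChar (E.bundle i) : ℤ) / E.rank : ℚ) := by
  have : (E.rank : ℚ) ≠ 0 := by exact_mod_cast hE.ne'
  rw [slope, parabolicDegree]
  push_cast
  field_simp

/-- The constant terms of the slopes cancel in a comparison. -/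
theorem slope_le_slope_iff (hr : 0 < r) (hF : 0 < F.rank) (hE : 0 < E.rank) :
    F.slope ≤ E.slope ↔ (∑ i ∈ Finset.Icc 1 r, eulerChar (F.bundle i)) * E.rank ≤
      (∑ i ∈ Finset.Icc 1 r, eulerChar (E.bundle i)) * F.rank := by
  have hr' : (0 : ℚ) < 1 / r := by positivity
  have hF' : (0 : ℚ) < F.rank := by exact_mod_cast hF
  have hE' : (0 : ℚ) < E.rank := by exact_mod_cast hE
  rw [slope_eq hF, slope_eq hE, add_le_add_iff_left, mul_le_mul_iff_right₀ hr',
    div_le_div_iff₀ hF' hE']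
  exact_mod_cast Iff.rfl

/-- Every component of a parabolic line bundle has a translate by a multiple of the period without
cohomology. -/
theorem exists_no_cohomology_of_rank_one (hr : 0 < r) (ℓ : LinearEquation x) (hL : L.rank = 1)
    (i : ℤ) : globalSections (L.bundle (i + r * eulerChar (L.bundle i))) = ⊥ ∧
      lattice₀ (L.bundle (i + r * eulerChar (L.bundle i))) ⊔
        lattice₁ (L.bundle (i + r * eulerChar (L.bundle i))) = ⊤ := by
  have h := L.isLocallyFreeOfRank_bundle hr ℓ (i + r * eulerChar (L.bundle i))
  have hχ := L.eulerChar_add_mul hr ℓ i (eulerChar (L.bundle i))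
  rw [hL] at h hχ
  rw [Nat.cast_one, one_mul, sub_self] at hχ
  have h0 : globalSections (L.bundle (i + r * eulerChar (L.bundle i))) = ⊥ :=
    inf_eq_bot_of_rank_one (isLattice₀ h) (isLattice₁ h) (by rw [eulerChar_eq h] at hχ; omega)
  exact ⟨h0, sup_eq_top_of_eulerChar h h0 hχ⟩

theorem IsDirectSumOfCopies.apply_eq_sum {ι : Fin n → (L ⟶ E)} {π : Fin n → (E ⟶ L)}
    (h : ∑ a, (π a).hom ≫ (ι a).hom = 𝟙 E.functor) (i : ℤ) {V : (P1 k).Opens}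
    (w : Γ(E.bundle i, V)) :
    w = ∑ a, mapp (comp (ι a).hom i) V (mapp (comp (π a).hom i) V w) := by
  have h1 : ∑ a, comp (π a).hom i ≫ comp (ι a).hom i = 𝟙 (E.bundle i) := by
    have h2 := congrArg (fun φ : E.functor ⟶ E.functor ↦ φ.app (.op i)) h
    exact (NatTrans.app_sum _ _ fun a ↦ (π a).hom ≫ (ι a).hom).symm.trans h2
  conv_lhs => rw [← mapp_id w, ← h1, mapp_sum]
  rfl

/-- The translate of `L_{i/r}` by its Euler characteristic has neither `H⁰` nor `H¹`, so the same holds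
for the translate of `E_{i/r}`. -/
theorem IsDirectSumOfCopies.eulerChar_eq (hr : 0 < r) (ℓ : LinearEquation x) (hL : L.rank = 1)
    (h : E.IsDirectSumOfCopies L n) (i : ℤ) :
    globalSections (E.bundle (i + r * eulerChar (L.bundle i))) = ⊥ ∧
      eulerChar (E.bundle i) = E.rank * eulerChar (L.bundle i) := by
  obtain ⟨ι, π, -, -, hsum⟩ := h
  obtain ⟨h0, h1⟩ := exists_no_cohomology_of_rank_one hr ℓ hL i
  set j := i + r * eulerChar (L.bundle i) with hj
  have h0' : globalSections (E.bundle j) = ⊥ := by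
    refine (Submodule.eq_bot_iff _).2 fun w hw ↦ ?_
    rw [apply_eq_sum hsum j w]
    refine Finset.sum_eq_zero fun a _ ↦ ?_
    have := mapp_mem_globalSections (comp (π a).hom j) hw
    rw [h0] at this
    rw [(Submodule.mem_bot k).1 this, map_zero]
  refine ⟨h0', ?_⟩
  have h1' : lattice₀ (E.bundle j) ⊔ lattice₁ (E.bundle j) = ⊤ := by
    refine top_le_iff.1 fun w _ ↦ ?_
    rw [apply_eq_sum hsum j w]
    refine sum_mem fun a _ ↦ ?_
    obtain ⟨p, hp, q, hq, hpq⟩ := Submodule.mem_sup.1 (h1.ge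
      (trivial : mapp (comp (π a).hom j) (overlap k) w ∈ (⊤ : Submodule k Γ(L.bundle j, overlap k))))
    have e : mapp (comp (π a).hom j) (overlap k) w = p + q := hpq.symm
    rw [e, map_add]
    exact add_mem (Submodule.mem_sup_left (mapp_mem_lattice₀ _ hp))
      (Submodule.mem_sup_right (mapp_mem_lattice₁ _ hq))
  have := E.eulerChar_add_mul hr ℓ i (eulerChar (L.bundle i))
  rw [← hj, eulerChar_eq_zero (E.isLocallyFree j) h0' h1'] at this
  omega

theorem IsDirectSumOfCopies.isSemistable (hr : 0 < r) (ℓ : LinearEquation x) (hL : L.rank = 1)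
    (h : E.IsDirectSumOfCopies L n) : E.IsSemistable := by
  intro F f hf hF
  have hinj (i : ℤ) (V : (P1 k).Opens) : Function.Injective (mapp (comp f.hom i) V) :=
    have : Mono (comp f.hom i) := (hf i).1
    mapp_injective_of_mono _ V
  have hle : F.rank ≤ E.rank := rank_le_of_injective (F.isLocallyFreeOfRank_bundle hr ℓ 0)
    (E.isLocallyFreeOfRank_bundle hr ℓ 0) _ (hinj 0 _)
  have hF' (i : ℤ) : eulerChar (F.bundle i) ≤ F.rank * eulerChar (L.bundle i) := by
    have h0 := (h.eulerChar_eq hr ℓ hL i).1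
    have h1 : globalSections (F.bundle (i + r * eulerChar (L.bundle i))) = ⊥ := by
      refine (Submodule.eq_bot_iff _).2 fun w hw ↦ ?_
      have := mapp_mem_globalSections (comp f.hom _) hw
      rw [h0] at this
      exact (map_eq_zero_iff _ (hinj _ _)).1 this
    have := F.eulerChar_add_mul hr ℓ i (eulerChar (L.bundle i))
    have := eulerChar_nonpos (F.isLocallyFree _) h1
    omega
  rw [slope_le_slope_iff hr hF (hF.trans_le hle)]
  simp_rw [fun i : ℕ ↦ (h.eulerChar_eq hr ℓ hL i).2]
  rw [← Finset.mul_sum, mul_comm, mul_assoc]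
  refine mul_le_mul_of_nonneg_left ?_ (by positivity)
  rw [Finset.sum_mul]
  exact Finset.sum_le_sum fun i _ ↦ (hF' i).trans_eq (mul_comm _ _)

end ParabolicBundle

/-! ### Cokernels of nowhere vanishing sections -/

section Cokernel

variable {X : Scheme.{u}} {K M N : X.Modules} {U : X.Opens} {d : ℕ}

/-- Sections of a direct sum of two sheaves, in terms of the sections of the summands. -/
theorem mapp_biprod_bijective (α : K ⟶ M) (β : N ⟶ M)
    (h : Function.Bijective fun w : Γ(K, U) × Γ(N, U) ↦ mapp α U w.1 + mapp β U w.2) :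
    Function.Bijective (mapp (biprod.desc α β) U) := by
  have hs (w : Γ(K ⊞ N, U)) : w = mapp biprod.inl U (mapp (biprod.fst : K ⊞ N ⟶ K) U w) +
      mapp biprod.inr U (mapp (biprod.snd : K ⊞ N ⟶ N) U w) := by
    conv_lhs => rw [← mapp_id w, ← biprod.total, mapp_add]
    rfl
  have hl (v : Γ(K, U)) : mapp (biprod.desc α β) U (mapp biprod.inl U v) = mapp α U v :=
    congrArg (fun ψ ↦ mapp ψ U v) (biprod.inl_desc α β)
  have hr (v : Γ(N, U)) : mapp (biprod.desc α β) U (mapp biprod.inr U v) = mapp β U v :=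
    congrArg (fun ψ ↦ mapp ψ U v) (biprod.inr_desc α β)
  have hd (w : Γ(K ⊞ N, U)) : mapp (biprod.desc α β) U w =
      mapp α U (mapp (biprod.fst : K ⊞ N ⟶ K) U w) +
        mapp β U (mapp (biprod.snd : K ⊞ N ⟶ N) U w) := by
    conv_lhs => rw [hs w, map_add, hl, hr]
  refine ⟨fun v w hvw ↦ ?_, fun s ↦ ?_⟩
  · rw [hd, hd] at hvw
    have := h.1 (a₁ := (_, _)) (a₂ := (_, _)) hvw
    rw [hs v, hs w]
    exact congrArg₂ (fun a b ↦ mapp biprod.inl U a + mapp biprod.inr U b)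
      (congrArg Prod.fst this) (congrArg Prod.snd this)
  · obtain ⟨w, rfl⟩ := h.2 s
    refine ⟨mapp biprod.inl U w.1 + mapp biprod.inr U w.2, ?_⟩
    rw [map_add, hl, hr]

/-- If the image of a generator of `K` is part of a frame, then the other members of the frame
trivialize the cokernel. -/
theorem nonempty_cokernel_iso_power (φ : K ⟶ M) {g : Γ(K, ⊤)}
    (hg : IsFrame K ⊤ fun _ : Fin 1 ↦ g) {e : Fin d → Γ(M, ⊤)}
    (he : IsFrame M ⊤ (Fin.cons (mapp φ ⊤ g) e : Fin (d + 1) → Γ(M, ⊤))) :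
    Nonempty (cokernel φ ≅ power (structureModule X) d) := by
  let ψ : power (structureModule X) d ⟶ M := biproduct.desc fun i ↦ homOfTopSection (e i)
  obtain ⟨f, hf, hψ⟩ : ∃ f : Fin d → Γ(power (structureModule X) d, ⊤),
      IsFrame (power (structureModule X) d) ⊤ f ∧ ∀ i, mapp ψ ⊤ (f i) = e i := by
    refine ⟨_, isFrame_power X d, fun i ↦ ?_⟩
    refine (congrArg (fun ψ ↦ mapp ψ ⊤ (functionSection ⊤ 1)) (biproduct.ι_desc
      (fun i ↦ homOfTopSection (e i)) i)).trans ?_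
    rw [mapp_homOfTopSection, one_smul, mres_self]
  have hsum (V : X.Opens) (a : Γ(X, V)) (b : Fin d → Γ(X, V)) :
      mapp φ V (a • mres K le_top g) + mapp ψ V (∑ i, b i • mres _ le_top (f i)) =
        ∑ i, (Fin.cons a b : Fin (d + 1) → Γ(X, V)) i •
          mres M le_top ((Fin.cons (mapp φ ⊤ g) e : Fin (d + 1) → Γ(M, ⊤)) i) := by
    rw [Fin.sum_univ_succ, map_smul, mapp_mres, map_sum]
    simp_rw [map_smul, mapp_mres, hψ, Fin.cons_zero, Fin.cons_succ]
  have hbij (V : X.Opens) : Function.Bijective (mapp (biprod.desc φ ψ) V) := by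
    refine mapp_biprod_bijective φ ψ ⟨?_, fun s ↦ ?_⟩
    · rintro ⟨v, w⟩ ⟨v', w'⟩ h
      obtain ⟨a, rfl⟩ := hg.exists_eq_smul le_top v
      obtain ⟨a', rfl⟩ := hg.exists_eq_smul le_top v'
      obtain ⟨b, rfl⟩ := hf.exists_eq le_top w
      obtain ⟨b', rfl⟩ := hf.exists_eq le_top w'
      have h1 := he.eq_of_sum_eq le_top (((hsum V a b).symm.trans h).trans (hsum V a' b'))
      rw [Fin.cons_inj] at h1
      rw [h1.1, h1.2]
    · obtain ⟨c, rfl⟩ := he.exists_eq le_top s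
      refine ⟨(c 0 • mres K le_top g, ∑ i, Fin.tail c i • mres _ le_top (f i)), ?_⟩
      refine (hsum V (c 0) (Fin.tail c)).trans ?_
      rw [Fin.cons_self_tail]
  have : IsIso (biprod.desc φ ψ) := isIso_of_mapp_bijective _ hbij
  exact ⟨cokernelIsoOfEq (biprod.inl_desc φ ψ).symm ≪≫ cokernelCompIsIso _ _ ≪≫
    cokernelBiprodInlIso⟩

/-- A morphism from a line bundle whose image is locally generated by part of a frame is the
inclusion of a subbundle. -/
theorem isLocallyFreeOfRank_cokernel (φ : K ⟶ M)
    (h : ∀ p : X, ∃ (U : X.Opens) (g : Γ(K, U)) (e : Fin d → Γ(M, U)), p ∈ U ∧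
      IsFrame K U (fun _ : Fin 1 ↦ g) ∧
        IsFrame M U (Fin.cons (mapp φ U g) e : Fin (d + 1) → Γ(M, U))) :
    IsLocallyFreeOfRank (cokernel φ) d := by
  intro p
  obtain ⟨U, g, e, hp, hg, he⟩ := h p
  have hU : U.ι ''ᵁ ⊤ ≤ U := by simp
  have he' := he.mono hU
  have h1 : (fun i ↦ mres M hU ((Fin.cons (mapp φ U g) e : Fin (d + 1) → Γ(M, U)) i)) =
      (Fin.cons (mapp φ (U.ι ''ᵁ ⊤) (mres K hU g)) fun i ↦ mres M hU (e i) :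
        Fin (d + 1) → Γ(M, U.ι ''ᵁ ⊤)) := by
    ext i
    refine Fin.cases ?_ (fun i ↦ ?_) i
    · rw [Fin.cons_zero, Fin.cons_zero, mapp_mres]
    · rw [Fin.cons_succ, Fin.cons_succ]
  rw [h1] at he'
  obtain ⟨γ⟩ := nonempty_cokernel_iso_power ((Scheme.Modules.restrictFunctor U.ι).map φ)
    (isFrame_restrict_iff.2 (hg.mono hU)) (isFrame_restrict_iff.2 he')
  exact ⟨U, hp, ⟨PreservesCokernel.iso (Scheme.Modules.restrictFunctor U.ι) φ ≪≫ γ⟩⟩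

theorem mono_of_isFrame (φ : K ⟶ M)
    (h : ∀ p : X, ∃ (U : X.Opens) (g : Γ(K, U)) (e : Fin d → Γ(M, U)), p ∈ U ∧
      IsFrame K U (fun _ : Fin 1 ↦ g) ∧
        IsFrame M U (Fin.cons (mapp φ U g) e : Fin (d + 1) → Γ(M, U))) : Mono φ := by
  choose U g e hp hg he using h
  refine mono_of_mapp_injective φ fun V ↦ (injective_iff_map_eq_zero _).2 fun s hs ↦ ?_
  refine section_ext (fun p : X ↦ V ⊓ U p) V (fun _ ↦ inf_le_left)
    (fun p hp' ↦ Opens.mem_iSup.2 ⟨p, hp', hp p⟩) fun p ↦ ?_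
  obtain ⟨a, ha⟩ := (hg p).exists_eq_smul inf_le_right (mres K (inf_le_left : V ⊓ U p ≤ V) s)
  have h1 := congrArg (mres M (inf_le_left : V ⊓ U p ≤ V)) hs
  rw [← mapp_mres, ha, map_smul, mapp_mres, map_zero] at h1
  have h2 := (he p).eq_of_sum_eq inf_le_right (a := Fin.cons a 0) (b := 0) (by
    rw [Fin.sum_univ_succ]
    simp [h1])
  rw [ha, show a = 0 from congrFun h2 0, zero_smul, map_zero]

end Cokernel

/-! ### Unimodular vectors over principal ideal domains -/

section Unimodular

variable {A : Type*} [CommRing A] [IsDomain A] [IsPrincipalIdealRing A] {N : Type*}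
  [AddCommGroup N] [Module A N] [Module.IsTorsionFree A N]

/-- A vector that no prime divides is saturated. -/
theorem exists_eq_smul_of_forall_prime {w : N} (hw : ∀ p : A, Prime p → ∀ v : N, w ≠ p • v) (a : A) :
    a ≠ 0 → ∀ (b : A) (v : N), a • v = b • w → ∃ c : A, v = c • w := by
  induction a using UniqueFactorizationMonoid.induction_on_prime with
  | h₁ => exact fun h ↦ absurd rfl h
  | h₂ u hu =>
    obtain ⟨u, rfl⟩ := hu
    intro _ b v h
    refine ⟨↑u⁻¹ * b, ?_⟩
    rw [mul_smul, ← h, smul_smul, Units.inv_mul, one_smul]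
  | h₃ a p ha hp ih =>
    intro _ b v h
    rw [mul_smul] at h
    by_cases hpb : p ∣ b
    · obtain ⟨b', rfl⟩ := hpb
      rw [mul_smul] at h
      exact ih ha b' v (smul_right_injective N hp.ne_zero h)
    · -- otherwise `p` and `b` are coprime, and `p` divides `w`
      obtain ⟨u, z, huz⟩ := (hp.irreducible.coprime_iff_not_dvd).2 hpb
      refine absurd ?_ (hw p hp (u • w + z • a • v))
      rw [smul_add, smul_comm p z, h, smul_smul, smul_smul, ← add_smul, mul_comm p u, huz, one_smul]

/-- A saturated vector is part of a basis. -/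
theorem exists_basis_of_forall_prime [Module.Finite A N] {w : N} (hw0 : w ≠ 0)
    (hw : ∀ p : A, Prime p → ∀ v : N, w ≠ p • v) : ∃ (d : ℕ) (e : Fin d → N),
      LinearIndependent A (Fin.cons w e : Fin (d + 1) → N) ∧
        Submodule.span A (Set.range (Fin.cons w e : Fin (d + 1) → N)) = ⊤ := by
  let Q := N ⧸ Submodule.span A {w}
  have : Module.IsTorsionFree A Q := by
    refine ⟨fun a ha ↦ (injective_iff_map_eq_zero (LinearMap.lsmul A Q a)).2 fun q hq ↦ ?_⟩
    obtain ⟨v, rfl⟩ := Submodule.Quotient.mk_surjective _ q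
    obtain ⟨b, hb⟩ := Submodule.mem_span_singleton.1 ((Submodule.Quotient.mk_eq_zero _).1 hq)
    obtain ⟨c, rfl⟩ := exists_eq_smul_of_forall_prime hw a ha.ne_zero b v hb.symm
    exact (Submodule.Quotient.mk_eq_zero _).2 (Submodule.mem_span_singleton.2 ⟨c, rfl⟩)
  obtain ⟨d, b⟩ := Module.basisOfFiniteTypeTorsionFree' (R := A) (M := Q)
  choose e he using fun i ↦ Submodule.Quotient.mk_surjective _ (b i)
  have hmk (c : Fin d → A) : (Submodule.span A {w}).mkQ (∑ i, c i • e i) = ∑ i, c i • b i := by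
    simp_rw [map_sum, map_smul, ← he]
    rfl
  refine ⟨d, e, ?_, top_le_iff.1 fun v _ ↦ ?_⟩
  · rw [Fintype.linearIndependent_iff]
    intro c hc
    rw [Fin.sum_univ_succ, Fin.cons_zero] at hc
    simp_rw [Fin.cons_succ] at hc
    have h1 := congrArg (Submodule.span A {w}).mkQ hc
    rw [map_add, hmk, map_smul, Submodule.mkQ_apply, (Submodule.Quotient.mk_eq_zero _).2
      (Submodule.mem_span_singleton_self w), smul_zero, zero_add, map_zero] at h1
    have h2 := Fintype.linearIndependent_iff.1 b.linearIndependent _ h1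
    simp_rw [h2, zero_smul, Finset.sum_const_zero, add_zero] at hc
    exact Fin.cases ((smul_eq_zero_iff_left hw0).1 hc) h2
  · have h1 := b.sum_repr ((Submodule.span A {w}).mkQ v)
    rw [← hmk, ← sub_eq_zero, ← map_sub, Submodule.mkQ_apply, Submodule.Quotient.mk_eq_zero] at h1
    obtain ⟨a, ha⟩ := Submodule.mem_span_singleton.1 h1
    refine (Submodule.mem_span_range_iff_exists_fun A).2
      ⟨Fin.cons (-a) fun i ↦ b.repr ((Submodule.span A {w}).mkQ v) i, ?_⟩
    rw [Fin.sum_univ_succ]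
    simp_rw [Fin.cons_zero, Fin.cons_succ]
    rw [neg_smul, ha]
    abel

end Unimodular
namespace ParabolicBundle

/-! ### Morphisms from a parabolic line bundle -/

section LineHom

variable {k : Type u} [Field k] {x : P1 k} {r : ℕ} (E : ParabolicBundle (P1 k) x r)
  (ℓ : LinearEquation x) (hr : 0 < r) {m i j : ℤ}

variable (r) in
/-- The translate of `i` by a multiple of the period that lies in `(m - r, m]`. -/
def lineBase (m i : ℤ) : ℤ := i + r * lineDegree r m i

theorem lineBase_le (m i : ℤ) (hr : 0 < r) : lineBase r m i ≤ m := by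
  have := Int.mul_ediv_self_le (x := m - i) (k := r) (by omega)
  rw [lineBase, lineDegree]
  omega

theorem lt_lineBase (m i : ℤ) (hr : 0 < r) : m - r < lineBase r m i := by
  have := Int.lt_mul_ediv_self_add (x := m - i) (k := r) (by omega)
  rw [lineBase, lineDegree]
  omega

theorem exists_shiftEquiv (m i : ℤ) (c : Fin 2) :
    ∃ κ : Γ(E.bundle (lineBase r m i), chart k c) ≃ₗ[Γ(P1 k, chart k c)] Γ(E.bundle i, chart k c),
      ∀ (w) (l : ℤ) (hi : l ≤ i) (hm : l ≤ lineBase r m i) (p q : ℕ),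
        (q : ℤ) = p + lineDegree r m i →
          ℓ.eqn c ^ q • mapp (E.incl hi) _ (κ w) = ℓ.eqn c ^ p • mapp (E.incl hm) _ w := by
  obtain ⟨κ, hκ⟩ := E.exists_equiv (ℓ.isLocal c) le_rfl (chart_ne_bot c) (lineDegree r m i)
    (i := i) rfl
  simp only [ores_self] at hκ
  exact ⟨κ, hκ⟩

/-- Sections of `E_{i'/r}`, where `i' = i + r b` is the translate of `i` in `(m - r, m]`, are
`ℓ ^ b` times the sections of `E_{i/r}`. -/
def shiftEquiv (m i : ℤ) (c : Fin 2) :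
    Γ(E.bundle (lineBase r m i), chart k c) ≃ₗ[Γ(P1 k, chart k c)] Γ(E.bundle i, chart k c) :=
  (E.exists_shiftEquiv ℓ m i c).choose

theorem shiftEquiv_spec (m i : ℤ) (c : Fin 2) (w : Γ(E.bundle (lineBase r m i), chart k c)) {l : ℤ}
    (hi : l ≤ i) (hm : l ≤ lineBase r m i) {p q : ℕ} (hq : (q : ℤ) = p + lineDegree r m i) :
    ℓ.eqn c ^ q • mapp (E.incl hi) _ (E.shiftEquiv ℓ m i c w) =
      ℓ.eqn c ^ p • mapp (E.incl hm) _ w :=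
  (E.exists_shiftEquiv ℓ m i c).choose_spec w l hi hm p q hq

/-- A section of `E_{m/r}` over a chart, divided by `ℓ ^ b` with `b = lineDegree r m i`, so as to be
a section of `E_{i/r}`. -/
def lineSection (m i : ℤ) (c : Fin 2) (s : Γ(E.bundle m, chart k c)) : Γ(E.bundle i, chart k c) :=
  E.shiftEquiv ℓ m i c (mapp (E.incl (lineBase_le m i hr)) _ s)

/-- Both sections are compared in a component `E_{l/r}` into which they map, after multiplication by
powers of `ℓ` whose exponents differ by `lineDegree r m i`, as this integer may be negative. -/
theorem lineSection_spec (m i : ℤ) (c : Fin 2) (s : Γ(E.bundle m, chart k c)) {l : ℤ}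
    (hi : l ≤ i) (hm : l ≤ m - r) {p q : ℕ} (hq : (q : ℤ) = p + lineDegree r m i) :
    ℓ.eqn c ^ q • mapp (E.incl hi) _ (E.lineSection ℓ hr m i c s) =
      ℓ.eqn c ^ p • mapp (E.incl (hm.trans (by omega))) _ s := by
  rw [lineSection, E.shiftEquiv_spec ℓ m i c _ hi (hm.trans (lt_lineBase m i hr).le) hq,
    incl_incl_apply]

theorem incl_lineSection (h : i ≤ j) (c : Fin 2) (s : Γ(E.bundle m, chart k c)) :
    mapp (E.incl h) _ (E.lineSection ℓ hr m j c s) =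
      ℓ.eqn c ^ (lineDegree r m i - lineDegree r m j).toNat • E.lineSection ℓ hr m i c s := by
  have hb := lineDegree_eq_add (r := r) m h
  have hl : min i (m - r) ≤ i := min_le_left _ _
  have hl' : min i (m - r) ≤ m - r := min_le_right _ _
  obtain ⟨p, q, hq⟩ : ∃ p q : ℕ, (q : ℤ) = p + lineDegree r m j :=
    ⟨(-lineDegree r m j).toNat, (lineDegree r m j).toNat, by omega⟩
  have e1 := E.lineSection_spec ℓ hr m j c s (hl.trans h) hl' hq
  have e2 := E.lineSection_spec ℓ hr m i c s hl hl'
    (q := q + (lineDegree r m i - lineDegree r m j).toNat) (p := p) (by push_cast; omega)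
  refine E.incl_injective hr hl _ (smul_injective (E.isLocallyFree _) (chart_ne_bot c)
    (pow_ne_zero q (ℓ.isLocal c).ne_zero) ?_)
  dsimp only
  rw [map_smul, smul_smul, ← pow_add, e2, ← e1, incl_incl_apply]

/-- If `s` is a global section of `E_{m/r}`, then the `lineSection`s differ by the transition
function of `𝒪(lineDegree r m i)`, as the local equations of `x` satisfy `ℓ₀ = t ℓ₁`. -/
theorem lineSection_compat {s : ∀ c, Γ(E.bundle m, chart k c)}
    (hs : mres (E.bundle m) (V := overlap k) inf_le_left (s 0) = mres _ inf_le_right (s 1)) (i : ℤ) :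
    mres (E.bundle i) (V := overlap k) inf_le_right (E.lineSection ℓ hr m i 1 (s 1)) =
      (↑(tUnit k ^ lineDegree r m i) : Γ(P1 k, overlap k)) •
        mres _ inf_le_left (E.lineSection ℓ hr m i 0 (s 0)) := by
  have hl : min i (m - r) ≤ i := min_le_left _ _
  have hl' : min i (m - r) ≤ m - r := min_le_right _ _
  obtain ⟨p, q, hq⟩ : ∃ p q : ℕ, (q : ℤ) = p + lineDegree r m i :=
    ⟨(-lineDegree r m i).toNat, (lineDegree r m i).toNat, by omega⟩
  have e0 := congrArg (mres _ (inf_le_left : overlap k ≤ _))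
    (E.lineSection_spec ℓ hr m i 0 (s 0) hl hl' hq)
  have e1 := congrArg (mres _ (inf_le_right : overlap k ≤ _))
    (E.lineSection_spec ℓ hr m i 1 (s 1) hl hl' hq)
  rw [mres_smul, mres_smul, map_pow, map_pow, ← mapp_mres, ← mapp_mres] at e0 e1
  rw [hs, ℓ.compat] at e0
  have hne := ores_eqn_ne_zero ℓ (inf_le_right : overlap k ≤ chart k 1) overlap_ne_bot
  set u := ores (inf_le_right : overlap k ≤ _) (ℓ.eqn 1)
  have hT : (tCoord k ^ q : Γ(P1 k, overlap k)) = tCoord k ^ p * ↑(tUnit k ^ lineDegree r m i) := by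
    have : tUnit k ^ q = tUnit k ^ p * tUnit k ^ lineDegree r m i := by
      rw [← zpow_natCast, ← zpow_natCast, ← zpow_add, hq]
    exact congrArg Units.val this
  refine E.incl_injective hr hl _ (smul_injective (E.isLocallyFree _) overlap_ne_bot
    (pow_ne_zero q hne) ?_)
  dsimp only
  rw [e1]
  have e2 : (tCoord k ^ p : Γ(P1 k, overlap k)) • (u ^ q •
      mapp (E.incl hl) _ ((↑(tUnit k ^ lineDegree r m i) : Γ(P1 k, overlap k)) •
        mres _ inf_le_left (E.lineSection ℓ hr m i 0 (s 0)))) =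
      (tCoord k ^ p : Γ(P1 k, overlap k)) •
        (u ^ p • mapp (E.incl (hl'.trans (by omega))) _ (mres _ (inf_le_right : overlap k ≤ _) (s 1))) := by
    rw [mul_pow, mul_pow, mul_smul, mul_smul] at e0
    rw [map_smul, smul_comm (u ^ q), smul_smul, ← hT]
    exact e0
  exact ((tUnit k ^ p).isUnit.smul_left_cancel.1 e2).symm

/-- A global section of `E_{m/r}` defines a morphism from the parabolic line bundle that jumps at
`m / r`. -/
theorem exists_natTrans_lineFunctor {s : ∀ c, Γ(E.bundle m, chart k c)}
    (hs : mres (E.bundle m) (V := overlap k) inf_le_left (s 0) = mres _ inf_le_right (s 1)) :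
    ∃ φ : (lineBundle ℓ hr m).functor ⟶ E.functor, ∀ i c,
      mapp (comp φ i) _ (serreGen k (lineDegree r m i) c) = E.lineSection ℓ hr m i c (s c) := by
  choose φ hφ using fun i ↦ exists_hom_serreTwist (lineDegree r m i)
    (fun c ↦ E.lineSection ℓ hr m i c (s c)) (E.lineSection_compat ℓ hr hs i)
  refine ⟨{ app := fun i ↦ φ i.unop, naturality := fun j i f ↦ ?_ }, hφ⟩
  have h := leOfHom f.unop
  change (lineBundle ℓ hr m).incl h ≫ φ i.unop = φ j.unop ≫ E.incl h
  refine hom_ext_of_frames iSup_chart (isFrame_serreGen _) fun c ↦ ?_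
  refine (congrArg (mapp (φ i.unop) _) (lineBundle_incl_serreGen ℓ hr m h c)).trans ?_
  rw [map_smul, hφ]
  refine (E.incl_lineSection ℓ hr h c (s c)).symm.trans ?_
  exact congrArg (mapp (E.incl h) _) (hφ _ _).symm

end LineHom
end ParabolicBundle

/-! ### Nowhere vanishing sections -/

section NowhereVanishing

variable {k : Type u} [Field k] [IsAlgClosed k] {M : (P1 k).Modules} {n d : ℕ}

theorem exists_eq_coordinate_sub_mul {i j : Fin 2} (hij : i ≠ j) {p : Γ(P1 k, chart k i)}
    (hp : Prime p) : ∃ (a : k) (q : Γ(P1 k, chart k i)),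
      p = (coordinate k i j - scalars k _ a) * q := by
  let e : Polynomial k ≃+* Γ(P1 k, chart k i) := .ofBijective _ (chartEval_bijective hij)
  obtain ⟨P, rfl⟩ := e.surjective p
  have hP : Prime P := (MulEquiv.prime_iff e).1 hp
  obtain ⟨a, ha⟩ := IsAlgClosed.exists_root P
    (Polynomial.degree_pos_of_irreducible hP.irreducible).ne'
  obtain ⟨Q, rfl⟩ := Polynomial.dvd_iff_isRoot.2 ha
  refine ⟨a, e Q, ?_⟩
  rw [map_mul, map_sub]
  exact congrArg₂ (fun f g ↦ (f - g) * e Q) (chartEval_X i j) (chartEval_C i j a)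

/-- If no nonzero global section of `M` vanishes to first order at `t⁻¹ = 0`, then nonzero global
sections vanish nowhere, as any two points of the projective line are linearly equivalent. -/
theorem ne_prime_smul (hM : IsLocallyFreeOfRank M n)
    (hinf : lattice₀ M ⊓ (lattice₁ M).comap (mulT M).toLinearMap = ⊥)
    {s : ∀ c, Γ(M, chart k c)}
    (hs : mres M (V := overlap k) inf_le_left (s 0) = mres M inf_le_right (s 1))
    {c : Fin 2} (hs0 : s c ≠ 0) (p : Γ(P1 k, chart k c)) (hp : Prime p) (v : Γ(M, chart k c)) :
    s c ≠ p • v := by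
  rintro h
  match c with
  | 0 =>
    obtain ⟨a, q, rfl⟩ := exists_eq_coordinate_sub_mul zero_ne_one hp
    have h1 := congrArg (mres M (inf_le_left : overlap k ≤ chart k 0)) h
    rw [mul_smul, mres_smul, map_sub, sub_smul, ores_scalars] at h1
    refine hs0 (mres_injective hM inf_le_left overlap_ne_bot (Eq.trans ?_ (map_zero _).symm))
    exact eq_zero_of_eq_sub (T := mulT M) (isLattice₁ hM) hinf ⟨s 1, hs.symm⟩ ⟨q • v, rfl⟩ a h1
  | 1 =>
    obtain ⟨a, q, rfl⟩ := exists_eq_coordinate_sub_mul one_ne_zero hp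
    have h1 := congrArg (mres M (inf_le_right : overlap k ≤ chart k 1)) h
    rw [mul_smul, mres_smul, map_sub, sub_smul, ores_scalars] at h1
    refine hs0 (mres_injective hM inf_le_right overlap_ne_bot (Eq.trans ?_ (map_zero _).symm))
    refine eq_zero_of_eq_sub (T := (mulT M).symm) (M₀ := lattice₁ M) (isLattice₀ hM) ?_
      ⟨s 0, hs⟩ ⟨q • v, rfl⟩ a h1
    refine (Submodule.eq_bot_iff _).2 fun w hw ↦ ?_
    have h2 : (mulT M).symm w ∈ lattice₀ M ⊓ (lattice₁ M).comap (mulT M).toLinearMap := by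
      refine ⟨hw.2, ?_⟩
      change mulT M ((mulT M).symm w) ∈ lattice₁ M
      rw [LinearEquiv.apply_symm_apply]
      exact hw.1
    rw [hinf] at h2
    exact (map_eq_zero_iff _ (mulT M).symm.injective).1 ((Submodule.mem_bot k).1 h2)

/-- A section over a chart that no prime divides is part of a frame: the chart is the spectrum of a
principal ideal domain. -/
theorem exists_isFrame_cons {k : Type u} [Field k] {M : (P1 k).Modules}
    (hM : IsLocallyFreeOfRank M (d + 1)) {c : Fin 2}
    {w : Γ(M, chart k c)} (hw0 : w ≠ 0)
    (hw : ∀ p : Γ(P1 k, chart k c), Prime p → ∀ v : Γ(M, chart k c), w ≠ p • v) :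
    ∃ e : Fin d → Γ(M, chart k c),
      IsFrame M (chart k c) (Fin.cons w e : Fin (d + 1) → Γ(M, chart k c)) := by
  have hU := isAffineOpen_chart k c
  have := isDomain_sections (chart_ne_bot (k := k) c)
  have := finite_sections hM hU
  have := isTorsionFree_sections hM (chart_ne_bot c)
  obtain ⟨d', e, hli, hspan⟩ := exists_basis_of_forall_prime hw0 hw
  obtain ⟨e', he'⟩ := exists_isFrame_of_isPrincipalIdealRing hM hU (chart_ne_bot c)
  have h1 := Module.finrank_eq_card_basis (Module.Basis.mk hli hspan.ge)
  rw [Module.finrank_eq_card_basis he'.basis, Fintype.card_fin, Fintype.card_fin] at h1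
  obtain rfl : d = d' := by omega
  exact ⟨e, isFrame_of_span_eq_top hM hU hspan⟩

end NowhereVanishing

namespace ParabolicBundle

/-! ### Semistable parabolic bundles -/

section Semistable

variable {k : Type u} [Field k] [IsAlgClosed k] {x : P1 k} {r : ℕ}
  (E : ParabolicBundle (P1 k) x r) {m i : ℤ} {d : ℕ}

/-- For `i > m - r` the twist of `E_{i/r}` by a point, being `E_{i/r + 1}`, has no global sections. -/
theorem inf_comap_eq_bot {k : Type u} [Field k] {x : P1 k} (E : ParabolicBundle (P1 k) x r)
    (ℓ : LinearEquation x) (hm : ∀ j, m < j → globalSections (E.bundle j) = ⊥) (hi : m - r < i) :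
    lattice₀ (E.bundle i) ⊓ (lattice₁ (E.bundle i)).comap (mulT _).toLinearMap = ⊥ :=
  (E.globalSections_eq_bot_iff ℓ rfl).1 (hm (i + r) (by omega))

/-- A global section of `E_{m/r}`, where `m` is as large as possible, makes a parabolic line bundle
a subbundle. -/
theorem exists_isSubbundle_lineBundle (ℓ : LinearEquation x) (hr : 0 < r) (hE : E.rank = d + 1) (hm₀ : globalSections (E.bundle m) ≠ ⊥)
    (hm : ∀ j, m < j → globalSections (E.bundle j) = ⊥) :
    ∃ f : lineBundle ℓ hr m ⟶ E, IsSubbundle f := by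
  obtain ⟨w, ⟨⟨s₀, h₀⟩, s₁, h₁⟩, hw⟩ := Submodule.exists_mem_ne_zero_of_ne_bot hm₀
  let s : ∀ c, Γ(E.bundle m, chart k c) := Fin.cons s₀ (Fin.cons s₁ fun i ↦ i.elim0)
  have hs : mres (E.bundle m) (V := overlap k) inf_le_left (s 0) = mres _ inf_le_right (s 1) :=
    h₀.trans h₁.symm
  have hs0 (c : Fin 2) : s c ≠ 0 := by
    match c with
    | 0 =>
      rintro (h : s₀ = 0)
      exact hw (by rw [← h₀, h, map_zero])
    | 1 =>
      rintro (h : s₁ = 0)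
      exact hw (by rw [← h₁, h, map_zero])
  obtain ⟨φ, hφ⟩ := E.exists_natTrans_lineFunctor ℓ hr hs
  have hrank (i : ℤ) : IsLocallyFreeOfRank (E.bundle i) (d + 1) :=
    hE ▸ E.isLocallyFreeOfRank_bundle hr ℓ i
  have key (i : ℤ) (c : Fin 2) : ∃ e : Fin d → Γ(E.bundle i, chart k c), IsFrame (E.bundle i)
      (chart k c) (Fin.cons (E.lineSection ℓ hr m i c (s c)) e : Fin (d + 1) → _) := by
    have hincl := E.incl_injective hr (lineBase_le m i hr)
    have h1 := ne_prime_smul (hrank (lineBase r m i))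
      (E.inf_comap_eq_bot ℓ hm (lt_lineBase m i hr))
      (s := fun c ↦ mapp (E.incl (lineBase_le m i hr)) _ (s c)) (by rw [← mapp_mres, hs, mapp_mres])
      (c := c) fun h ↦ hs0 c (hincl _ (h.trans (map_zero _).symm))
    refine exists_isFrame_cons (hrank i) (fun h ↦ hs0 c (hincl _ ?_)) fun p hp v hv ↦
      h1 p hp ((E.shiftEquiv ℓ m i c).symm v) ?_
    · rw [map_zero]
      exact (map_eq_zero_iff _ (E.shiftEquiv ℓ m i c).injective).1 h
    · rw [← map_smul, LinearEquiv.eq_symm_apply]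
      exact hv
  have hfr (i : ℤ) (p : P1 k) : ∃ (U : (P1 k).Opens)
      (g : Γ((lineBundle ℓ hr m).bundle i, U)) (e : Fin d → Γ(E.bundle i, U)), p ∈ U ∧
      IsFrame ((lineBundle ℓ hr m).bundle i) U (fun _ : Fin 1 ↦ g) ∧
      IsFrame (E.bundle i) U (Fin.cons (mapp (comp φ i) U g) e : Fin (d + 1) → Γ(E.bundle i, U)) := by
    obtain ⟨c, hc⟩ := Opens.mem_iSup.1 ((iSup_chart (k := k)).ge (trivial : p ∈ (⊤ : (P1 k).Opens)))
    obtain ⟨e, he⟩ := key i c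
    exact ⟨_, serreGen k (lineDegree r m i) c, e, hc, isFrame_serreGen _ c, by rwa [hφ]⟩
  exact ⟨homOfNatTrans φ, fun i ↦ ⟨mono_of_isFrame _ (hfr i),
    d, isLocallyFreeOfRank_cokernel (comp φ i) (hfr i)⟩⟩

/-- The comparison of slopes forces the Euler characteristics of a semistable parabolic bundle to be
multiples of those of the parabolic line bundle. -/
theorem eulerChar_eq_zero_of_isSemistable (ℓ : LinearEquation x) (hr : 0 < r) (hE : E.rank = d + 1) (hss : E.IsSemistable)
    (hm₀ : globalSections (E.bundle m) ≠ ⊥)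
    (hm : ∀ j, m < j → globalSections (E.bundle j) = ⊥) (h₁ : m < i) (h₂ : i ≤ m + r) :
    eulerChar (E.bundle i) = 0 := by
  set L := lineBundle ℓ hr m
  have hL : L.rank = 1 := lineBundle_rank ℓ hr m
  obtain ⟨f, hf⟩ := E.exists_isSubbundle_lineBundle ℓ hr hE hm₀ hm
  have hslope := hss L f hf (by rw [hL]; exact one_pos)
  rw [slope_le_slope_iff hr (by rw [hL]; exact one_pos) (by rw [hE]; exact d.succ_pos), hL,
    Nat.cast_one, mul_one] at hslope
  let g (i : ℤ) : ℤ := eulerChar (L.bundle i) * E.rank - eulerChar (E.bundle i)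
  have hg (i b : ℤ) : g (i + r * b) = g i := by
    simp only [g]
    rw [L.eulerChar_add_mul hr ℓ, E.eulerChar_add_mul hr ℓ, hL]
    push_cast
    ring
  have hg' (i : ℤ) (h₁ : m < i) (h₂ : i ≤ m + r) : g i = - eulerChar (E.bundle i) := by
    simp only [g]
    rw [lineBundle_eulerChar ℓ hr h₁ h₂]
    ring
  have hnonneg (i : ℤ) : 0 ≤ g i := by
    have h1 := lineBase_le m i hr
    have h2 := lt_lineBase m i hr
    have h3 : lineBase r m i + r = i + r * (lineDegree r m i + 1) := by rw [lineBase]; ring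
    rw [← hg i (lineDegree r m i + 1), ← h3, hg' _ (by omega) (by omega)]
    have := eulerChar_nonpos (E.isLocallyFree (lineBase r m i + r)) (hm _ (by omega))
    omega
  have hsum : ∑ i ∈ Finset.Icc 1 r, g i = 0 := by
    refine le_antisymm ?_ (Finset.sum_nonneg fun i _ ↦ hnonneg i)
    simp only [g]
    rw [Finset.sum_sub_distrib, ← Finset.sum_mul]
    omega
  have hzero : g i = 0 := by
    have h3 : lineBase r r i = i + r * lineDegree r r i := rfl
    have h1 := lineBase_le r i hr
    have h2 := lt_lineBase r i hr
    rw [← hg i (lineDegree r r i), ← h3]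
    have h4 := (Finset.sum_eq_zero_iff_of_nonneg fun (i : ℕ) _ ↦ hnonneg i).1 hsum
      (lineBase r r i).toNat (Finset.mem_Icc.2 ⟨by omega, by omega⟩)
    rwa [Int.toNat_of_nonneg (by omega)] at h4
  have := hg' i h₁ h₂
  omega

end Semistable
end ParabolicBundle

/-! ### Splitting a semistable parabolic bundle -/

/-- Morphisms from a line bundle that carry a generator to the members of a frame identify the
target with a direct sum. -/
theorem mapp_biproduct_desc_bijective {X : Scheme.{u}} {L M : X.Modules} {U V : X.Opens} {n : ℕ}
    {g : Γ(L, U)} (hg : IsFrame L U fun _ : Fin 1 ↦ g) (φ : Fin n → (L ⟶ M))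
    (h : IsFrame M U fun a ↦ mapp (φ a) U g) (hV : V ≤ U) :
    Function.Bijective (mapp (biproduct.desc φ) V) := by
  refine mapp_biproduct_bijective φ ⟨fun v w hvw ↦ ?_, fun t ↦ ?_⟩
  · choose a ha using fun i ↦ hg.exists_eq_smul hV (v i)
    choose b hb using fun i ↦ hg.exists_eq_smul hV (w i)
    have : a = b := h.eq_of_sum_eq hV (by simpa only [ha, hb, map_smul, mapp_mres] using hvw)
    funext i
    rw [ha, hb, this]
  · obtain ⟨a, rfl⟩ := h.exists_eq hV t
    exact ⟨fun i ↦ a i • mres L hV g, by simp only [map_smul, mapp_mres]⟩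

namespace ParabolicBundle

section Splitting

variable {k : Type u} [Field k] {x : P1 k} {r : ℕ} (E : ParabolicBundle (P1 k) x r)
  {L : ParabolicBundle (P1 k) x r} {m i : ℤ} {n : ℕ}

variable {E} in
/-- Morphisms `L ⟶ E` that identify every component of `E` with a direct sum of copies of the
component of `L` make `E` a direct sum of copies of `L`. -/
theorem isDirectSumOfCopies_of_isIso (φ : Fin n → (L.functor ⟶ E.functor))
    (h : ∀ i, IsIso (biproduct.desc fun a ↦ comp (φ a) i)) : E.IsDirectSumOfCopies L n := by
  let Φ (i : ℤ) : (⨁ fun _ : Fin n ↦ L.bundle i) ⟶ E.bundle i := biproduct.desc fun a ↦ comp (φ a) i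
  have hΦ (i : ℤ) : IsIso (Φ i) := h i
  have hι (a : Fin n) (i : ℤ) : biproduct.ι (fun _ ↦ L.bundle i) a ≫ Φ i = comp (φ a) i :=
    biproduct.ι_desc _ a
  have hnat {i j : ℤ} (hij : i ≤ j) :
      Φ j ≫ E.incl hij = (biproduct.map fun _ ↦ L.incl hij) ≫ Φ i := by
    refine biproduct.hom_ext' _ _ fun a ↦ ?_
    rw [← Category.assoc, hι, ← incl_comp, ← Category.assoc, biproduct.ι_map, Category.assoc, hι]
  let q (b : Fin n) (i : ℤ) : E.bundle i ⟶ L.bundle i :=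
    inv (Φ i) ≫ biproduct.π (fun _ ↦ L.bundle i) b
  have hq (b : Fin n) {i j : ℤ} (hij : i ≤ j) : E.incl hij ≫ q b i = q b j ≫ L.incl hij := by
    rw [← cancel_epi (Φ j), ← Category.assoc, hnat, Category.assoc, IsIso.hom_inv_id_assoc,
      Category.assoc, IsIso.hom_inv_id_assoc, biproduct.map_π]
  have hcomp (a b : Fin n) (i : ℤ) : comp (φ a) i ≫ q b i =
      biproduct.ι (fun _ ↦ L.bundle i) a ≫ biproduct.π (fun _ ↦ L.bundle i) b := by
    rw [← hι, Category.assoc, IsIso.hom_inv_id_assoc]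
  have hsum (i : ℤ) : ∑ a, q a i ≫ comp (φ a) i = 𝟙 (E.bundle i) := by
    have h1 (a : Fin n) : q a i ≫ comp (φ a) i = inv (Φ i) ≫
        (biproduct.π (fun _ ↦ L.bundle i) a ≫ biproduct.ι (fun _ ↦ L.bundle i) a) ≫ Φ i := by
      rw [← hι, Category.assoc, Category.assoc]
    simp_rw [h1]
    rw [← Preadditive.comp_sum, ← Preadditive.sum_comp, biproduct.total, Category.id_comp,
      IsIso.inv_hom_id]
  let π (b : Fin n) : E.functor ⟶ L.functor :=
    { app := fun i ↦ q b i.unop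
      naturality := fun j i f ↦ hq b (leOfHom f.unop) }
  refine ⟨fun a ↦ homOfNatTrans (φ a), fun b ↦ homOfNatTrans (π b), fun a ↦ Hom.ext ?_,
    fun a b hab ↦ ?_, ?_⟩
  · ext ⟨i⟩ : 2
    exact (hcomp a a i).trans (biproduct.ι_π_self _ _)
  · ext ⟨i⟩ : 2
    exact (hcomp a b i).trans (biproduct.ι_π_ne _ hab)
  · ext ⟨i⟩ : 2
    exact (NatTrans.app_sum _ _ fun a ↦ π a ≫ φ a).trans (hsum i)

/-- Global sections of `E_{m/r}` that generate the components `E_{i/r}` for `m - r < i ≤ m` split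
`E` into a direct sum of parabolic line bundles. -/
theorem isDirectSumOfCopies_of_span_eq_top (ℓ : LinearEquation x) (hr : 0 < r) (hE : E.rank = n)
    {s : Fin n → ∀ c, Γ(E.bundle m, chart k c)}
    (hs : ∀ a, mres (E.bundle m) (V := overlap k) inf_le_left (s a 0) = mres _ inf_le_right (s a 1))
    (hspan : ∀ (i : ℤ) (hi : i ≤ m), m - r < i → ∀ c, Submodule.span Γ(P1 k, chart k c)
      (Set.range fun a ↦ mapp (E.incl hi) _ (s a c)) = ⊤) :
    E.IsDirectSumOfCopies (lineBundle ℓ hr m) n ∧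
      Nonempty (E.underlying ≅ power (serreTwist k (lineDegree r m 0)) n) := by
  choose φ hφ using fun a ↦ E.exists_natTrans_lineFunctor ℓ hr (hs a)
  have hfr (i : ℤ) (c : Fin 2) :
      IsFrame (E.bundle i) (chart k c) fun a ↦ E.lineSection ℓ hr m i c (s a c) := by
    refine isFrame_of_span_eq_top (hE ▸ E.isLocallyFreeOfRank_bundle hr ℓ i)
      (isAffineOpen_chart k c) ?_
    have h1 := congrArg (Submodule.map (E.shiftEquiv ℓ m i c).toLinearMap)
      (hspan _ (lineBase_le m i hr) (lt_lineBase m i hr) c)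
    rw [Submodule.map_span, ← Set.range_comp, Submodule.map_top, LinearEquiv.range] at h1
    exact h1
  have hiso (i : ℤ) : IsIso (biproduct.desc fun a ↦ comp (φ a) i) := by
    refine isIso_of_locally_bijective _ fun p ↦ ?_
    obtain ⟨c, hc⟩ := Opens.mem_iSup.1 ((iSup_chart (k := k)).ge (trivial : p ∈ (⊤ : (P1 k).Opens)))
    refine ⟨_, hc, fun V hV ↦ mapp_biproduct_desc_bijective (isFrame_serreGen _ c)
      (fun a ↦ comp (φ a) i) ?_ hV⟩
    have := hfr i c
    simp_rw [← hφ] at this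
    exact this
  have := hiso 0
  exact ⟨isDirectSumOfCopies_of_isIso φ hiso,
    ⟨(asIso (biproduct.desc fun a ↦ comp (φ a) 0)).symm⟩⟩

/-- If the components of `E` just above `m / r` have no cohomology, then every basis of the global
sections of `E_{m/r}` generates the components `E_{i/r}` with `m - r < i ≤ m`. -/
theorem exists_span_eq_top (ℓ : LinearEquation x) (hr : 0 < r) (hE : E.rank = n)
    (hm : ∀ j, m < j → globalSections (E.bundle j) = ⊥)
    (hχ : ∀ j, m < j → j ≤ m + r → eulerChar (E.bundle j) = 0) :
    ∃ s : Fin n → ∀ c, Γ(E.bundle m, chart k c),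
      (∀ a, mres (E.bundle m) (V := overlap k) inf_le_left (s a 0) = mres _ inf_le_right (s a 1)) ∧
      ∀ (i : ℤ) (hi : i ≤ m), m - r < i → ∀ c, Submodule.span Γ(P1 k, chart k c)
        (Set.range fun a ↦ mapp (E.incl hi) _ (s a c)) = ⊤ := by
  have hrank (i : ℤ) : IsLocallyFreeOfRank (E.bundle i) n :=
    hE ▸ E.isLocallyFreeOfRank_bundle hr ℓ i
  have hinf {i : ℤ} (hi : m - r < i) := E.inf_comap_eq_bot ℓ hm hi
  have hsup {i : ℤ} (hi : i ≤ m) (hi' : m - r < i) :=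
    (E.sup_eq_top_iff ℓ (i := i) rfl).1 (sup_eq_top_of_eulerChar (hrank _)
      (hm _ (by omega)) (hχ (i + r) (by omega) (by omega)))
  have hdim {i : ℤ} (hi : i ≤ m) (hi' : m - r < i) :
      Module.finrank k (globalSections (E.bundle i)) = n :=
    finrank_inf_of_twist_eq_top (isLattice₀ (hrank i)) (isLattice₁ (hrank i)) (hinf hi')
      (hsup hi hi')
  have hfin (i : ℤ) : Module.Finite k (globalSections (E.bundle i)) :=
    finite_inf (isLattice₀ (hrank i)) (isLattice₁ (hrank i))
  let b := Module.finBasisOfFinrankEq k _ (hdim le_rfl (by omega))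
  have hb (a : Fin n) : ∃ s : ∀ c, Γ(E.bundle m, chart k c),
      mres (E.bundle m) (V := overlap k) inf_le_left (s 0) = (b a).1 ∧
      mres (E.bundle m) (V := overlap k) inf_le_right (s 1) = (b a).1 := by
    obtain ⟨⟨s₀, h₀⟩, s₁, h₁⟩ := (b a).2
    exact ⟨Fin.cons s₀ (Fin.cons s₁ fun i ↦ i.elim0), h₀, h₁⟩
  choose s h₀ h₁ using hb
  refine ⟨s, fun a ↦ (h₀ a).trans (h₁ a).symm, fun i hi hi' c ↦ ?_⟩
  have hM := hrank i
  -- the sections of `E_{m/r}` are all the sections of `E_{i/r}`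
  have hsub (P : Submodule k Γ(E.bundle i, overlap k))
      (hP : ∀ a, mapp (E.incl hi) _ (b a).1 ∈ P) : lattice₀ (E.bundle i) ⊓ lattice₁ (E.bundle i) ≤ P := by
    let f : globalSections (E.bundle m) →ₗ[k] globalSections (E.bundle i) :=
      ((mapp (E.incl hi) (overlap k)).restrictScalars k).restrict
        fun w hw ↦ mapp_mem_globalSections _ hw
    have hf : Function.Injective f := fun v w hvw ↦
      Subtype.ext (E.incl_injective hr hi _ (congrArg Subtype.val hvw))
    have hf' := (LinearMap.injective_iff_surjective_of_finrank_eq_finrank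
      ((hdim le_rfl (by omega)).trans (hdim hi hi').symm)).1 hf
    intro w hw
    obtain ⟨v, hv⟩ := hf' ⟨w, hw⟩
    rw [← b.sum_repr v, map_sum] at hv
    have hv' := congrArg (Submodule.subtype _) hv
    rw [map_sum] at hv'
    refine Eq.subst (motive := (· ∈ P)) hv' (sum_mem fun a _ ↦ ?_)
    rw [map_smul, map_smul]
    exact P.smul_mem _ (hP a)
  let S (c : Fin 2) := Submodule.span Γ(P1 k, chart k c)
    (Set.range fun a ↦ mapp (E.incl hi) _ (s a c))
  have hmem (a : Fin n) (c : Fin 2) : mapp (E.incl hi) _ (s a c) ∈ S c :=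
    Submodule.subset_span ⟨a, rfl⟩
  match c with
  | 0 =>
    have hle := le_of_twist_eq_top (isLattice₀ hM) (isLattice₁ hM) (hsup hi hi')
      (((S 0).restrictScalars k).map (restrictSections (E.bundle i) inf_le_left))
      (hsub _ fun a ↦ ⟨_, hmem a 0, by rw [restrictSections_apply, ← mapp_mres, h₀]⟩) (by
        rintro _ ⟨y, hy, rfl⟩
        exact ⟨_, (S 0).smul_mem (coordinate k 0 1) hy, mres_smul _ _ _⟩)
    refine top_le_iff.1 fun y _ ↦ ?_
    obtain ⟨y', hy', h⟩ := hle ⟨y, rfl⟩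
    rwa [← mres_injective hM inf_le_left overlap_ne_bot h]
  | 1 =>
    have hle := le_of_twist_eq_top' (isLattice₀ hM) (isLattice₁ hM) (hsup hi hi')
      (((S 1).restrictScalars k).map (restrictSections (E.bundle i) inf_le_right))
      (hsub _ fun a ↦ ⟨_, hmem a 1, by rw [restrictSections_apply, ← mapp_mres, h₁]⟩) (by
        rintro _ ⟨y, hy, rfl⟩
        exact ⟨_, (S 1).smul_mem (coordinate k 1 0) hy, mres_smul _ _ _⟩)
    refine top_le_iff.1 fun y _ ↦ ?_
    obtain ⟨y', hy', h⟩ := hle ⟨y, rfl⟩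
    rwa [← mres_injective hM inf_le_right overlap_ne_bot h]

/-- The integer `m` is the greatest one for which `E_{m/r}` has a nonzero global section. -/
theorem IsSemistable.exists_isDirectSumOfCopies [IsAlgClosed k] (ℓ : LinearEquation x) (hr : 0 < r)
    (hE : E.rank = n) (hss : E.IsSemistable) :
    ∃ m, E.IsDirectSumOfCopies (lineBundle ℓ hr m) n ∧
      Nonempty (E.underlying ≅ power (serreTwist k (lineDegree r m 0)) n) := by
  obtain _ | d := n
  · refine ⟨0, E.isDirectSumOfCopies_of_span_eq_top ℓ hr hE (m := 0) (s := fun a ↦ a.elim0)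
      (fun a ↦ a.elim0) fun i hi _ c ↦ ?_⟩
    obtain ⟨e, he⟩ := exists_isFrame_of_isPrincipalIdealRing
      (hE ▸ E.isLocallyFreeOfRank_bundle hr ℓ i) (isAffineOpen_chart k c) (chart_ne_bot c)
    refine top_le_iff.1 fun v _ ↦ ?_
    obtain ⟨a, rfl⟩ := he.exists_eq le_rfl v
    exact sum_mem fun a _ ↦ a.elim0
  · obtain ⟨m, hm₀, hm⟩ := E.exists_greatest_globalSections hr ℓ (by rw [hE]; exact d.succ_pos)
    obtain ⟨s, hs, hspan⟩ := E.exists_span_eq_top ℓ hr hE hm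
      fun j h₁ h₂ ↦ E.eulerChar_eq_zero_of_isSemistable ℓ hr hE hss hm₀ hm h₁ h₂
    exact ⟨m, E.isDirectSumOfCopies_of_span_eq_top ℓ hr hE hs hspan⟩

end Splitting
end ParabolicBundle
end ParabolicP1

theorem mainTheorem4 {k : Type u} [Field k] [IsAlgClosed k] [CharZero k]
    (x : ParabolicP1.P1 k) (hx : IsClosed {x}) (r : ℕ) (hr : 0 < r) (n : ℕ)
    (E : ParabolicP1.ParabolicBundle (ParabolicP1.P1 k) x r) (hE : E.rank = n) :
    (E.IsSemistable ↔ ∃ L : ParabolicP1.ParabolicBundle (ParabolicP1.P1 k) x r,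
      L.rank = 1 ∧ E.IsDirectSumOfCopies L n) ∧
    (E.IsSemistable → ∃ a : ℤ,
      Nonempty (E.underlying ≅ ParabolicP1.power (ParabolicP1.serreTwist k a) n)) := by
  obtain ⟨ℓ⟩ := ParabolicP1.nonempty_linearEquation hx
  refine ⟨⟨fun h ↦ ?_, fun ⟨L, hL, h⟩ ↦ h.isSemistable hr ℓ hL⟩, fun h ↦ ?_⟩
  · obtain ⟨m, hm, -⟩ := h.exists_isDirectSumOfCopies E ℓ hr hE
    exact ⟨_, ParabolicP1.lineBundle_rank ℓ hr m, hm⟩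
  · obtain ⟨m, -, hm⟩ := h.exists_isDirectSumOfCopies E ℓ hr hE
    exact ⟨_, hm⟩
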